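/- Let $n\ge 1$, let $D\subset\subset\mathbb{C}^n$ be a bounded (weakly) pseudoconvex domain with boundary $bD$ of class $C^k$, $k\ge 3$, and let $\varphi$ be a $C^k$ defining function for $D$ on a neighborhood $U$ of $bD$ (that is, $D\cap U=\{z\in U:\varphi(z)<0\}$ and $d\varphi\ne0$ on $bD$; pseudoconvexity means that at every $\zeta\in bD$ the Levi form $\mathcal L(\varphi,\zeta;t)=\sum_{j,l}\frac{\partial^2\varphi}{\partial\zeta_j\partial\bar\zeta_l}(\zeta)t_j\bar t_l$ is $\ge0$ for all $t\in\mathbb{C}^n$ with $\sum_j\frac{\partial\varphi}{\partial\zeta_j}(\zeta)t_j=0$). For $C>0$ put $r(z)=\varphi(z)\exp(-C|z|^2)$. There are $C>0$ such that, for some neighborhood $V\subset U$ of $bD$, $$(*)\qquad \mathcal L(r,\zeta;t)\ge 0\ \text{ for all } \zeta\in\overline D\cap V \text{ and all } t\in\mathbb{C}^n \text{ with } \textstyle\sum_j\frac{\partial r}{\partial\zeta_j}(\zeta)t_j=0 .$$ Fix any $C>0$ with $(*)$. For $K>0$, $\varepsilon>0$ and a $C^\infty$ function $\chi:\mathbb{R}\to[0,1]$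 with $\chi(t)=1$ for $t\le\varepsilon/2$ and $\chi(t)=0$ for $t\ge\frac34\varepsilon$, define $$\Phi_K(\zeta,z)=\sum_j\frac{\partial r}{\partial\zeta_j}(\zeta)(\zeta_j-z_j)-\frac12\sum_{j,l}\frac{\partial^2r}{\partial\zeta_j\partial\zeta_l}(\zeta)(\zeta_j-z_j)(\zeta_l-z_l)-r(\zeta)+K|\zeta-z|^3,$$ $$g_j(\zeta,z)=\frac{\partial r}{\partial\zeta_j}(\zeta)-\frac12\sum_l\frac{\partial^2r}{\partial\zeta_j\partial\zeta_l}(\zeta)(\zeta_l-z_l)+K|\zeta-z|\,\overline{(\zeta_j-z_j)},$$ and, with $\chi=\chi(|\zeta-z|)$, $$S=\chi\,\Phi_K+(1-\chi)|\zeta-z|^2,\qquad s_j=\chi\, g_j+(1-\chi)\overline{(\zeta_j-z_j)},\qquad W^S=\frac{\sum_j s_j\,d\zeta_j}{S},$$ $$\Omega_0(W^S)=(2\pi i)^{-n}\,W^S\wedge(\overline\partial_\zeta W^S)^{n-1}.$$ Then there are $K_0>0$ and $\varepsilon_0>0$ such that for all $K\ge K_0$, all $0<\varepsilon\le\varepsilon_0$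 and all $\chi$ as above the following hold: $S(\zeta,z)\ne0$ for all $\zeta\in bD$, $z\in\overline D$ with $\zeta\neq z$; and for every $\alpha>0$ there is a constant $C_\alpha$ such that for every $z\in\overline D$ with $\operatorname{dist}(z,bD)<\varepsilon/2$ the function $|\zeta-z|^\alpha|\Omega_0(W^S)(\zeta,z)|$ is integrable over $bD$ and $$\int_{bD}|\zeta-z|^{\alpha}\,\bigl|\Omega_0(W^S)(\zeta,z)\bigr|\le C_\alpha .$$ Here $|\Omega_0(W^S)|$ is the density, with respect to surface measure on $bD$, of the absolute value of the pull-back to $bD$ of the form $\Omega_0(W^S)(\cdot,z)$. -/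

import Mathlib

open MeasureTheory
open scoped ContDiff

noncomputable section

namespace CauchyFantappie

/-- `ℂⁿ` with its Euclidean norm. -/
abbrev Cn (n : ℕ) : Type := EuclideanSpace ℂ (Fin n)

/-- The Wirtinger derivative `∂f/∂ζⱼ` at `ζ`. -/
def dz {n : ℕ} (j : Fin n) (f : Cn n → ℂ) (ζ : Cn n) : ℂ :=
  (1 / 2) * (fderiv ℝ f ζ (EuclideanSpace.single j 1)
    - Complex.I * fderiv ℝ f ζ (EuclideanSpace.single j Complex.I))

/-- The Wirtinger derivative `∂f/∂ζ̄ⱼ` at `ζ`. -/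
def dzbar {n : ℕ} (j : Fin n) (f : Cn n → ℂ) (ζ : Cn n) : ℂ :=
  (1 / 2) * (fderiv ℝ f ζ (EuclideanSpace.single j 1)
    + Complex.I * fderiv ℝ f ζ (EuclideanSpace.single j Complex.I))

/-- `∂r/∂ζⱼ` for a real-valued function `r`. -/
def dr {n : ℕ} (r : Cn n → ℝ) (j : Fin n) (ζ : Cn n) : ℂ :=
  dz j (fun x => (r x : ℂ)) ζ

/-- `∂²r/∂ζⱼ∂ζₖ` for a real-valued function `r`. -/
def ddr {n : ℕ} (r : Cn n → ℝ) (j k : Fin n) (ζ : Cn n) : ℂ :=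
  dz j (dz k (fun x => (r x : ℂ))) ζ

/-- The Levi form `∑ⱼₖ ∂²r/∂ζⱼ∂ζ̄ₖ (ζ) tⱼ t̄ₖ` (a real number for real-valued `r` of class `C²`). -/
def levi {n : ℕ} (r : Cn n → ℝ) (ζ t : Cn n) : ℝ :=
  (∑ j, ∑ k, dz j (dzbar k (fun x => (r x : ℂ))) ζ * t j * star (t k)).re

/-- The Levi form of `r` at `ζ` is positive semidefinite on the complex tangent space
`{t : ∑ⱼ ∂r/∂ζⱼ(ζ) tⱼ = 0}`. -/
def LeviNonneg {n : ℕ} (r : Cn n → ℝ) (ζ : Cn n) : Prop :=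
  ∀ t : Cn n, ∑ j, dr r j ζ * t j = 0 → 0 ≤ levi r ζ t

/-- `φ` is a `C^k` defining function for `D`, defined on the neighborhood `U` of `bD`. -/
structure IsDefiningFunction {n : ℕ} (k : ℕ∞) (D U : Set (Cn n)) (φ : Cn n → ℝ) : Prop where
  isOpen : IsOpen U
  frontier_subset : frontier D ⊆ U
  contDiffOn : ContDiffOn ℝ k φ U
  inter_eq : D ∩ U = {z ∈ U | φ z < 0}
  fderiv_ne_zero : ∀ ζ ∈ frontier D, fderiv ℝ φ ζ ≠ 0

/-- `D` is a bounded (weakly) pseudoconvex domain in `ℂⁿ` with `C^k` boundary, with the `C^k`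
defining function `φ` on `U`. -/
structure IsPseudoconvexDomain {n : ℕ} (k : ℕ∞) (D U : Set (Cn n)) (φ : Cn n → ℝ) : Prop where
  isOpen : IsOpen D
  isConnected : IsConnected D
  isBounded : Bornology.IsBounded D
  isDefiningFunction : IsDefiningFunction k D U φ
  leviNonneg : ∀ ζ ∈ frontier D, LeviNonneg φ ζ

/-- The modified defining function `r(z) = φ(z) exp(-C|z|²)`. -/
def modDef {n : ℕ} (φ : Cn n → ℝ) (C : ℝ) (z : Cn n) : ℝ :=
  φ z * Real.exp (-C * ‖z‖ ^ 2)

/-- The level surfaces of `r` in `D̄ ∩ V`, for some neighborhood `V ⊆ U` of `bD`, are Levi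
pseudoconvex. -/
def LevelsPseudoconvex {n : ℕ} (D U : Set (Cn n)) (r : Cn n → ℝ) : Prop :=
  ∃ V : Set (Cn n), IsOpen V ∧ frontier D ⊆ V ∧ V ⊆ U ∧ ∀ ζ ∈ closure D ∩ V, LeviNonneg r ζ

/-- The Levi polynomial `F^{(r)}(ζ, z)`. -/
def leviPoly {n : ℕ} (r : Cn n → ℝ) (ζ z : Cn n) : ℂ :=
  ∑ j, dr r j ζ * (ζ j - z j)
    - (1 / 2) * ∑ j, ∑ k, ddr r j k ζ * (ζ j - z j) * (ζ k - z k)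

/-- The support function `Φ_K(ζ, z) = F^{(r)}(ζ, z) - r(ζ) + K|ζ - z|³`. -/
def Phi {n : ℕ} (r : Cn n → ℝ) (K : ℝ) (ζ z : Cn n) : ℂ :=
  leviPoly r ζ z - r ζ + K * ‖ζ - z‖ ^ 3

/-- The coefficients `gⱼ` of the decomposition `Φ_K + r(ζ) = ∑ⱼ gⱼ (ζⱼ - zⱼ)`. -/
def gCoeff {n : ℕ} (r : Cn n → ℝ) (K : ℝ) (j : Fin n) (ζ z : Cn n) : ℂ :=
  dr r j ζ - (1 / 2) * ∑ k, ddr r j k ζ * (ζ k - z k) + K * ‖ζ - z‖ * star (ζ j - z j)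

/-- `χ` is a smooth cut-off function, `1` on `t ≤ ε/2` and `0` on `t ≥ 3ε/4`. -/
structure IsCutoff (ε : ℝ) (χ : ℝ → ℝ) : Prop where
  contDiff : ContDiff ℝ ∞ χ
  nonneg : ∀ t, 0 ≤ χ t
  le_one : ∀ t, χ t ≤ 1
  eq_one : ∀ t, t ≤ ε / 2 → χ t = 1
  eq_zero : ∀ t, 3 / 4 * ε ≤ t → χ t = 0

/-- The global support function `S = χ(|ζ-z|) Φ_K + (1 - χ(|ζ-z|)) |ζ-z|²`. -/
def S {n : ℕ} (r : Cn n → ℝ) (K : ℝ) (χ : ℝ → ℝ) (ζ z : Cn n) : ℂ :=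
  χ ‖ζ - z‖ * Phi r K ζ z + (1 - χ ‖ζ - z‖) * ‖ζ - z‖ ^ 2

/-- The coefficients `sⱼ = χ(|ζ-z|) gⱼ + (1 - χ(|ζ-z|)) conj (ζⱼ - zⱼ)`. -/
def sCoeff {n : ℕ} (r : Cn n → ℝ) (K : ℝ) (χ : ℝ → ℝ) (j : Fin n) (ζ z : Cn n) : ℂ :=
  χ ‖ζ - z‖ * gCoeff r K j ζ z + (1 - χ ‖ζ - z‖) * star (ζ j - z j)

/-- The coefficients `sⱼ / S` of the generating form `W^S = ∑ⱼ (sⱼ / S) dζⱼ`. -/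
def WS {n : ℕ} (r : Cn n → ℝ) (K : ℝ) (χ : ℝ → ℝ) (z : Cn n) (j : Fin n) (ζ : Cn n) : ℂ :=
  sCoeff r K χ j ζ z / S r K χ ζ z

/-- The value at `ζ`, on the tangent vector `v`, of the `(1,0)`-form `∑ⱼ wⱼ dζⱼ`. -/
def form10 {n : ℕ} (w : Fin n → Cn n → ℂ) (ζ v : Cn n) : ℂ :=
  ∑ j, w j ζ * v j

/-- The value at `ζ`, on the tangent vector `v`, of `∂̄f = ∑ₖ ∂f/∂ζ̄ₖ dζ̄ₖ`. -/
def dbarFun {n : ℕ} (f : Cn n → ℂ) (ζ v : Cn n) : ℂ :=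
  ∑ k, dzbar k f ζ * star (v k)

/-- The value at `ζ`, on the tangent vectors `u, v`, of the `(1,1)`-form
`∂̄(∑ⱼ wⱼ dζⱼ) = ∑ⱼ ∂̄wⱼ ∧ dζⱼ`. -/
def dbarForm {n : ℕ} (w : Fin n → Cn n → ℂ) (ζ u v : Cn n) : ℂ :=
  ∑ j, (dbarFun (w j) ζ u * v j - dbarFun (w j) ζ v * u j)

/-- The wedge product `α ∧ β^m` of a `1`-form `α` with the `m`-th wedge power of a `2`-form `β`,
in the normalization `(dx₁ ∧ ⋯ ∧ dxₚ)(v₁, …, vₚ) = det (dxᵢ(vⱼ))`. -/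
def wedgePow {n : ℕ} (α : Cn n → ℂ) (β : Cn n → Cn n → ℂ) (m : ℕ)
    (v : Fin (2 * m + 1) → Cn n) : ℂ :=
  (1 / 2 : ℂ) ^ m * ∑ σ : Equiv.Perm (Fin (2 * m + 1)),
    ((Equiv.Perm.sign σ : ℤ) : ℂ) * α (v (σ ⟨0, by omega⟩)) *
      ∏ i : Fin m, β (v (σ ⟨2 * i.1 + 1, by omega⟩)) (v (σ ⟨2 * i.1 + 2, by omega⟩))

/-- The Cauchy-Fantappiè form `Ω₀(W) = (2πi)⁻ⁿ W ∧ (∂̄W)^{n-1}` of `W = ∑ⱼ wⱼ dζⱼ`, at `ζ`. -/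
def Omega0 {n : ℕ} (w : Fin n → Cn n → ℂ) (ζ : Cn n) (v : Fin (2 * (n - 1) + 1) → Cn n) : ℂ :=
  ((2 * Real.pi * Complex.I) ^ n)⁻¹ * wedgePow (form10 w ζ) (dbarForm w ζ) (n - 1) v

/-- The density `|ι*η|` at `ζ`, with respect to surface measure, of the pull-back of a form `η` of
degree `p` to the hypersurface `{r = const}` through `ζ`. When `p` is the dimension of the
hypersurface, `|η(v)|` has the same value for all orthonormal bases `v` of the tangent space. -/
def tangentialNorm {n p : ℕ} (r : Cn n → ℝ) (ζ : Cn n) (η : (Fin p → Cn n) → ℂ) : ℝ :=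
  sSup {x : ℝ | ∃ v : Fin p → Cn n, Orthonormal ℝ v ∧ (∀ i, fderiv ℝ r ζ (v i) = 0) ∧ x = ‖η v‖}

/-- The integrand `|ζ - z|^α |Ω₀(W^S)(ζ, z)|`, as a density with respect to surface measure
on `bD`. -/
def kernelDensity {n : ℕ} (r : Cn n → ℝ) (K : ℝ) (χ : ℝ → ℝ) (α : ℝ) (z ζ : Cn n) : ℝ :=
  ‖ζ - z‖ ^ α * tangentialNorm r ζ (Omega0 (WS r K χ z) ζ)

/-- Surface measure on `bD`: the `(2n-1)`-dimensional Hausdorff measure, normalized to agree with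
Lebesgue measure on `(2n-1)`-dimensional Euclidean spaces, restricted to `bD`. -/
def surfaceMeasure {n : ℕ} (D : Set (Cn n)) : Measure (Cn n) :=
  (μHE[2 * n - 1]).restrict (frontier D)

end CauchyFantappie

end

set_option maxSynthPendingDepth 3

noncomputable section

namespace CauchyFantappie

/-! ### The wedge product `α ∧ β^m` -/

/-! The difficulty is confined to the diagonal: where `|ζ - z| ≥ ε / 2` the kernel is jointly
continuous on a compact set. Write d = |ζ - z| and n = m + 1. Let y be a boundary point nearest to
z, ν a unit normal at y, and e_1, …, e_m a unitary eigenbasis of the Levi form of r at y on the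
complex tangent space, with eigenvalues l_j ≥ 0. The frame depends on z alone, so eigenvectors need
not vary regularly with ζ, and replacing ζ by y costs only O(d) because |ζ - y| ≤ 2d.

Denominator. Taylor's formula at ζ and r(z) ≤ 0 bound 2 Re Φ from below by the Levi form of ζ - z
plus a cubic term. Discarding the normal component of ζ - z costs a multiple of |∂r(ζ - z)| d, which
is a small multiple of |Φ| plus O(d³), and a large K absorbs the latter. Hence l_j |⟨e_j, ζ - z⟩|² ≤
(5/2) |Φ| and d³ ≤ |Φ| (`Phi_ge`, `Phi_lower_bounds`). Weak pseudoconvexity is enough, since the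
cubic term alone gives nonvanishing (`S_ne_zero`).

Numerator. Terms of ∂̄W that contain W as a factor vanish in W ∧ (∂̄W)^m, so near the diagonal the
kernel is Φ^{-n} g ∧ (∂̄g)^m up to a constant (`wedgePow_div`). Here g = ∂r + O(d), and ∂̄g is the
Levi form up to O(d). On the real frame e_j, i e_j, iν, corrected to be tangent at ζ, this gives the
bound A ∏ (l_j + d) (`exists_norm_wedgePow_gCoeff_le`): small eigenvalues weaken the denominator but
shrink the numerator too.

Integration. The functions Re ⟨e_j, ζ - z⟩, Im ⟨e_j, ζ - z⟩ and Im Φ are coordinates on bD near z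
whose inverse is Lipschitz uniformly in z (`norm_sub_le_bdryCoord`). For s < 1 the factors (l_j + d)
|⟨e_j, ζ - z⟩|^{2s} and |Im Φ|^s are all O(|Φ|^s); if s is close to 1, the remaining |Φ|^{-n(1-s)}
is paid for by d^α, because d³ ≤ |Φ| (`weighted_kernel_le`). The kernel is therefore dominated by
the product of the |y_a|^{-s} over the coordinates y_a, whose integral over a fixed cube is finite
and does not depend on z.

Existence of C. A point z of D near bD has distance O(|φ(z)|) from bD, so the Levi form of φ at z
can be negative only by O(|∂φ(t)| |t| + |φ| |t|²). On ker ∂r one has ∂φ(t) = Cφ⟨z, t⟩, and there the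
exponential weight contributes C²|φ| |⟨z, t⟩|² + C|φ| |t|², which dominates this defect for large C
(`exists_levelsPseudoconvex`). -/

lemma prod_fin_two_mul_add_one {M : Type*} [CommMonoid M] (m : ℕ) (f : Fin (2 * m + 1) → M) :
    ∏ k, f k = f ⟨0, by omega⟩ *
      ∏ i : Fin m, (f ⟨2 * i.1 + 1, by omega⟩ * f ⟨2 * i.1 + 2, by omega⟩) := by
  induction m with
  | zero => simp
  | succ m ih =>
    have h1 : ∏ k : Fin (2 * (m + 1) + 1), f k = ∏ k : Fin (2 * m + 1 + 1 + 1), f k := rfl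
    rw [h1, Fin.prod_univ_castSucc, Fin.prod_univ_castSucc]
    have := ih (fun k => f k.castSucc.castSucc)
    rw [this, Fin.prod_univ_castSucc (n := m), mul_assoc, mul_assoc]
    rfl

/-- A weighted bound for `α ∧ β^m` on a family of vectors. -/
lemma norm_wedgePow_le {n m : ℕ} {α : Cn n → ℂ} {β : Cn n → Cn n → ℂ}
    {v : Fin (2 * m + 1) → Cn n} {τ : Fin (2 * m + 1) → ℝ} {A B : ℝ} (hτ : ∀ i, 0 ≤ τ i)
    (hA : 0 ≤ A) (hα : ∀ i, ‖α (v i)‖ ≤ A * τ i)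
    (hβ : ∀ i j, i ≠ j → ‖β (v i) (v j)‖ ≤ B * (τ i * τ j)) :
    ‖wedgePow α β m v‖ ≤ (2 * m + 1).factorial * (A * B ^ m * ∏ i, τ i) := by
  unfold wedgePow
  have hhalf : ‖(1 / 2 : ℂ) ^ m‖ ≤ 1 := by
    rw [norm_pow]
    refine pow_le_one₀ (norm_nonneg _) ?_
    norm_num
  rw [norm_mul]
  refine (mul_le_of_le_one_left (norm_nonneg _) hhalf).trans ?_
  refine (norm_sum_le _ _).trans ?_
  have key : ∀ σ : Equiv.Perm (Fin (2 * m + 1)),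
      ‖((Equiv.Perm.sign σ : ℤ) : ℂ) * α (v (σ ⟨0, by omega⟩)) *
      ∏ i : Fin m, β (v (σ ⟨2 * i.1 + 1, by omega⟩)) (v (σ ⟨2 * i.1 + 2, by omega⟩))‖
      ≤ A * B ^ m * ∏ i, τ i := by
    intro σ
    have hs : ‖((Equiv.Perm.sign σ : ℤ) : ℂ)‖ = 1 := by
      rcases Int.units_eq_one_or (Equiv.Perm.sign σ) with h | h <;> simp [h]
    rw [norm_mul, norm_mul, hs, one_mul, norm_prod]
    have hprod : ∏ i, τ i = τ (σ ⟨0, by omega⟩) *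
        ∏ i : Fin m, (τ (σ ⟨2 * i.1 + 1, by omega⟩) * τ (σ ⟨2 * i.1 + 2, by omega⟩)) := by
      rw [← prod_fin_two_mul_add_one m (fun k => τ (σ k)), Equiv.prod_comp σ τ]
    have h2 : ∏ i : Fin m, ‖β (v (σ ⟨2 * i.1 + 1, by omega⟩)) (v (σ ⟨2 * i.1 + 2, by omega⟩))‖
        ≤ ∏ i : Fin m, (B * (τ (σ ⟨2 * i.1 + 1, by omega⟩) * τ (σ ⟨2 * i.1 + 2, by omega⟩))) := by
      refine Finset.prod_le_prod (fun _ _ => norm_nonneg _) fun i _ => hβ _ _ ?_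
      intro h
      have := σ.injective h
      simp at this
    rw [Finset.prod_mul_distrib, Finset.prod_const, Finset.card_univ, Fintype.card_fin] at h2
    refine (mul_le_mul (hα _) h2 (Finset.prod_nonneg fun _ _ => norm_nonneg _)
      (mul_nonneg hA (hτ _))).trans (le_of_eq ?_)
    rw [hprod]
    ring
  refine (Finset.sum_le_sum fun σ _ => key σ).trans (le_of_eq ?_)
  rw [Finset.sum_const, Finset.card_univ, Fintype.card_perm, Fintype.card_fin, nsmul_eq_mul]

/-- The multilinear map `v ↦ α(v₀) ∏ᵢ β(v₂ᵢ₊₁, v₂ᵢ₊₂)`. -/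
def wedgeMultilinear {n : ℕ} (α : Cn n →ₗ[ℝ] ℂ) (β : Cn n →ₗ[ℝ] Cn n →ₗ[ℝ] ℂ) (m : ℕ) :
    MultilinearMap ℝ (fun _ : Fin (2 * m + 1) => Cn n) ℂ :=
  let F : (Fin (2 * m + 1) → Cn n) → ℂ := fun v => α (v ⟨0, by omega⟩) *
    ∏ i : Fin m, β (v ⟨2 * i.1 + 1, by omega⟩) (v ⟨2 * i.1 + 2, by omega⟩)
  -- Each slot occurs in exactly one factor. With the other vectors frozen, the product is a real
  -- linear function of that slot times a constant, and both axioms of multilinearity follow.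
  have key : ∀ (v : Fin (2 * m + 1) → Cn n) (p : Fin (2 * m + 1)),
      ∃ (c : ℂ) (l : Cn n →ₗ[ℝ] ℂ), ∀ x, F (Function.update v p x) = l x * c := by
    intro v p
    obtain ⟨p, hp⟩ := p
    rcases Nat.eq_zero_or_pos p with rfl | h0
    · refine ⟨∏ i : Fin m, β (v ⟨2 * i.1 + 1, by omega⟩) (v ⟨2 * i.1 + 2, by omega⟩), α,
        fun x => ?_⟩
      simp [F]
    · obtain ⟨i, hi, h⟩ : ∃ i, i < m ∧ (p = 2 * i + 1 ∨ p = 2 * i + 2) :=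
        ⟨(p - 1) / 2, by omega, by omega⟩
      have hsplit : ∀ w : Fin (2 * m + 1) → Cn n, F w = α (w ⟨0, by omega⟩) *
          (β (w ⟨2 * i + 1, by omega⟩) (w ⟨2 * i + 2, by omega⟩) *
            ∏ j ∈ Finset.univ.erase (⟨i, hi⟩ : Fin m),
              β (w ⟨2 * j.1 + 1, by omega⟩) (w ⟨2 * j.1 + 2, by omega⟩)) := by
        intro w
        exact congrArg (fun x => α (w ⟨0, by omega⟩) * x) (Finset.mul_prod_erase Finset.univ
          (fun j : Fin m => β (w ⟨2 * j.1 + 1, by omega⟩) (w ⟨2 * j.1 + 2, by omega⟩))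
          (Finset.mem_univ ⟨i, hi⟩)).symm
      have hrest : ∀ x, ∏ j ∈ Finset.univ.erase (⟨i, hi⟩ : Fin m),
            β (Function.update v ⟨p, hp⟩ x ⟨2 * j.1 + 1, by omega⟩)
              (Function.update v ⟨p, hp⟩ x ⟨2 * j.1 + 2, by omega⟩) =
          ∏ j ∈ Finset.univ.erase (⟨i, hi⟩ : Fin m),
              β (v ⟨2 * j.1 + 1, by omega⟩) (v ⟨2 * j.1 + 2, by omega⟩) := by
        intro x
        refine Finset.prod_congr rfl fun j hj => ?_
        have hne : j.1 ≠ i := fun h => Finset.ne_of_mem_erase hj (Fin.ext h)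
        rw [Function.update_of_ne, Function.update_of_ne]
        · simp only [ne_eq, Fin.mk.injEq]; omega
        · simp only [ne_eq, Fin.mk.injEq]; omega
      have h00 : ∀ x, Function.update v ⟨p, hp⟩ x ⟨0, by omega⟩ = v ⟨0, by omega⟩ := by
        intro x
        rw [Function.update_of_ne]
        simp only [ne_eq, Fin.mk.injEq]; omega
      rcases h with rfl | rfl
      · refine ⟨α (v ⟨0, by omega⟩) * ∏ j ∈ Finset.univ.erase (⟨i, hi⟩ : Fin m),
          β (v ⟨2 * j.1 + 1, by omega⟩) (v ⟨2 * j.1 + 2, by omega⟩), β.flip (v ⟨2 * i + 2, by omega⟩), fun x => ?_⟩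
        rw [hsplit, hrest, h00, Function.update_self, Function.update_of_ne,
          mul_left_comm, LinearMap.flip_apply]
        simp
      · refine ⟨α (v ⟨0, by omega⟩) * ∏ j ∈ Finset.univ.erase (⟨i, hi⟩ : Fin m),
          β (v ⟨2 * j.1 + 1, by omega⟩) (v ⟨2 * j.1 + 2, by omega⟩), β (v ⟨2 * i + 1, by omega⟩), fun x => ?_⟩
        rw [hsplit, hrest, h00, Function.update_self, Function.update_of_ne,
          mul_left_comm]
        simp
  { toFun := F
    map_update_add' := by
      intro inst v p x y
      obtain rfl : inst = instDecidableEqFin _ := Subsingleton.elim _ _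
      obtain ⟨c, l, h⟩ := key v p
      rw [h, h, h, map_add, add_mul]
    map_update_smul' := by
      intro inst v p x y
      obtain rfl : inst = instDecidableEqFin _ := Subsingleton.elim _ _
      obtain ⟨c, l, h⟩ := key v p
      rw [h, h, map_smul, smul_mul_assoc] }

/-- `α ∧ β^m` as an alternating map. -/
def wedgeAlternating {n : ℕ} (α : Cn n →ₗ[ℝ] ℂ) (β : Cn n →ₗ[ℝ] Cn n →ₗ[ℝ] ℂ) (m : ℕ) :
    Cn n [⋀^Fin (2 * m + 1)]→ₗ[ℝ] ℂ :=
  MultilinearMap.alternatization (wedgeMultilinear α β m)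

/-- Supplies the two facts needed in `norm_wedgePow_sum_le`: expansion over linear combinations, and
vanishing on families with a repeated vector. -/
lemma wedgePow_eq_wedgeAlternating {n : ℕ} (α : Cn n →ₗ[ℝ] ℂ)
    (β : Cn n →ₗ[ℝ] Cn n →ₗ[ℝ] ℂ) (m : ℕ) (v : Fin (2 * m + 1) → Cn n) :
    wedgePow α (fun u w => β u w) m v = (1 / 2 : ℂ) ^ m * wedgeAlternating α β m v := by
  unfold wedgePow wedgeAlternating
  rw [MultilinearMap.alternatization_apply]
  congr 1
  refine Finset.sum_congr rfl fun σ _ => ?_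
  rw [mul_assoc]
  have : ∀ (s : ℤˣ) (x : ℂ), ((s : ℤ) : ℂ) * x = s • x := by
    intro s x
    rcases Int.units_eq_one_or s with h | h <;> simp [h]
  rw [this]
  rfl

/-- A bound for `α ∧ β^m` on all families of vectors whose coefficients with respect to a
family `u` are bounded by `1`, in terms of the values on `u`. -/
lemma norm_wedgePow_sum_le {n m : ℕ} {ι : Type*} [Fintype ι] [DecidableEq ι]
    (hι : Fintype.card ι = 2 * m + 1)
    (α : Cn n →ₗ[ℝ] ℂ) (β : Cn n →ₗ[ℝ] Cn n →ₗ[ℝ] ℂ) {u : ι → Cn n} {τ : ι → ℝ} {A B : ℝ}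
    (hτ : ∀ i, 0 ≤ τ i) (hA : 0 ≤ A) (hB : 0 ≤ B) (hα : ∀ i, ‖α (u i)‖ ≤ A * τ i)
    (hβ : ∀ i j, i ≠ j → ‖β (u i) (u j)‖ ≤ B * (τ i * τ j))
    {c : Fin (2 * m + 1) → ι → ℝ} (hc : ∀ i a, |c i a| ≤ 1) :
    ‖wedgePow α (fun x y => β x y) m (fun i => ∑ a, c i a • u a)‖ ≤
      (2 * m + 1 : ℕ) ^ (2 * m + 1) * ((2 * m + 1).factorial * (A * B ^ m * ∏ i, τ i)) := by
  set X : ℝ := (2 * m + 1).factorial * (A * B ^ m * ∏ i, τ i) with hX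
  have hX0 : 0 ≤ X := by
    have : 0 ≤ ∏ i, τ i := Finset.prod_nonneg fun i _ => hτ i
    positivity
  have hterm : ∀ f : Fin (2 * m + 1) → ι, ‖wedgePow α (fun x y => β x y) m (fun i => u (f i))‖ ≤ X := by
    intro f
    -- An injective choice uses every frame vector once and yields the full product of weights. Any
    -- other choice repeats a vector and contributes zero, so only off-diagonal values of `β` need a
    -- bound.
    by_cases hf : Function.Injective f
    · have hbij : Function.Bijective f := by
        rw [Fintype.bijective_iff_injective_and_card]
        exact ⟨hf, by simp [hι]⟩
      refine (norm_wedgePow_le (τ := fun i => τ (f i)) (fun i => hτ _) hA (fun i => hα _)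
        (fun i j hij => hβ _ _ (fun h => hij (hf h)))).trans (le_of_eq ?_)
      rw [hX, hbij.prod_comp τ]
    · rw [wedgePow_eq_wedgeAlternating, AlternatingMap.map_eq_zero_of_not_injective, mul_zero,
        norm_zero]
      · exact hX0
      · exact fun h => hf (Function.Injective.of_comp (f := u) h)
  rw [wedgePow_eq_wedgeAlternating]
  have hexp : wedgeAlternating α β m (fun i => ∑ a, c i a • u a) =
      ∑ f : Fin (2 * m + 1) → ι, (∏ i, c i (f i)) • wedgeAlternating α β m (fun i => u (f i)) := by
    rw [← AlternatingMap.coe_multilinearMap, MultilinearMap.map_sum]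
    refine Finset.sum_congr rfl fun f _ => ?_
    rw [MultilinearMap.map_smul_univ]
  rw [hexp, Finset.mul_sum]
  refine (norm_sum_le _ _).trans ?_
  have : ∀ f : Fin (2 * m + 1) → ι, ‖(1 / 2 : ℂ) ^ m *
      ((∏ i, c i (f i)) • wedgeAlternating α β m (fun i => u (f i)))‖ ≤ X := by
    intro f
    rw [mul_smul_comm, ← wedgePow_eq_wedgeAlternating, norm_smul, norm_prod]
    refine (mul_le_of_le_one_left (norm_nonneg _) ?_).trans (hterm f)
    exact Finset.prod_le_one (fun _ _ => norm_nonneg _) fun i _ => hc i _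
  refine (Finset.sum_le_sum fun f _ => this f).trans (le_of_eq ?_)
  rw [Finset.sum_const, Finset.card_univ, Fintype.card_fun, Fintype.card_fin, hι, nsmul_eq_mul]
  push_cast
  ring

/-- Adding a multiple of `α` to `β` does not change `α ∧ β^m`. -/
lemma wedgePow_add_wedge {n : ℕ} (α γ : Cn n → ℂ) (β : Cn n → Cn n → ℂ) (m : ℕ)
    (v : Fin (2 * m + 1) → Cn n) :
    wedgePow α (fun x y => β x y + (γ x * α y - γ y * α x)) m v = wedgePow α β m v := by
  unfold wedgePow
  congr 1
  set b : Equiv.Perm (Fin (2 * m + 1)) → Fin m → ℂ := fun σ i =>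
    β (v (σ ⟨2 * i.1 + 1, by omega⟩)) (v (σ ⟨2 * i.1 + 2, by omega⟩)) with hb
  set k : Equiv.Perm (Fin (2 * m + 1)) → Fin m → ℂ := fun σ i =>
    γ (v (σ ⟨2 * i.1 + 1, by omega⟩)) * α (v (σ ⟨2 * i.1 + 2, by omega⟩)) -
      γ (v (σ ⟨2 * i.1 + 2, by omega⟩)) * α (v (σ ⟨2 * i.1 + 1, by omega⟩)) with hk
  have hexp : ∀ σ : Equiv.Perm (Fin (2 * m + 1)), ∏ i, (b σ i + k σ i) =
      ∑ t ∈ (Finset.univ : Finset (Fin m)).powerset,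
        (∏ i ∈ t, b σ i) * ∏ i ∈ Finset.univ \ t, k σ i := fun σ =>
    Finset.prod_add _ _ _
  change ∑ σ : Equiv.Perm (Fin (2 * m + 1)), ((Equiv.Perm.sign σ : ℤ) : ℂ) *
    α (v (σ ⟨0, by omega⟩)) * ∏ i, (b σ i + k σ i) = ∑ σ : Equiv.Perm (Fin (2 * m + 1)),
    ((Equiv.Perm.sign σ : ℤ) : ℂ) * α (v (σ ⟨0, by omega⟩)) * ∏ i, b σ i
  simp_rw [hexp, Finset.mul_sum]
  -- Here `t` is the set of factors taken from `β`. If some pair `i` lies outside `t`, then `α`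
  -- occurs both in slot 0 and in the pair `i`; transposing these two slots changes the sign of the
  -- sum, which is therefore zero.
  rw [Finset.sum_comm, Finset.sum_eq_single Finset.univ]
  · simp
  · intro t _ ht
    obtain ⟨i, hi⟩ : ∃ i, i ∉ t := by
      by_contra h
      push Not at h
      exact ht (Finset.eq_univ_of_forall h)
    -- exchanging the arguments of the two copies of `α` changes the sign
    have swap_zero : ∀ (p q : ℕ) (hp : p < 2 * m + 1) (hq : q < 2 * m + 1),
        ((p = 2 * i.1 + 1 ∧ q = 2 * i.1 + 2) ∨ (q = 2 * i.1 + 1 ∧ p = 2 * i.1 + 2)) →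
        ∑ σ : Equiv.Perm (Fin (2 * m + 1)), ((Equiv.Perm.sign σ : ℤ) : ℂ) *
          α (v (σ ⟨0, by omega⟩)) * ((∏ i ∈ t, b σ i) *
            (γ (v (σ ⟨p, hp⟩)) * α (v (σ ⟨q, hq⟩)) *
              ∏ j ∈ (Finset.univ \ t).erase i, k σ j)) = 0 := by
      intro p q hp hq hpq
      set s : Equiv.Perm (Fin (2 * m + 1)) := Equiv.swap ⟨0, by omega⟩ ⟨q, hq⟩ with hs
      have hne : (⟨0, by omega⟩ : Fin (2 * m + 1)) ≠ ⟨q, hq⟩ := by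
        simp only [ne_eq, Fin.mk.injEq]; omega
      have hfix : ∀ (a : ℕ) (ha : a < 2 * m + 1), a ≠ 0 → a ≠ q → s ⟨a, ha⟩ = ⟨a, ha⟩ := by
        intro a ha h1 h2
        refine Equiv.swap_apply_of_ne_of_ne ?_ ?_ <;> simpa using ‹_›
      have hneg : ∀ x : ℂ, x = -x → x = 0 := fun x hx => by
        have : (2 : ℂ) * x = 0 := by linear_combination hx
        simpa using this
      refine hneg _ ?_
      conv_lhs => rw [← Equiv.sum_comp (Equiv.mulRight s)]
      rw [← Finset.sum_neg_distrib]
      refine Finset.sum_congr rfl fun σ _ => ?_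
      simp only [Equiv.coe_mulRight, Equiv.Perm.sign_mul]
      rw [hs, Equiv.Perm.sign_swap hne, ← hs]
      have e1 : (σ * s) ⟨0, by omega⟩ = σ ⟨q, hq⟩ := by
        rw [Equiv.Perm.mul_apply, hs, Equiv.swap_apply_left]
      have e2 : (σ * s) ⟨q, hq⟩ = σ ⟨0, by omega⟩ := by
        rw [Equiv.Perm.mul_apply, hs, Equiv.swap_apply_right]
      have e3 : (σ * s) ⟨p, hp⟩ = σ ⟨p, hp⟩ := by
        rw [Equiv.Perm.mul_apply, hfix] <;> omega
      have e4 : ∏ j ∈ t, b (σ * s) j = ∏ j ∈ t, b σ j := by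
        refine Finset.prod_congr rfl fun j hj => ?_
        have hji : j.1 ≠ i.1 := fun h => hi (by rwa [← Fin.ext h])
        simp only [hb, Equiv.Perm.mul_apply]
        rw [hfix, hfix] <;> omega
      have e5 : ∏ j ∈ (Finset.univ \ t).erase i, k (σ * s) j =
          ∏ j ∈ (Finset.univ \ t).erase i, k σ j := by
        refine Finset.prod_congr rfl fun j hj => ?_
        have hji : j.1 ≠ i.1 := fun h => Finset.ne_of_mem_erase hj (Fin.ext h)
        simp only [hk, Equiv.Perm.mul_apply]
        rw [hfix, hfix] <;> omega
      rw [e1, e2, e3, e4, e5]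
      push_cast
      ring
    have hsplit : ∀ σ : Equiv.Perm (Fin (2 * m + 1)), ∏ j ∈ Finset.univ \ t, k σ j =
        k σ i * ∏ j ∈ (Finset.univ \ t).erase i, k σ j := fun σ =>
      (Finset.mul_prod_erase _ _ (by simp [hi])).symm
    have h1 := swap_zero (2 * i.1 + 1) (2 * i.1 + 2) (by omega) (by omega) (by omega)
    have h2 := swap_zero (2 * i.1 + 2) (2 * i.1 + 1) (by omega) (by omega) (by omega)
    rw [← sub_eq_zero.2 (h1.trans h2.symm), ← Finset.sum_sub_distrib]
    refine Finset.sum_congr rfl fun σ _ => ?_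
    rw [hsplit]
    simp only [hk]
    ring
  · simp

/-- Homogeneity of the wedge product. -/
lemma wedgePow_smul {n : ℕ} (α : Cn n → ℂ) (β : Cn n → Cn n → ℂ) (m : ℕ) (c : ℂ)
    (v : Fin (2 * m + 1) → Cn n) :
    wedgePow (fun x => c * α x) (fun x y => c * β x y) m v =
      c ^ (m + 1) * wedgePow α β m v := by
  unfold wedgePow
  rw [mul_left_comm]
  congr 1
  rw [Finset.mul_sum]
  refine Finset.sum_congr rfl fun σ _ => ?_
  rw [Finset.prod_mul_distrib, Finset.prod_const, Finset.card_univ, Fintype.card_fin]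
  ring

end CauchyFantappie

namespace CauchyFantappie

variable {n : ℕ}

/-! ### Wirtinger calculus without coordinates -/

lemma norm_I_smul (t : Cn n) : ‖Complex.I • t‖ = ‖t‖ := by simp [norm_smul]

lemma I_smul_I_smul (t : Cn n) : Complex.I • Complex.I • t = -t := by
  rw [smul_smul, Complex.I_mul_I, neg_one_smul]

lemma single_I (j : Fin n) : (EuclideanSpace.single j Complex.I : Cn n) =
    Complex.I • EuclideanSpace.single j (1 : ℂ) := by
  ext i
  simp

/-- The vectors `e_j` and `i e_j` span over the reals, so a map commuting with `i` is determined by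
its values on the `e_j`. This is the dictionary that turns Wirtinger sums into expressions in real
derivatives. -/
lemma complexLin_eq_sum (c : Fin n → ℂ) (L : Cn n →ₗ[ℝ] ℂ) (hL : ∀ t, L (Complex.I • t) = Complex.I * L t)
    (hc : ∀ j, c j = L (EuclideanSpace.single j 1)) (t : Cn n) : ∑ j, c j * t j = L t := by
  have ht : t = ∑ j, ((t j).re • (EuclideanSpace.single j 1 : Cn n) +
      (t j).im • Complex.I • (EuclideanSpace.single j 1 : Cn n)) := by
    ext i
    simp only [WithLp.ofLp_sum, Finset.sum_apply, PiLp.add_apply, PiLp.smul_apply,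
      PiLp.single_apply]
    rw [Finset.sum_eq_single i]
    · simp
    · intro b _ hb
      simp [hb.symm]
    · simp
  conv_rhs => rw [ht]
  rw [map_sum]
  refine Finset.sum_congr rfl fun j _ => ?_
  rw [map_add, map_smul, map_smul, hL, ← hc]
  conv_lhs => rw [← Complex.re_add_im (t j)]
  simp only [Complex.real_smul]
  ring

lemma complexConjLin_eq_sum (c : Fin n → ℂ) (L : Cn n →ₗ[ℝ] ℂ)
    (hL : ∀ t, L (Complex.I • t) = -Complex.I * L t)
    (hc : ∀ j, c j = L (EuclideanSpace.single j 1)) (t : Cn n) :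
    ∑ j, c j * star (t j) = L t := by
  have h := complexLin_eq_sum (fun j => star (c j))
    (Complex.conjCLE.toContinuousLinearMap.toLinearMap.comp L)
    (fun t => by simp [hL]) (fun j => by simp [hc]) t
  have h2 := congrArg star h
  simpa [mul_comm] using h2

/-- The `ℂ`-linear part of a real linear map. -/
def linPart (L : Cn n →ₗ[ℝ] ℂ) (t : Cn n) : ℂ := (1 / 2) * (L t - Complex.I * L (Complex.I • t))

/-- The conjugate-linear part of a real linear map. -/
def conjPart (L : Cn n →ₗ[ℝ] ℂ) (t : Cn n) : ℂ := (1 / 2) * (L t + Complex.I * L (Complex.I • t))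

lemma linPart_eq_sum (L : Cn n →ₗ[ℝ] ℂ) (t : Cn n) :
    ∑ j, (1 / 2) * (L (EuclideanSpace.single j 1) -
      Complex.I * L (EuclideanSpace.single j Complex.I)) * t j = linPart L t := by
  refine complexLin_eq_sum _ ((1 / 2 : ℂ) • (L - Complex.I • L.comp
    ((Complex.I • (LinearMap.id : Cn n →ₗ[ℂ] Cn n)).restrictScalars ℝ))) ?_ ?_ t
  · intro t
    simp [I_smul_I_smul]
    linear_combination ((1 / 2) * L (Complex.I • t)) * Complex.I_sq
  · intro j
    simp [single_I]

lemma conjPart_eq_sum (L : Cn n →ₗ[ℝ] ℂ) (t : Cn n) :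
    ∑ j, (1 / 2) * (L (EuclideanSpace.single j 1) +
      Complex.I * L (EuclideanSpace.single j Complex.I)) * star (t j) = conjPart L t := by
  refine complexConjLin_eq_sum _ ((1 / 2 : ℂ) • (L + Complex.I • L.comp
    ((Complex.I • (LinearMap.id : Cn n →ₗ[ℂ] Cn n)).restrictScalars ℝ))) ?_ ?_ t
  · intro t
    simp [I_smul_I_smul]
    linear_combination ((1 / 2) * L (Complex.I • t)) * Complex.I_sq
  · intro j
    simp [single_I, mul_add]

lemma sum_dz_mul (f : Cn n → ℂ) (ζ t : Cn n) :
    ∑ j, dz j f ζ * t j = linPart (fderiv ℝ f ζ).toLinearMap t :=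
  linPart_eq_sum (fderiv ℝ f ζ).toLinearMap t

lemma dbarFun_eq (f : Cn n → ℂ) (ζ t : Cn n) :
    dbarFun f ζ t = (1 / 2) * (fderiv ℝ f ζ t + Complex.I * fderiv ℝ f ζ (Complex.I • t)) :=
  conjPart_eq_sum (fderiv ℝ f ζ).toLinearMap t

/-- The `(1,0)`-part of a real functional. -/
def dPart (L : Cn n →L[ℝ] ℝ) (t : Cn n) : ℂ := (1 / 2) * (L t - Complex.I * L (Complex.I • t))

/-- The `(2,0)`-part of a real bilinear form. -/
def qPart (B : Cn n →L[ℝ] Cn n →L[ℝ] ℝ) (t s : Cn n) : ℂ :=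
  (1 / 4) * (B t s - Complex.I * B (Complex.I • t) s - Complex.I * B t (Complex.I • s)
    - B (Complex.I • t) (Complex.I • s))

/-- The `(1,1)`-part of a real bilinear form. -/
def lPart (B : Cn n →L[ℝ] Cn n →L[ℝ] ℝ) (t s : Cn n) : ℂ :=
  (1 / 4) * (B t s - Complex.I * B (Complex.I • t) s + Complex.I * B t (Complex.I • s)
    + B (Complex.I • t) (Complex.I • s))

lemma dPart_add (L : Cn n →L[ℝ] ℝ) (t s : Cn n) : dPart L (t + s) = dPart L t + dPart L s := by
  simp only [dPart, smul_add, map_add]; push_cast; ring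

lemma dPart_sub (L : Cn n →L[ℝ] ℝ) (t s : Cn n) : dPart L (t - s) = dPart L t - dPart L s := by
  simp only [dPart, smul_sub, map_sub]; push_cast; ring

lemma dPart_I_smul (L : Cn n →L[ℝ] ℝ) (t : Cn n) :
    dPart L (Complex.I • t) = Complex.I * dPart L t := by
  simp only [dPart, I_smul_I_smul, map_neg]; push_cast
  linear_combination ((1 / 2) * (L (Complex.I • t) : ℂ)) * Complex.I_sq

lemma dPart_real_smul (L : Cn n →L[ℝ] ℝ) (c : ℝ) (t : Cn n) :
    dPart L (c • t) = c * dPart L t := by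
  simp only [dPart, smul_comm Complex.I c t, map_smul, smul_eq_mul]; push_cast; ring

lemma complex_smul_eq (c : ℂ) (t : Cn n) : c • t = c.re • t + c.im • Complex.I • t := by
  ext i
  simp only [PiLp.add_apply, PiLp.smul_apply, smul_eq_mul, Complex.real_smul]
  conv_lhs => rw [← Complex.re_add_im c]
  ring

lemma dPart_smul (L : Cn n →L[ℝ] ℝ) (c : ℂ) (t : Cn n) : dPart L (c • t) = c * dPart L t := by
  rw [complex_smul_eq, dPart_add, dPart_real_smul, dPart_real_smul, dPart_I_smul]
  conv_rhs => rw [← Complex.re_add_im c]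
  ring

lemma dPart_re (L : Cn n →L[ℝ] ℝ) (t : Cn n) : (dPart L t).re = L t / 2 := by
  simp [dPart]; ring

lemma dPart_im (L : Cn n →L[ℝ] ℝ) (t : Cn n) : (dPart L t).im = -L (Complex.I • t) / 2 := by
  simp [dPart]; ring

lemma dPart_sub_left (L L' : Cn n →L[ℝ] ℝ) (t : Cn n) :
    dPart (L - L') t = dPart L t - dPart L' t := by
  simp only [dPart, sub_apply]; push_cast; ring

lemma norm_dPart_le (L : Cn n →L[ℝ] ℝ) (t : Cn n) : ‖dPart L t‖ ≤ ‖L‖ * ‖t‖ := by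
  have h1 := L.le_opNorm t
  have h2 := L.le_opNorm (Complex.I • t)
  rw [norm_I_smul] at h2
  rw [dPart, norm_mul]
  have h3 := norm_sub_le ((L t : ℝ) : ℂ) (Complex.I * (L (Complex.I • t) : ℝ))
  rw [norm_mul, Complex.norm_I, one_mul, Complex.norm_real, Complex.norm_real] at h3
  have : ‖(1 / 2 : ℂ)‖ = 1 / 2 := by norm_num
  rw [this]
  linarith

lemma norm_quarter_le {M : ℝ} {x y u v : ℂ} (hx : ‖x‖ ≤ M) (hy : ‖y‖ ≤ M)
    (hu : ‖u‖ ≤ M) (hv : ‖v‖ ≤ M) : ‖(1 / 4 : ℂ) * (x + y + u + v)‖ ≤ M := by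
  rw [norm_mul]
  have : ‖(1 / 4 : ℂ)‖ = 1 / 4 := by norm_num
  rw [this]
  have h1 := norm_add_le (x + y + u) v
  have h2 := norm_add_le (x + y) u
  have h3 := norm_add_le x y
  linarith

lemma norm_bilin_bounds (B : Cn n →L[ℝ] Cn n →L[ℝ] ℝ) (t s : Cn n) (c : ℂ) (hc : ‖c‖ = 1) :
    ‖c * (B t s : ℝ)‖ ≤ ‖B‖ * ‖t‖ * ‖s‖ ∧ ‖c * (B (Complex.I • t) s : ℝ)‖ ≤ ‖B‖ * ‖t‖ * ‖s‖ ∧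
    ‖c * (B t (Complex.I • s) : ℝ)‖ ≤ ‖B‖ * ‖t‖ * ‖s‖ ∧
    ‖c * (B (Complex.I • t) (Complex.I • s) : ℝ)‖ ≤ ‖B‖ * ‖t‖ * ‖s‖ := by
  simp only [norm_mul, hc, one_mul, Complex.norm_real]
  have h1 := B.le_opNorm₂ t s
  have h2 := B.le_opNorm₂ (Complex.I • t) s
  have h3 := B.le_opNorm₂ t (Complex.I • s)
  have h4 := B.le_opNorm₂ (Complex.I • t) (Complex.I • s)
  simp only [norm_I_smul] at h2 h3 h4
  exact ⟨h1, h2, h3, h4⟩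

lemma norm_qPart_le (B : Cn n →L[ℝ] Cn n →L[ℝ] ℝ) (t s : Cn n) :
    ‖qPart B t s‖ ≤ ‖B‖ * ‖t‖ * ‖s‖ := by
  have h1 := (norm_bilin_bounds B t s 1 (by simp)).1
  have h2 := (norm_bilin_bounds B t s (-Complex.I) (by simp)).2.1
  have h3 := (norm_bilin_bounds B t s (-Complex.I) (by simp)).2.2.1
  have h4 := (norm_bilin_bounds B t s (-1) (by simp)).2.2.2
  have h := norm_quarter_le h1 h2 h3 h4
  refine le_trans (le_of_eq ?_) h
  rw [qPart]; congr 1; ring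

lemma norm_lPart_le (B : Cn n →L[ℝ] Cn n →L[ℝ] ℝ) (t s : Cn n) :
    ‖lPart B t s‖ ≤ ‖B‖ * ‖t‖ * ‖s‖ := by
  have h1 := (norm_bilin_bounds B t s 1 (by simp)).1
  have h2 := (norm_bilin_bounds B t s (-Complex.I) (by simp)).2.1
  have h3 := (norm_bilin_bounds B t s (Complex.I) (by simp)).2.2.1
  have h4 := (norm_bilin_bounds B t s (1) (by simp)).2.2.2
  have h := norm_quarter_le h1 h2 h3 h4
  refine le_trans (le_of_eq ?_) h
  rw [lPart]; congr 1; ring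

lemma qPart_sub_left (B B' : Cn n →L[ℝ] Cn n →L[ℝ] ℝ) (t s : Cn n) :
    qPart (B - B') t s = qPart B t s - qPart B' t s := by
  simp only [qPart, sub_apply]; push_cast; ring

lemma qPart_sub (B : Cn n →L[ℝ] Cn n →L[ℝ] ℝ) (t s s' : Cn n) :
    qPart B t (s - s') = qPart B t s - qPart B t s' := by
  simp only [qPart, smul_sub, map_sub]; push_cast; ring

lemma qPart_sub_fst (B : Cn n →L[ℝ] Cn n →L[ℝ] ℝ) (t t' s : Cn n) :
    qPart B (t - t') s = qPart B t s - qPart B t' s := by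
  simp only [qPart, smul_sub, map_sub, sub_apply]; push_cast; ring

lemma qPart_I_smul (B : Cn n →L[ℝ] Cn n →L[ℝ] ℝ) (t s : Cn n) :
    qPart B t (Complex.I • s) = Complex.I * qPart B t s := by
  simp only [qPart, I_smul_I_smul, map_neg]; push_cast
  linear_combination ((1 / 4) * ((B t (Complex.I • s) : ℂ) + B (Complex.I • t) s)) * Complex.I_sq

lemma lPart_sub_left (B B' : Cn n →L[ℝ] Cn n →L[ℝ] ℝ) (t s : Cn n) :
    lPart (B - B') t s = lPart B t s - lPart B' t s := by
  simp only [lPart, sub_apply]; push_cast; ring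

lemma lPart_add_fst (B : Cn n →L[ℝ] Cn n →L[ℝ] ℝ) (t t' s : Cn n) :
    lPart B (t + t') s = lPart B t s + lPart B t' s := by
  simp only [lPart, smul_add, map_add, add_apply]; push_cast; ring

lemma lPart_add_snd (B : Cn n →L[ℝ] Cn n →L[ℝ] ℝ) (t s s' : Cn n) :
    lPart B t (s + s') = lPart B t s + lPart B t s' := by
  simp only [lPart, smul_add, map_add]; push_cast; ring

lemma lPart_I_smul_fst (B : Cn n →L[ℝ] Cn n →L[ℝ] ℝ) (t s : Cn n) :
    lPart B (Complex.I • t) s = Complex.I * lPart B t s := by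
  simp only [lPart, I_smul_I_smul, map_neg, neg_apply]; push_cast
  linear_combination ((1 / 4) * (B (Complex.I • t) s : ℂ) -
    (1 / 4) * (B t (Complex.I • s) : ℂ)) * Complex.I_sq

lemma lPart_smul_fst (B : Cn n →L[ℝ] Cn n →L[ℝ] ℝ) (c : ℂ) (t s : Cn n) :
    lPart B (c • t) s = c * lPart B t s := by
  have hr : ∀ (c : ℝ) (t : Cn n), lPart B (c • t) s = c * lPart B t s := by
    intro c t
    simp only [lPart, smul_comm Complex.I c t, map_smul, smul_eq_mul,
      smul_apply]
    push_cast; ring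
  rw [complex_smul_eq, lPart_add_fst, hr, hr, lPart_I_smul_fst]
  conv_rhs => rw [← Complex.re_add_im c]
  ring

/-- Hermitian symmetry of the `(1,1)`-part of a symmetric form. -/
lemma star_lPart {B : Cn n →L[ℝ] Cn n →L[ℝ] ℝ} (hB : ∀ t s, B t s = B s t) (t s : Cn n) :
    star (lPart B t s) = lPart B s t := by
  simp only [lPart, hB s t, hB (Complex.I • s) t, hB s (Complex.I • t),
    hB (Complex.I • s) (Complex.I • t)]
  simp
  ring

lemma lPart_smul_snd {B : Cn n →L[ℝ] Cn n →L[ℝ] ℝ} (hB : ∀ t s, B t s = B s t)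
    (c : ℂ) (t s : Cn n) : lPart B t (c • s) = star c * lPart B t s := by
  rw [← star_lPart hB, lPart_smul_fst, star_mul', star_lPart hB]

lemma lPart_self_re (B : Cn n →L[ℝ] Cn n →L[ℝ] ℝ) (t : Cn n) :
    (lPart B t t).re = (B t t + B (Complex.I • t) (Complex.I • t)) / 4 := by
  simp [lPart]; ring

lemma qPart_self_re (B : Cn n →L[ℝ] Cn n →L[ℝ] ℝ) (t : Cn n) :
    (qPart B t t).re = (B t t - B (Complex.I • t) (Complex.I • t)) / 4 := by
  simp [qPart]; ring

/-! ### Translation of the coordinate definitions -/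

lemma hasFDerivAt_ofReal {r : Cn n → ℝ} {ζ : Cn n} (h : DifferentiableAt ℝ r ζ) :
    HasFDerivAt (fun x => (r x : ℂ)) (Complex.ofRealCLM.comp (fderiv ℝ r ζ)) ζ :=
  Complex.ofRealCLM.hasFDerivAt.comp ζ h.hasFDerivAt

lemma dr_eq {r : Cn n → ℝ} {ζ : Cn n} (h : DifferentiableAt ℝ r ζ) (j : Fin n) :
    dr r j ζ = dPart (fderiv ℝ r ζ) (EuclideanSpace.single j 1) := by
  simp only [dr, dz, (hasFDerivAt_ofReal h).fderiv, dPart, single_I]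
  rfl

lemma sum_dr_mul {r : Cn n → ℝ} {ζ : Cn n} (h : DifferentiableAt ℝ r ζ) (t : Cn n) :
    ∑ j, dr r j ζ * t j = dPart (fderiv ℝ r ζ) t := by
  have := sum_dz_mul (fun x => (r x : ℂ)) ζ t
  simp only [dr]
  rw [this, linPart, (hasFDerivAt_ofReal h).fderiv]
  rfl

/-- `L ↦ dPart L t` as a linear map. -/
def dPartCLM (t : Cn n) : (Cn n →L[ℝ] ℝ) →L[ℝ] ℂ :=
  LinearMap.toContinuousLinearMap
    { toFun := fun L => dPart L t
      map_add' := fun L L' => by simp only [dPart, add_apply]; push_cast; ring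
      map_smul' := fun c L => by
        simp only [dPart, smul_apply, smul_eq_mul, RingHom.id_apply,
          Complex.real_smul]
        push_cast; ring }

@[simp] lemma dPartCLM_apply (t : Cn n) (L : Cn n →L[ℝ] ℝ) : dPartCLM t L = dPart L t := rfl

/-- `L ↦ conj (dPart L t)` as a linear map. -/
def dbarPartCLM (t : Cn n) : (Cn n →L[ℝ] ℝ) →L[ℝ] ℂ :=
  Complex.conjCLE.toContinuousLinearMap.comp (dPartCLM t)

lemma dbarPartCLM_apply (t : Cn n) (L : Cn n →L[ℝ] ℝ) :
    dbarPartCLM t L = (1 / 2) * (L t + Complex.I * L (Complex.I • t)) := by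
  simp [dbarPartCLM, dPart, map_ofNat]

lemma eventually_dz_eq {r : Cn n → ℝ} {ζ : Cn n} (h : ContDiffAt ℝ 2 r ζ) (k : Fin n) :
    dz k (fun x => (r x : ℂ)) =ᶠ[nhds ζ]
      fun x => dPartCLM (EuclideanSpace.single k 1) (fderiv ℝ r x) := by
  filter_upwards [h.eventually (by simp)] with x hx
  exact dr_eq (hx.differentiableAt (by simp)) k

lemma eventually_dzbar_eq {r : Cn n → ℝ} {ζ : Cn n} (h : ContDiffAt ℝ 2 r ζ) (k : Fin n) :
    dzbar k (fun x => (r x : ℂ)) =ᶠ[nhds ζ]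
      fun x => dbarPartCLM (EuclideanSpace.single k 1) (fderiv ℝ r x) := by
  filter_upwards [h.eventually (by simp)] with x hx
  have := hx.differentiableAt (by simp)
  rw [dbarPartCLM_apply]
  simp only [dzbar, (hasFDerivAt_ofReal this).fderiv, single_I]
  rfl

lemma differentiableAt_fderiv {r : Cn n → ℝ} {ζ : Cn n} (h : ContDiffAt ℝ 2 r ζ) :
    DifferentiableAt ℝ (fderiv ℝ r) ζ :=
  (h.fderiv_right (m := 1) (by norm_num)).differentiableAt (by simp)

lemma fderiv_clm_fderiv {r : Cn n → ℝ} {ζ : Cn n} (h : ContDiffAt ℝ 2 r ζ)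
    (l : (Cn n →L[ℝ] ℝ) →L[ℝ] ℂ) :
    HasFDerivAt (fun x => l (fderiv ℝ r x)) (l.comp (fderiv ℝ (fderiv ℝ r) ζ)) ζ :=
  l.hasFDerivAt.comp ζ (differentiableAt_fderiv h).hasFDerivAt

lemma sum_ddr_mul {r : Cn n → ℝ} {ζ : Cn n} (h : ContDiffAt ℝ 2 r ζ) (t s : Cn n) :
    ∑ j, ∑ k, ddr r j k ζ * t j * s k = qPart (fderiv ℝ (fderiv ℝ r) ζ) t s := by
  set B := fderiv ℝ (fderiv ℝ r) ζ with hB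
  have h1 : ∀ k, ∑ j, ddr r j k ζ * t j =
      (1 / 2) * (dPart (B t) (EuclideanSpace.single k 1)
        - Complex.I * dPart (B (Complex.I • t)) (EuclideanSpace.single k 1)) := by
    intro k
    have := sum_dz_mul (dz k (fun x => (r x : ℂ))) ζ t
    simp only [ddr]
    rw [this, linPart, (eventually_dz_eq h k).fderiv_eq, (fderiv_clm_fderiv h _).fderiv]
    rfl
  have h2 : ∀ L : Cn n →L[ℝ] ℝ, ∑ k, dPart L (EuclideanSpace.single k 1) * s k = dPart L s := by
    intro L
    have := linPart_eq_sum (Complex.ofRealCLM.comp L).toLinearMap s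
    simp only [single_I] at this
    exact this
  rw [Finset.sum_comm]
  simp_rw [← Finset.sum_mul, h1, mul_assoc, sub_mul, ← Finset.mul_sum, Finset.sum_sub_distrib,
    mul_assoc, ← Finset.mul_sum, h2]
  simp only [dPart, qPart]
  linear_combination (1 / 4 * ((B (Complex.I • t) (Complex.I • s) : ℝ) : ℂ)) * Complex.I_sq

lemma ddr_eq {r : Cn n → ℝ} {ζ : Cn n} (h : ContDiffAt ℝ 2 r ζ) (j k : Fin n) :
    ddr r j k ζ = qPart (fderiv ℝ (fderiv ℝ r) ζ) (EuclideanSpace.single j 1)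
      (EuclideanSpace.single k 1) := by
  rw [← sum_ddr_mul h, Finset.sum_eq_single j, Finset.sum_eq_single k]
  · simp
  · intro b _ hb
    simp [hb]
  · simp
  · intro b _ hb
    simp [hb]
  · simp

/-- Identifies the Levi form with the part of the real Hessian that is linear in `t` and conjugate
linear in `s`, so that it can be compared between nearby points through the Hessian alone. -/
lemma sum_levi_mul {r : Cn n → ℝ} {ζ : Cn n} (h : ContDiffAt ℝ 2 r ζ) (t s : Cn n) :
    ∑ j, ∑ k, dz j (dzbar k (fun x => (r x : ℂ))) ζ * t j * star (s k) =
      lPart (fderiv ℝ (fderiv ℝ r) ζ) t s := by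
  set B := fderiv ℝ (fderiv ℝ r) ζ with hB
  have h1 : ∀ k, ∑ j, dz j (dzbar k (fun x => (r x : ℂ))) ζ * t j =
      (1 / 2) * (dbarPartCLM (EuclideanSpace.single k 1) (B t)
        - Complex.I * dbarPartCLM (EuclideanSpace.single k 1) (B (Complex.I • t))) := by
    intro k
    have := sum_dz_mul (dzbar k (fun x => (r x : ℂ))) ζ t
    rw [this, linPart, (eventually_dzbar_eq h k).fderiv_eq, (fderiv_clm_fderiv h _).fderiv]
    rfl
  have h2 : ∀ L : Cn n →L[ℝ] ℝ, ∑ k, dbarPartCLM (EuclideanSpace.single k 1) L * star (s k) =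
      (1 / 2) * (L s + Complex.I * L (Complex.I • s)) := by
    intro L
    have := conjPart_eq_sum (Complex.ofRealCLM.comp L).toLinearMap s
    simp only [single_I] at this
    simp only [dbarPartCLM_apply]
    exact this
  rw [Finset.sum_comm]
  simp_rw [← Finset.sum_mul, h1, mul_assoc, sub_mul, ← Finset.mul_sum, Finset.sum_sub_distrib,
    mul_assoc, ← Finset.mul_sum, h2]
  simp only [lPart]
  linear_combination (-1 / 4 * ((B (Complex.I • t) (Complex.I • s) : ℝ) : ℂ)) * Complex.I_sq

lemma levi_eq {r : Cn n → ℝ} {ζ : Cn n} (h : ContDiffAt ℝ 2 r ζ) (t : Cn n) :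
    levi r ζ t = (lPart (fderiv ℝ (fderiv ℝ r) ζ) t t).re := by
  rw [levi, sum_levi_mul h]

lemma hessian_symm {r : Cn n → ℝ} {ζ : Cn n} (h : ContDiffAt ℝ 2 r ζ) (t s : Cn n) :
    fderiv ℝ (fderiv ℝ r) ζ t s = fderiv ℝ (fderiv ℝ r) ζ s t :=
  (h.isSymmSndFDerivAt (by simp)).eq t s

lemma leviPoly_eq {r : Cn n → ℝ} {ζ : Cn n} (h : ContDiffAt ℝ 2 r ζ) (z : Cn n) :
    leviPoly r ζ z = dPart (fderiv ℝ r ζ) (ζ - z) -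
      (1 / 2) * qPart (fderiv ℝ (fderiv ℝ r) ζ) (ζ - z) (ζ - z) := by
  rw [leviPoly, ← sum_ddr_mul h, ← sum_dr_mul (h.differentiableAt (by simp))]
  rfl

lemma form10_gCoeff {r : Cn n → ℝ} {ζ : Cn n} (h : ContDiffAt ℝ 2 r ζ) (K : ℝ) (z v : Cn n) :
    form10 (fun j x => gCoeff r K j x z) ζ v = dPart (fderiv ℝ r ζ) v -
      (1 / 2) * qPart (fderiv ℝ (fderiv ℝ r) ζ) v (ζ - z) +
        K * (‖ζ - z‖ * inner ℂ (ζ - z) v) := by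
  rw [← sum_ddr_mul h, ← sum_dr_mul (h.differentiableAt (by simp)), form10]
  simp only [gCoeff, PiLp.inner_apply, RCLike.inner_apply, Finset.mul_sum, ← Finset.sum_sub_distrib,
    ← Finset.sum_add_distrib, add_mul, sub_mul, Finset.sum_mul]
  refine Finset.sum_congr rfl fun j _ => ?_
  congr 1
  · congr 1
    refine Finset.sum_congr rfl fun k _ => ?_
    simp only [PiLp.sub_apply]
    ring
  · simp only [PiLp.sub_apply, starRingEnd_apply]
    ring

end CauchyFantappie

namespace CauchyFantappie

variable {n : ℕ}

/-! ### Reduction of `Ω₀(W)` to the numerators -/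

/-- With the second vector frozen, `form10 w x v` is a scalar function of `x`; thus `∂̄W` can be
computed from directional derivatives, without coordinates. -/
lemma dbarForm_eq_sub {w : Fin n → Cn n → ℂ} {ζ : Cn n} (hw : ∀ j, DifferentiableAt ℝ (w j) ζ)
    (u v : Cn n) : dbarForm w ζ u v =
      dbarFun (fun x => form10 w x v) ζ u - dbarFun (fun x => form10 w x u) ζ v := by
  have key : ∀ a b : Cn n, dbarFun (fun x => form10 w x b) ζ a =
      ∑ j, dbarFun (w j) ζ a * b j := by
    intro a b
    have hd : HasFDerivAt (fun x => form10 w x b) (∑ j, (b j) • fderiv ℝ (w j) ζ) ζ := by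
      unfold form10
      refine HasFDerivAt.fun_sum fun j _ => ?_
      exact (hw j).hasFDerivAt.mul_const (b j)
    rw [dbarFun_eq, hd.fderiv]
    simp only [dbarFun_eq, sum_apply, smul_apply,
      smul_eq_mul, Finset.mul_sum, ← Finset.sum_add_distrib]
    refine Finset.sum_congr rfl fun j _ => ?_
    ring
  rw [key, key, dbarForm, Finset.sum_sub_distrib]

/-- The quotient rule in the shape needed for `wedgePow_div`: the term with `∂̄s` is a multiple of
`g` and disappears after wedging with `g`. -/
lemma dbarFun_div {g s : Cn n → ℂ} {ζ : Cn n} (hg : DifferentiableAt ℝ g ζ)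
    (hs : DifferentiableAt ℝ s ζ) (h0 : s ζ ≠ 0) (u : Cn n) :
    dbarFun (fun x => g x / s x) ζ u =
      (s ζ)⁻¹ * (dbarFun g ζ u - dbarFun s ζ u / s ζ * g ζ) := by
  have hd := hg.hasFDerivAt.mul ((hasDerivAt_inv h0).comp_hasFDerivAt ζ hs.hasFDerivAt)
  have hd' : HasFDerivAt (fun x => g x / s x) _ ζ := hd
  rw [dbarFun_eq, dbarFun_eq, dbarFun_eq, hd'.fderiv]
  simp only [add_apply, smul_apply, smul_eq_mul, Function.comp_apply]
  field_simp
  ring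

lemma dbarFun_congr {f g : Cn n → ℂ} {ζ : Cn n} (h : f =ᶠ[nhds ζ] g) (u : Cn n) :
    dbarFun f ζ u = dbarFun g ζ u := by
  rw [dbarFun_eq, dbarFun_eq, h.fderiv_eq]

/-- `W ∧ (∂̄W)^m = s^{-(m+1)} g ∧ (∂̄g)^m` for `W = g / s`. -/
lemma wedgePow_div {w g : Fin n → Cn n → ℂ} {s : Cn n → ℂ} {ζ : Cn n}
    (hw : ∀ j, w j =ᶠ[nhds ζ] fun x => g j x / s x)
    (hg : ∀ j, DifferentiableAt ℝ (g j) ζ) (hs : DifferentiableAt ℝ s ζ) (h0 : s ζ ≠ 0)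
    (m : ℕ) (v : Fin (2 * m + 1) → Cn n) :
    wedgePow (form10 w ζ) (dbarForm w ζ) m v =
      (s ζ)⁻¹ ^ (m + 1) * wedgePow (form10 g ζ) (dbarForm g ζ) m v := by
  have hα : form10 w ζ = fun x => (s ζ)⁻¹ * form10 g ζ x := by
    funext x
    simp only [form10, Finset.mul_sum]
    refine Finset.sum_congr rfl fun j _ => ?_
    rw [(hw j).self_of_nhds]
    ring
  have hβ : dbarForm w ζ = fun x y => (s ζ)⁻¹ * (dbarForm g ζ x y +
      ((-dbarFun s ζ x / s ζ) * form10 g ζ y - (-dbarFun s ζ y / s ζ) * form10 g ζ x)) := by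
    funext x y
    simp only [dbarForm, form10, Finset.mul_sum, ← Finset.sum_sub_distrib,
      ← Finset.sum_add_distrib]
    refine Finset.sum_congr rfl fun j _ => ?_
    rw [dbarFun_congr (hw j), dbarFun_congr (hw j), dbarFun_div (hg j) hs h0,
      dbarFun_div (hg j) hs h0]
    ring
  rw [hα, hβ, wedgePow_smul, wedgePow_add_wedge (form10 g ζ) (fun x => -dbarFun s ζ x / s ζ)]

/-- `form10 w ζ` as a real linear map. -/
def form10Lin (w : Fin n → Cn n → ℂ) (ζ : Cn n) : Cn n →ₗ[ℝ] ℂ where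
  toFun := form10 w ζ
  map_add' x y := by simp only [form10, PiLp.add_apply, mul_add, Finset.sum_add_distrib]
  map_smul' c x := by
    simp only [form10, PiLp.smul_apply, RingHom.id_apply, mul_smul_comm, Finset.smul_sum]

/-- `dbarForm w ζ` as a real bilinear map. -/
def dbarFormLin (w : Fin n → Cn n → ℂ) (ζ : Cn n) : Cn n →ₗ[ℝ] Cn n →ₗ[ℝ] ℂ :=
  have hadd : ∀ (f : Cn n → ℂ) (x y : Cn n), dbarFun f ζ (x + y) = dbarFun f ζ x + dbarFun f ζ y := by
    intro f x y
    simp only [dbarFun_eq, smul_add, map_add]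
    ring
  have hsmul : ∀ (f : Cn n → ℂ) (c : ℝ) (x : Cn n), dbarFun f ζ (c • x) = c * dbarFun f ζ x := by
    intro f c x
    simp only [dbarFun_eq, smul_comm Complex.I c, map_smul, Complex.real_smul]
    ring
  LinearMap.mk₂ ℝ (dbarForm w ζ)
    (fun x y v => by
      simp only [dbarForm, hadd, PiLp.add_apply, ← Finset.sum_add_distrib]
      exact Finset.sum_congr rfl fun j _ => by ring)
    (fun c x v => by
      simp only [dbarForm, hsmul, PiLp.smul_apply, Complex.real_smul, Finset.mul_sum]
      exact Finset.sum_congr rfl fun j _ => by ring)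
    (fun x y v => by
      simp only [dbarForm, hadd, PiLp.add_apply, ← Finset.sum_add_distrib]
      exact Finset.sum_congr rfl fun j _ => by ring)
    (fun c x v => by
      simp only [dbarForm, hsmul, PiLp.smul_apply, Complex.real_smul, Finset.mul_sum]
      exact Finset.sum_congr rfl fun j _ => by ring)

/-! ### The forms `g` and `∂̄g` -/

/-- `(B, s) ↦ qPart B v s` as a continuous bilinear map. -/
def qPartCLM (v : Cn n) : (Cn n →L[ℝ] Cn n →L[ℝ] ℝ) →L[ℝ] Cn n →L[ℝ] ℂ :=
  LinearMap.mkContinuous₂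
    (LinearMap.mk₂ ℝ (fun B s => qPart B v s)
      (fun B B' s => by simp only [qPart, add_apply]; push_cast; ring)
      (fun c B s => by
        simp only [qPart, smul_apply, smul_eq_mul, Complex.real_smul]; push_cast; ring)
      (fun B s s' => by simp only [qPart, smul_add, map_add]; push_cast; ring)
      (fun c B s => by
        simp only [qPart, smul_comm Complex.I c, map_smul, smul_eq_mul, Complex.real_smul]
        push_cast; ring)) ‖v‖
    (fun B s => by
      refine (norm_qPart_le B v s).trans (le_of_eq ?_)
      ring)

@[simp] lemma qPartCLM_apply (v : Cn n) (B : Cn n →L[ℝ] Cn n →L[ℝ] ℝ) (s : Cn n) :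
    qPartCLM v B s = qPart B v s := rfl

/-- `x ↦ ⟪x, v⟫` as a real linear map. -/
def innerCLM (v : Cn n) : Cn n →L[ℝ] ℂ :=
  Complex.conjCLE.toContinuousLinearMap.comp ((innerSL ℂ v).restrictScalars ℝ)

@[simp] lemma innerCLM_apply (v x : Cn n) : innerCLM v x = inner ℂ x v := by
  simp [innerCLM]

/-- The third derivative. -/
abbrev fderiv3 (r : Cn n → ℝ) (ζ : Cn n) : Cn n →L[ℝ] Cn n →L[ℝ] Cn n →L[ℝ] ℝ :=
  fderiv ℝ (fderiv ℝ (fderiv ℝ r)) ζ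

lemma differentiableAt_norm_sub {ζ z : Cn n} (h : ζ ≠ z) :
    DifferentiableAt ℝ (fun x : Cn n => ‖x - z‖) ζ := by
  have h1 : ContDiffAt ℝ 1 (fun x : Cn n => ‖x‖) (ζ - z) := contDiffAt_norm ℂ (sub_ne_zero.2 h)
  exact (h1.differentiableAt (by simp)).comp ζ (differentiableAt_id.sub_const z)

lemma hasFDerivAt_clm_apply_sub {E X G : Type*} [NormedAddCommGroup E] [NormedSpace ℝ E]
    [NormedAddCommGroup X] [NormedSpace ℝ X] [NormedAddCommGroup G] [NormedSpace ℝ G]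
    (l : X →L[ℝ] E →L[ℝ] G) {B : E → X} {T : E →L[ℝ] X} {ζ : E} (hB : HasFDerivAt B T ζ) (z : E) :
    ∃ L : E →L[ℝ] G, HasFDerivAt (fun x => l (B x) (x - z)) L ζ ∧
      ∀ u, L u = l (T u) (ζ - z) + l (B ζ) u := by
  have h1 : HasFDerivAt (fun x => l (B x)) (l.comp T) ζ := l.hasFDerivAt.comp ζ hB
  refine ⟨_, h1.clm_apply ((hasFDerivAt_id ζ).sub_const z), fun u => ?_⟩
  simp [add_comm]

/-- The third derivative of `r` appears only contracted with `ζ - z`, so it costs a factor `|ζ -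
z|`. The condition `ζ ≠ z` is there for the norm in the `K` term. -/
lemma hasFDerivAt_form10_gCoeff {r : Cn n → ℝ} {ζ z : Cn n} (h : ContDiffAt ℝ 3 r ζ)
    (hne : ζ ≠ z) (K : ℝ) (v : Cn n) :
    ∃ L : Cn n →L[ℝ] ℂ, HasFDerivAt (fun x => form10 (fun j x => gCoeff r K j x z) x v) L ζ ∧
      ∀ u, L u = dPart (fderiv ℝ (fderiv ℝ r) ζ u) v -
        (1 / 2) * (qPart (fderiv3 r ζ u) v (ζ - z) + qPart (fderiv ℝ (fderiv ℝ r) ζ) v u) +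
        K * (‖ζ - z‖ * inner ℂ u v + fderiv ℝ (fun x : Cn n => ‖x - z‖) ζ u * inner ℂ (ζ - z) v) := by
  have h2 : ContDiffAt ℝ 2 r ζ := h.of_le (by norm_num)
  have hev : (fun x => form10 (fun j x => gCoeff r K j x z) x v) =ᶠ[nhds ζ] fun x =>
      dPartCLM v (fderiv ℝ r x) -
      (1 / 2) * qPartCLM v (fderiv ℝ (fderiv ℝ r) x) (x - z) +
        K * ((‖x - z‖ : ℝ) * innerCLM v (x - z)) := by
    filter_upwards [h2.eventually (by simp)] with x hx
    rw [form10_gCoeff hx]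
    simp
  have hB : DifferentiableAt ℝ (fderiv ℝ (fderiv ℝ r)) ζ :=
    ((h.fderiv_right (m := 2) (by norm_num)).fderiv_right (m := 1)
      (by norm_num)).differentiableAt (by simp)
  have d1 := fderiv_clm_fderiv h2 (dPartCLM v)
  have dsub : HasFDerivAt (fun x : Cn n => x - z) (ContinuousLinearMap.id ℝ (Cn n)) ζ :=
    (hasFDerivAt_id ζ).sub_const z
  obtain ⟨L₂, d2, hL₂⟩ := hasFDerivAt_clm_apply_sub (E := Cn n)
    (X := Cn n →L[ℝ] Cn n →L[ℝ] ℝ) (G := ℂ) (qPartCLM v) (T := fderiv3 r ζ) hB.hasFDerivAt z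
  have d3 := (innerCLM v).hasFDerivAt.comp ζ dsub
  have d4 := hasFDerivAt_ofReal (differentiableAt_norm_sub hne)
  have d := (d1.sub (d2.const_mul (1 / 2 : ℂ))).add ((d4.mul d3).const_mul (K : ℂ))
  refine ⟨_, d.congr_of_eventuallyEq hev, fun u => ?_⟩
  simp only [add_apply, sub_apply, smul_apply, smul_eq_mul, hL₂, ContinuousLinearMap.comp_apply,
    dPartCLM_apply, qPartCLM_apply, innerCLM_apply, Complex.ofRealCLM_apply,
    ContinuousLinearMap.id_apply, Function.comp_apply]
  ring

lemma differentiableAt_gCoeff {r : Cn n → ℝ} {ζ z : Cn n} (h : ContDiffAt ℝ 3 r ζ)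
    (hne : ζ ≠ z) (K : ℝ) (j : Fin n) : DifferentiableAt ℝ (fun x => gCoeff r K j x z) ζ := by
  obtain ⟨L, hL, -⟩ := hasFDerivAt_form10_gCoeff h hne K (EuclideanSpace.single j 1)
  refine hL.differentiableAt.congr_of_eventuallyEq (Filter.Eventually.of_forall fun x => ?_)
  simp only [form10]
  rw [Finset.sum_eq_single j]
  · simp
  · intro b _ hb
    simp [hb]
  · simp

/-- The term `qPart` in `(v, u)`, produced by differentiating `ζ - z`, is complex linear in `u` and
is annihilated by `∂̄`. The Hessian then contributes only the Levi form, and every other term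
carries a factor `|ζ - z|`. -/
lemma norm_dbarFun_form10_gCoeff_sub_le {r : Cn n → ℝ} {ζ z : Cn n} (h : ContDiffAt ℝ 3 r ζ)
    (hne : ζ ≠ z) {M : ℝ} (hT : ∀ u, ‖fderiv3 r ζ u‖ ≤ M * ‖u‖) (K : ℝ) (u v : Cn n) :
    ‖dbarFun (fun x => form10 (fun j x => gCoeff r K j x z) x v) ζ u -
      lPart (fderiv ℝ (fderiv ℝ r) ζ) v u‖ ≤
        (M + 2 * |K|) * ‖ζ - z‖ * ‖u‖ * ‖v‖ := by
  obtain ⟨L, hL, hLu⟩ := hasFDerivAt_form10_gCoeff h hne K v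
  have h2 : ContDiffAt ℝ 2 r ζ := h.of_le (by norm_num)
  set B := fderiv ℝ (fderiv ℝ r) ζ with hB
  set T := fderiv3 r ζ
  set N := fderiv ℝ (fun x : Cn n => ‖x - z‖) ζ with hN
  set w := ζ - z with hw
  have hN1 : ∀ u, ‖N u‖ ≤ ‖u‖ := by
    intro u
    have hlip : LipschitzWith 1 (fun x : Cn n => ‖x - z‖) := by
      refine LipschitzWith.of_dist_le_mul fun x y => ?_
      have := abs_norm_sub_norm_le (x - z) (y - z)
      simpa [Real.dist_eq, dist_eq_norm] using this
    have := norm_fderiv_le_of_lipschitz ℝ hlip (x₀ := ζ)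
    refine (N.le_opNorm u).trans (mul_le_of_le_one_left (norm_nonneg _) (by simpa using this))
  have hmain : dbarFun (fun x => form10 (fun j x => gCoeff r K j x z) x v) ζ u - lPart B v u =
      -(1 / 4) * (qPart (T u) v w + Complex.I * qPart (T (Complex.I • u)) v w) +
      K * ((1 / 2) * (‖w‖ * (inner ℂ u v + Complex.I * inner ℂ (Complex.I • u) v) +
        (N u + Complex.I * N (Complex.I • u)) * inner ℂ w v)) := by
    rw [dbarFun_eq, hL.fderiv, hLu, hLu, qPart_I_smul]
    have hs : ∀ t s, B t s = B s t := hessian_symm h2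
    simp only [dPart, lPart, hs v, hs (Complex.I • v)]
    linear_combination (-(1 / 4) * qPart B v u - 1 / 4 * (B (Complex.I • u) (Complex.I • v) : ℂ))
      * Complex.I_sq
  rw [hmain]
  have hTu : ‖T u‖ ≤ M * ‖u‖ := hT u
  have hTIu : ‖T (Complex.I • u)‖ ≤ M * ‖u‖ := by
    have := hT (Complex.I • u)
    rwa [norm_I_smul] at this
  have q1 : ‖qPart (T u) v w‖ ≤ M * ‖u‖ * ‖v‖ * ‖w‖ :=
    (norm_qPart_le _ _ _).trans (by gcongr)
  have q2 : ‖Complex.I * qPart (T (Complex.I • u)) v w‖ ≤ M * ‖u‖ * ‖v‖ * ‖w‖ := by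
    rw [norm_mul, Complex.norm_I, one_mul]
    exact (norm_qPart_le _ _ _).trans (by gcongr)
  have i1 : ‖inner ℂ u v + Complex.I * inner ℂ (Complex.I • u) v‖ ≤ 2 * (‖u‖ * ‖v‖) := by
    refine (norm_add_le _ _).trans ?_
    rw [norm_mul, Complex.norm_I, one_mul]
    have a1 := norm_inner_le_norm (𝕜 := ℂ) u v
    have a2 := norm_inner_le_norm (𝕜 := ℂ) (Complex.I • u) v
    rw [norm_I_smul] at a2
    linarith
  have i2 : ‖((N u : ℝ) : ℂ) + Complex.I * (N (Complex.I • u) : ℝ)‖ ≤ 2 * ‖u‖ := by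
    refine (norm_add_le _ _).trans ?_
    rw [norm_mul, Complex.norm_I, one_mul, Complex.norm_real, Complex.norm_real]
    have a1 := hN1 u
    have a2 := hN1 (Complex.I • u)
    rw [norm_I_smul] at a2
    linarith
  have i3 := norm_inner_le_norm (𝕜 := ℂ) w v
  have half : ‖(1 / 2 : ℂ)‖ = 1 / 2 := by norm_num
  have quarter : ‖(-(1 / 4) : ℂ)‖ = 1 / 4 := by norm_num
  have t1 : ‖-(1 / 4) * (qPart (T u) v w + Complex.I * qPart (T (Complex.I • u)) v w)‖ ≤
      M * ‖u‖ * ‖v‖ * ‖w‖ := by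
    rw [norm_mul, quarter]
    have := norm_add_le (qPart (T u) v w) (Complex.I * qPart (T (Complex.I • u)) v w)
    have : 0 ≤ M * ‖u‖ * ‖v‖ * ‖w‖ := (norm_nonneg _).trans q1
    linarith
  have t2 : ‖(K : ℂ) * ((1 / 2) * (‖w‖ * (inner ℂ u v + Complex.I * inner ℂ (Complex.I • u) v) +
        (N u + Complex.I * N (Complex.I • u)) * inner ℂ w v))‖ ≤ |K| * (2 * (‖w‖ * ‖u‖ * ‖v‖)) := by
    rw [norm_mul, norm_mul, half, Complex.norm_real, Real.norm_eq_abs]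
    refine mul_le_mul_of_nonneg_left ?_ (abs_nonneg K)
    have b1 : ‖(‖w‖ : ℂ) * (inner ℂ u v + Complex.I * inner ℂ (Complex.I • u) v)‖ ≤
        ‖w‖ * (2 * (‖u‖ * ‖v‖)) := by
      rw [norm_mul, Complex.norm_real, norm_norm]
      gcongr
    have b2 : ‖((N u : ℂ) + Complex.I * N (Complex.I • u)) * inner ℂ w v‖ ≤
        (2 * ‖u‖) * (‖w‖ * ‖v‖) := by
      rw [norm_mul]
      gcongr
    have b3 := norm_add_le ((‖w‖ : ℂ) * (inner ℂ u v + Complex.I * inner ℂ (Complex.I • u) v))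
      (((N u : ℂ) + Complex.I * N (Complex.I • u)) * inner ℂ w v)
    linarith
  refine (norm_add_le _ _).trans ?_
  linarith

/-- The factors 2 come from antisymmetrization: by Hermitian symmetry the two Levi terms have the
same norm. -/
lemma norm_dbarForm_gCoeff_le {r : Cn n → ℝ} {ζ z : Cn n} (h : ContDiffAt ℝ 3 r ζ)
    (hne : ζ ≠ z) {M : ℝ} (hT : ∀ u, ‖fderiv3 r ζ u‖ ≤ M * ‖u‖) (K : ℝ) (u v : Cn n) :
    ‖dbarForm (fun j x => gCoeff r K j x z) ζ u v‖ ≤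
      2 * ‖lPart (fderiv ℝ (fderiv ℝ r) ζ) u v‖ +
        2 * ((M + 2 * |K|) * ‖ζ - z‖ * ‖u‖ * ‖v‖) := by
  have h2 : ContDiffAt ℝ 2 r ζ := h.of_le (by norm_num)
  rw [dbarForm_eq_sub (differentiableAt_gCoeff h hne K)]
  have h1 := norm_dbarFun_form10_gCoeff_sub_le h hne hT K u v
  have h3 := norm_dbarFun_form10_gCoeff_sub_le h hne hT K v u
  have h4 : ‖lPart (fderiv ℝ (fderiv ℝ r) ζ) v u‖ = ‖lPart (fderiv ℝ (fderiv ℝ r) ζ) u v‖ := by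
    rw [← star_lPart (hessian_symm h2), norm_star]
  set a := dbarFun (fun x => form10 (fun j x => gCoeff r K j x z) x v) ζ u
  set b := dbarFun (fun x => form10 (fun j x => gCoeff r K j x z) x u) ζ v
  set p := lPart (fderiv ℝ (fderiv ℝ r) ζ) v u
  set q := lPart (fderiv ℝ (fderiv ℝ r) ζ) u v
  have : a - b = (a - p) - (b - q) + (p - q) := by ring
  rw [this]
  have e1 := norm_add_le ((a - p) - (b - q)) (p - q)
  have e2 := norm_sub_le (a - p) (b - q)
  have e3 := norm_sub_le p q
  have e4 : (M + 2 * |K|) * ‖ζ - z‖ * ‖v‖ * ‖u‖ =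
    (M + 2 * |K|) * ‖ζ - z‖ * ‖u‖ * ‖v‖ := by ring
  linarith

lemma norm_form10_gCoeff_le {r : Cn n → ℝ} {ζ z : Cn n} (h : ContDiffAt ℝ 2 r ζ)
    (K : ℝ) (hK : ‖ζ - z‖ ≤ 1) (v : Cn n) :
    ‖form10 (fun j x => gCoeff r K j x z) ζ v‖ ≤ ‖dPart (fderiv ℝ r ζ) v‖ +
      (‖fderiv ℝ (fderiv ℝ r) ζ‖ + |K|) * ‖ζ - z‖ * ‖v‖ := by
  rw [form10_gCoeff h]
  have h1 := norm_qPart_le (fderiv ℝ (fderiv ℝ r) ζ) v (ζ - z)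
  have half : ‖(1 / 2 : ℂ)‖ = 1 / 2 := by norm_num
  have h2 : ‖(1 / 2 : ℂ) * qPart (fderiv ℝ (fderiv ℝ r) ζ) v (ζ - z)‖ ≤
      ‖fderiv ℝ (fderiv ℝ r) ζ‖ * ‖v‖ * ‖ζ - z‖ := by
    rw [norm_mul, half]
    have : 0 ≤ ‖qPart (fderiv ℝ (fderiv ℝ r) ζ) v (ζ - z)‖ := norm_nonneg _
    linarith
  have h3 : ‖(K : ℂ) * (‖ζ - z‖ * inner ℂ (ζ - z) v)‖ ≤ |K| * (1 * (‖ζ - z‖ * ‖v‖)) := by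
    rw [norm_mul, norm_mul, Complex.norm_real, Complex.norm_real, norm_norm, Real.norm_eq_abs]
    gcongr
    exact norm_inner_le_norm _ _
  have h4 := norm_add_le (dPart (fderiv ℝ r ζ) v -
    (1 / 2) * qPart (fderiv ℝ (fderiv ℝ r) ζ) v (ζ - z)) ((K : ℂ) * (‖ζ - z‖ * inner ℂ (ζ - z) v))
  have h5 := norm_sub_le (dPart (fderiv ℝ r ζ) v)
    ((1 / 2) * qPart (fderiv ℝ (fderiv ℝ r) ζ) v (ζ - z))
  linarith

end CauchyFantappie

namespace CauchyFantappie

/-! ### Uniform bounds for a `C³` function near a compact set -/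

section Taylor

variable {E : Type*} [NormedAddCommGroup E] [NormedSpace ℝ E]

lemma fderiv_taylor {r : E → ℝ} {s : Set E} (hs : Convex ℝ s) {M : ℝ} {x p : E}
    (hx : x ∈ s) (hp : p ∈ s) (hd : ∀ y ∈ s, DifferentiableAt ℝ (fderiv ℝ r) y)
    (hM : ∀ y ∈ s, ∀ y' ∈ s, ‖fderiv ℝ (fderiv ℝ r) y - fderiv ℝ (fderiv ℝ r) y'‖ ≤ M * ‖y - y'‖)
    (hM0 : 0 ≤ M) :
    ‖fderiv ℝ r p - fderiv ℝ r x - fderiv ℝ (fderiv ℝ r) x (p - x)‖ ≤ M * ‖p - x‖ ^ 2 := by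
  -- Intersecting with the ball about `x` through `p` keeps the set convex and makes every increment
  -- at most `‖p - x‖`.
  have hconv : Convex ℝ (s ∩ Metric.closedBall x ‖p - x‖) := hs.inter (convex_closedBall _ _)
  have := hconv.norm_image_sub_le_of_norm_fderiv_le' (f := fderiv ℝ r) (C := M * ‖p - x‖)
    (φ := fderiv ℝ (fderiv ℝ r) x) (x := x) (y := p) (fun y hy => hd y hy.1)
    (fun y hy => (hM y hy.1 x hx).trans (mul_le_mul_of_nonneg_left
      (by simpa [dist_eq_norm] using hy.2) hM0)) ⟨hx, by simp⟩ ⟨hp, by simp [dist_eq_norm]⟩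
  refine this.trans (le_of_eq ?_)
  ring

/-- After subtraction of half the Hessian form, the derivative differs from its value at `x` by a
quadratic error, and the mean value inequality applies. Only a Lipschitz bound for the Hessian
enters, and the constant is not sharp. -/
lemma taylor_three {r : E → ℝ} {s : Set E} (hs : Convex ℝ s) {M : ℝ} {x p : E}
    (hx : x ∈ s) (hp : p ∈ s) (hr : ∀ y ∈ s, ContDiffAt ℝ 2 r y)
    (hM : ∀ y ∈ s, ∀ y' ∈ s, ‖fderiv ℝ (fderiv ℝ r) y - fderiv ℝ (fderiv ℝ r) y'‖ ≤ M * ‖y - y'‖)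
    (hM0 : 0 ≤ M) :
    |r p - r x - fderiv ℝ r x (p - x) - fderiv ℝ (fderiv ℝ r) x (p - x) (p - x) / 2| ≤
      M * ‖p - x‖ ^ 3 := by
  set B := fderiv ℝ (fderiv ℝ r) x with hB
  have hd : ∀ y ∈ s, DifferentiableAt ℝ (fderiv ℝ r) y := fun y hy =>
    ((hr y hy).fderiv_right (m := 1) (by norm_num)).differentiableAt (by simp)
  have hsymm : ∀ a b, B a b = B b a := fun a b =>
    ((hr x hx).isSymmSndFDerivAt (by simp)).eq a b
  have hconv : Convex ℝ (s ∩ Metric.closedBall x ‖p - x‖) := hs.inter (convex_closedBall _ _)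
  have hf : ∀ y ∈ s, HasFDerivAt (fun y => r y - B (y - x) (y - x) / 2)
      (fderiv ℝ r y - B (y - x)) y := by
    intro y hy
    have h1 := ((hr y hy).differentiableAt (by simp)).hasFDerivAt
    have hsub : HasFDerivAt (fun y : E => y - x) (ContinuousLinearMap.id ℝ E) y :=
      (hasFDerivAt_id y).sub_const x
    have h2 : HasFDerivAt (fun y => B (y - x)) B y := B.hasFDerivAt.comp y hsub
    have h3 := (h2.clm_apply hsub).const_mul (1 / 2 : ℝ)
    have h4 := h1.sub h3
    refine (h4.congr_fderiv ?_).congr_of_eventuallyEq (Filter.Eventually.of_forall fun y => ?_)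
    · ext u
      have := hsymm u (y - x)
      simp only [sub_apply, smul_apply, add_apply, ContinuousLinearMap.comp_apply,
        ContinuousLinearMap.id_apply, ContinuousLinearMap.flip_apply, smul_eq_mul, this]
      ring
    · simp; ring
  have := hconv.norm_image_sub_le_of_norm_fderiv_le'
    (f := fun y => r y - B (y - x) (y - x) / 2) (C := M * ‖p - x‖ ^ 2)
    (φ := fderiv ℝ r x) (x := x) (y := p) (fun y hy => (hf y hy.1).differentiableAt)
    (fun y hy => ?_) ⟨hx, by simp⟩ ⟨hp, by simp [dist_eq_norm]⟩
  · rw [Real.norm_eq_abs] at this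
    refine le_trans (le_of_eq ?_) (this.trans (le_of_eq ?_))
    · congr 1
      simp
      ring
    · ring
  · rw [(hf y hy.1).fderiv]
    have h1 := fderiv_taylor hs hx hy.1 hd hM hM0
    have h2 : ‖y - x‖ ≤ ‖p - x‖ := by simpa [dist_eq_norm] using hy.2
    have h3 : fderiv ℝ r y - B (y - x) - fderiv ℝ r x = fderiv ℝ r y - fderiv ℝ r x - B (y - x) := by
      abel
    rw [h3]
    refine h1.trans ?_
    gcongr

lemma exists_uniform_bounds [ProperSpace E] {r : E → ℝ} {X U : Set E} (hX : IsCompact X)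
    (hU : IsOpen U) (hXU : X ⊆ U) (hr : ContDiffOn ℝ 3 r U) :
    ∃ ρ > 0, ∃ M ≥ 1, ∀ y ∈ X, Metric.ball y ρ ⊆ U ∧
      (∀ x ∈ Metric.ball y ρ, ‖fderiv ℝ r x‖ ≤ M ∧ ‖fderiv ℝ (fderiv ℝ r) x‖ ≤ M ∧
        ‖fderiv ℝ (fderiv ℝ (fderiv ℝ r)) x‖ ≤ M) ∧
      ∀ x ∈ Metric.ball y ρ, ∀ x' ∈ Metric.ball y ρ, |r x - r x'| ≤ M * ‖x - x'‖ ∧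
        ‖fderiv ℝ r x - fderiv ℝ r x'‖ ≤ M * ‖x - x'‖ ∧
        ‖fderiv ℝ (fderiv ℝ r) x - fderiv ℝ (fderiv ℝ r) x'‖ ≤ M * ‖x - x'‖ := by
  obtain ⟨ρ, hρ, hsub⟩ := hX.exists_cthickening_subset_open hU hXU
  have hc : IsCompact (Metric.cthickening ρ X) := hX.cthickening
  have h1 : ContDiffOn ℝ 2 (fderiv ℝ r) U := hr.fderiv_of_isOpen hU (by norm_num)
  have h2 : ContDiffOn ℝ 1 (fderiv ℝ (fderiv ℝ r)) U := h1.fderiv_of_isOpen hU (by norm_num)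
  have h3 : ContDiffOn ℝ 0 (fderiv ℝ (fderiv ℝ (fderiv ℝ r))) U :=
    h2.fderiv_of_isOpen hU (by norm_num)
  obtain ⟨M₁, hM₁⟩ := hc.exists_bound_of_continuousOn (h1.continuousOn.mono hsub)
  obtain ⟨M₂, hM₂⟩ := hc.exists_bound_of_continuousOn (h2.continuousOn.mono hsub)
  obtain ⟨M₃, hM₃⟩ := hc.exists_bound_of_continuousOn (h3.continuousOn.mono hsub)
  refine ⟨ρ, hρ, max 1 (max M₁ (max M₂ M₃)), le_max_left _ _, fun y hy => ?_⟩
  set M := max 1 (max M₁ (max M₂ M₃))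
  have hb : Metric.ball y ρ ⊆ Metric.cthickening ρ X := fun x hx =>
    Metric.mem_cthickening_of_dist_le x y ρ X hy (Metric.mem_ball.1 hx).le
  have hbU := hb.trans hsub
  have b1 : ∀ x ∈ Metric.ball y ρ, ‖fderiv ℝ r x‖ ≤ M := fun x hx =>
    (hM₁ x (hb hx)).trans (by simp [M])
  have b2 : ∀ x ∈ Metric.ball y ρ, ‖fderiv ℝ (fderiv ℝ r) x‖ ≤ M := fun x hx =>
    (hM₂ x (hb hx)).trans (by simp [M])
  have b3 : ∀ x ∈ Metric.ball y ρ, ‖fderiv ℝ (fderiv ℝ (fderiv ℝ r)) x‖ ≤ M := fun x hx =>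
    (hM₃ x (hb hx)).trans (by simp [M])
  have hcv : Convex ℝ (Metric.ball y ρ) := convex_ball _ _
  refine ⟨hbU, fun x hx => ⟨b1 x hx, b2 x hx, b3 x hx⟩, fun x hx x' hx' => ⟨?_, ?_, ?_⟩⟩
  · exact hcv.norm_image_sub_le_of_norm_fderiv_le (fun p hp =>
      (hr.differentiableOn (by simp)).differentiableAt (hU.mem_nhds (hbU hp))) b1 hx' hx
  · exact hcv.norm_image_sub_le_of_norm_fderiv_le (fun p hp =>
      (h1.differentiableOn (by simp)).differentiableAt (hU.mem_nhds (hbU hp))) b2 hx' hx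
  · exact hcv.norm_image_sub_le_of_norm_fderiv_le (fun p hp =>
      (h2.differentiableOn (by simp)).differentiableAt (hU.mem_nhds (hbU hp))) b3 hx' hx

end Taylor

variable {n : ℕ}

/-- Bounds for `r` and its derivatives up to order three in the `ρ`-balls around the points
of `X`. -/
structure ThirdOrderBounds (r : Cn n → ℝ) (X : Set (Cn n)) (ρ M : ℝ) : Prop where
  pos : 0 < ρ
  one_le : 1 ≤ M
  contDiffAt : ∀ y ∈ X, ∀ x ∈ Metric.ball y ρ, ContDiffAt ℝ 3 r x
  norm_fderiv_le : ∀ y ∈ X, ∀ x ∈ Metric.ball y ρ, ‖fderiv ℝ r x‖ ≤ M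
  norm_hessian_le : ∀ y ∈ X, ∀ x ∈ Metric.ball y ρ, ‖fderiv ℝ (fderiv ℝ r) x‖ ≤ M
  norm_fderiv3_le : ∀ y ∈ X, ∀ x ∈ Metric.ball y ρ, ∀ u, ‖fderiv3 r x u‖ ≤ M * ‖u‖
  abs_sub_le : ∀ y ∈ X, ∀ x ∈ Metric.ball y ρ, ∀ x' ∈ Metric.ball y ρ,
    |r x - r x'| ≤ M * ‖x - x'‖
  fderiv_sub_le : ∀ y ∈ X, ∀ x ∈ Metric.ball y ρ, ∀ x' ∈ Metric.ball y ρ,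
    ‖fderiv ℝ r x - fderiv ℝ r x'‖ ≤ M * ‖x - x'‖
  hessian_sub_le : ∀ y ∈ X, ∀ x ∈ Metric.ball y ρ, ∀ x' ∈ Metric.ball y ρ,
    ‖fderiv ℝ (fderiv ℝ r) x - fderiv ℝ (fderiv ℝ r) x'‖ ≤ M * ‖x - x'‖

lemma exists_thirdOrderBounds {r : Cn n → ℝ} {X U : Set (Cn n)} (hX : IsCompact X)
    (hU : IsOpen U) (hXU : X ⊆ U) (hr : ContDiffOn ℝ 3 r U) :
    ∃ ρ M, ThirdOrderBounds r X ρ M ∧ ∀ y ∈ X, Metric.ball y ρ ⊆ U := by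
  obtain ⟨ρ, hρ, M, hM, h⟩ := exists_uniform_bounds hX hU hXU hr
  refine ⟨ρ, M, ⟨hρ, hM, fun y hy x hx => hr.contDiffAt (hU.mem_nhds ((h y hy).1 hx)),
    fun y hy x hx => ((h y hy).2.1 x hx).1, fun y hy x hx => ((h y hy).2.1 x hx).2.1,
    fun y hy x hx u => ?_, fun y hy x hx x' hx' => ((h y hy).2.2 x hx x' hx').1,
    fun y hy x hx x' hx' => ((h y hy).2.2 x hx x' hx').2.1,
    fun y hy x hx x' hx' => ((h y hy).2.2 x hx x' hx').2.2⟩, fun y hy => (h y hy).1⟩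
  exact ContinuousLinearMap.le_of_opNorm_le _ ((h y hy).2.1 x hx).2.2 u

lemma ThirdOrderBounds.taylor {r : Cn n → ℝ} {X : Set (Cn n)} {ρ M : ℝ}
    (h : ThirdOrderBounds r X ρ M) {y x p : Cn n} (hy : y ∈ X) (hx : x ∈ Metric.ball y ρ)
    (hp : p ∈ Metric.ball y ρ) :
    |r p - r x - fderiv ℝ r x (p - x) - fderiv ℝ (fderiv ℝ r) x (p - x) (p - x) / 2| ≤
      M * ‖p - x‖ ^ 3 :=
  taylor_three (convex_ball y ρ) hx hp (fun a ha => (h.contDiffAt y hy a ha).of_le (by norm_num))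
    (h.hessian_sub_le y hy) (zero_le_one.trans h.one_le)

/-- The `(1,0)`-gradient direction: a unit vector `ν` on which `∂r` is at least a multiple of
its norm, and a splitting of every vector into a multiple of `ν` and a vector in `ker ∂r`. -/
lemma exists_unit_normal {L : Cn n →L[ℝ] ℝ} (hL : L ≠ 0) :
    ∃ ν : Cn n, ‖ν‖ = 1 ∧ ‖L‖ ≤ L ν ∧ dPart L ν = (L ν / 2 : ℝ) ∧
      ∀ t, dPart L t = (L ν / 2 : ℝ) * inner ℂ ν t := by
  -- the Riesz representative of the complex functional `dPart L`
  let f : Cn n →ₗ[ℂ] ℂ :=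
    { toFun := dPart L
      map_add' := dPart_add L
      map_smul' := fun c t => by simpa using dPart_smul L c t }
  set a : Cn n := (InnerProductSpace.toDual ℂ (Cn n)).symm f.toContinuousLinearMap with ha
  have hin : ∀ t, inner ℂ a t = dPart L t := fun t => by
    rw [ha, InnerProductSpace.toDual_symm_apply]; rfl
  have hLre : ∀ t, L t = 2 * (dPart L t).re := fun t => by rw [dPart_re]; ring
  have ha0 : a ≠ 0 := by
    intro h
    refine hL (ContinuousLinearMap.ext fun t => ?_)
    rw [hLre, ← hin, h]
    simp
  have hna : 0 < ‖a‖ := norm_pos_iff.2 ha0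
  have hdν : ∀ t, inner ℂ a t = ‖a‖ * inner ℂ ((‖a‖⁻¹ : ℝ) • a) t := by
    intro t
    rw [RCLike.real_smul_eq_coe_smul (K := ℂ), inner_smul_left]
    have : (‖a‖ : ℂ) ≠ 0 := by exact_mod_cast hna.ne'
    simp
    field_simp
  have hνν : inner ℂ a ((‖a‖⁻¹ : ℝ) • a) = ((‖a‖ : ℝ) : ℂ) := by
    rw [RCLike.real_smul_eq_coe_smul (K := ℂ), inner_smul_right, inner_self_eq_norm_sq_to_K]
    have : (‖a‖ : ℂ) ≠ 0 := by exact_mod_cast hna.ne'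
    simp
    field_simp
  have hLν : L ((‖a‖⁻¹ : ℝ) • a) = 2 * ‖a‖ := by
    rw [hLre, ← hin, hνν, Complex.ofReal_re]
  refine ⟨(‖a‖⁻¹ : ℝ) • a, ?_, ?_, ?_, ?_⟩
  · rw [norm_smul, norm_inv, norm_norm, inv_mul_cancel₀ hna.ne']
  · rw [hLν]
    refine L.opNorm_le_bound (by positivity) fun t => ?_
    rw [hLre, ← hin, Real.norm_eq_abs, abs_mul, abs_two, mul_assoc]
    exact mul_le_mul_of_nonneg_left ((Complex.abs_re_le_norm _).trans (norm_inner_le_norm _ _))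
      (by norm_num)
  · rw [hLν, ← hin, hνν]
    congr 1
    ring
  · intro t
    rw [hLν, ← hin, hdν t]
    congr 2
    ring

end CauchyFantappie

namespace CauchyFantappie

variable {n : ℕ}

/-! ### Pseudoconvexity of the interior level sets of the modified defining function -/

lemma fderiv_modDef {φ : Cn n → ℝ} {x : Cn n} (h : DifferentiableAt ℝ φ x) (C : ℝ) :
    HasFDerivAt (modDef φ C) (Real.exp (-C * ‖x‖ ^ 2) •
      (fderiv ℝ φ x - (2 * C * φ x) • innerSL ℝ x)) x := by
  have h1 := (((hasStrictFDerivAt_norm_sq x).hasFDerivAt).const_mul (-C)).exp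
  have h2 := h.hasFDerivAt.mul h1
  refine h2.congr_fderiv ?_
  ext u
  simp only [add_apply, smul_apply, sub_apply, smul_eq_mul, nsmul_eq_mul]
  push_cast
  ring

lemma hessian_modDef {φ : Cn n → ℝ} {z : Cn n} (h : ContDiffAt ℝ 2 φ z) (C : ℝ) (u v : Cn n) :
    fderiv ℝ (fderiv ℝ (modDef φ C)) z u v = Real.exp (-C * ‖z‖ ^ 2) *
      (fderiv ℝ (fderiv ℝ φ) z u v
        - 2 * C * (inner ℝ z u * fderiv ℝ φ z v + fderiv ℝ φ z u * inner ℝ z v)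
        + 4 * C ^ 2 * φ z * inner ℝ z u * inner ℝ z v - 2 * C * φ z * inner ℝ u v) := by
  have hev : fderiv ℝ (modDef φ C) =ᶠ[nhds z] fun x => Real.exp (-C * ‖x‖ ^ 2) •
      (fderiv ℝ φ x - (2 * C * φ x) • innerSL ℝ x) := by
    filter_upwards [h.eventually (by simp)] with x hx
    exact (fderiv_modDef (hx.differentiableAt (by simp)) C).fderiv
  have h1 := (((hasStrictFDerivAt_norm_sq z).hasFDerivAt).const_mul (-C)).exp
  have h2 := (differentiableAt_fderiv h).hasFDerivAt
  have h3 := (h.differentiableAt (by simp)).hasFDerivAt.const_mul (2 * C)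
  have h4 : HasFDerivAt (fun x : Cn n => innerSL ℝ x) (innerSL ℝ) z := (innerSL ℝ).hasFDerivAt
  have h5 := h1.fun_smul (h2.fun_sub (h3.fun_smul h4))
  rw [hev.fderiv_eq, h5.fderiv]
  simp only [add_apply, smul_apply, sub_apply, smul_eq_mul, nsmul_eq_mul,
    ContinuousLinearMap.smulRight_apply, innerSL_apply_apply]
  have : innerSL ℝ u v = inner ℝ u v := innerSL_apply_apply ℝ u v
  rw [this]
  push_cast
  ring

lemma inner_real_eq_re (x y : Cn n) : inner ℝ x y = (inner ℂ x y).re := by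
  simp [PiLp.inner_apply, Complex.inner]

lemma dPart_modDef {φ : Cn n → ℝ} {z : Cn n} (h : DifferentiableAt ℝ φ z) (C : ℝ) (t : Cn n) :
    dPart (fderiv ℝ (modDef φ C) z) t = Real.exp (-C * ‖z‖ ^ 2) *
      (dPart (fderiv ℝ φ z) t - C * φ z * inner ℂ z t) := by
  rw [(fderiv_modDef h C).fderiv]
  have hI : (inner ℂ z (Complex.I • t)).re = -(inner ℂ z t).im := by
    rw [inner_smul_right]; simp
  simp only [dPart, smul_apply, sub_apply, smul_eq_mul, innerSL_apply_apply, inner_real_eq_re, hI]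
  conv_rhs => rw [← Complex.re_add_im (inner ℂ z t)]
  push_cast
  ring

/-- The gain comes from `-C φ |t|²`, which is nonnegative where `φ ≤ 0` and `C > 0`; the mixed term
also gains once `∂φ(t)` is expressed by `⟪z, t⟫` on `ker ∂r`. -/
lemma levi_modDef {φ : Cn n → ℝ} {z : Cn n} (h : ContDiffAt ℝ 2 φ z) (C : ℝ) (t : Cn n) :
    levi (modDef φ C) z t = Real.exp (-C * ‖z‖ ^ 2) *
      (levi φ z t - 2 * C * ((dPart (fderiv ℝ φ z) t).re * (inner ℂ z t).re +
        (dPart (fderiv ℝ φ z) t).im * (inner ℂ z t).im) +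
        φ z * (C ^ 2 * ((inner ℂ z t).re ^ 2 + (inner ℂ z t).im ^ 2) - C * ‖t‖ ^ 2)) := by
  have hI : (inner ℂ z (Complex.I • t)).re = -(inner ℂ z t).im := by
    rw [inner_smul_right]; simp
  have hsm : ContDiffAt ℝ 2 (modDef φ C) z := by
    unfold modDef
    exact h.mul ((contDiffAt_const.mul (contDiff_norm_sq ℝ).contDiffAt).exp)
  have htt : ∀ x : Cn n, (inner ℂ x x).re = ‖x‖ ^ 2 := fun x => by
    rw [inner_self_eq_norm_sq_to_K]; norm_cast
  rw [levi_eq hsm, levi_eq h, lPart_self_re, lPart_self_re, hessian_modDef h, hessian_modDef h,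
    dPart_re, dPart_im]
  simp only [inner_real_eq_re, hI, htt, norm_I_smul]
  ring

/-- Comparison of the `(1,1)`-part with its restriction to the complex tangent space. -/
lemma lPart_re_ge_tangential {B : Cn n →L[ℝ] Cn n →L[ℝ] ℝ} {M : ℝ} (hB : ‖B‖ ≤ M) {ν : Cn n}
    (hν : ‖ν‖ = 1) (t : Cn n) :
    (lPart B (t - inner ℂ ν t • ν) (t - inner ℂ ν t • ν)).re - 5 * M * ‖inner ℂ ν t‖ * ‖t‖ ≤
      (lPart B t t).re := by
  set e := inner ℂ ν t • ν with he
  set s := t - e with hs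
  have hM : 0 ≤ M := (norm_nonneg _).trans hB
  have hin : ‖inner ℂ ν t‖ ≤ ‖t‖ := by simpa [hν] using norm_inner_le_norm (𝕜 := ℂ) ν t
  have hne : ‖e‖ = ‖inner ℂ ν t‖ := by rw [he, norm_smul, hν, mul_one]
  have hns : ‖s‖ ≤ 2 * ‖t‖ := by
    have := norm_sub_le t e
    linarith
  have hts : t = s + e := by simp [hs]
  have hexp : lPart B t t = lPart B s s + (lPart B s e + lPart B e s + lPart B e e) := by
    rw [hts, lPart_add_fst, lPart_add_snd, lPart_add_snd]
    ring
  have b1 : ‖lPart B s e‖ ≤ M * (2 * ‖t‖) * ‖e‖ := (norm_lPart_le _ _ _).trans (by gcongr)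
  have b2 : ‖lPart B e s‖ ≤ M * ‖e‖ * (2 * ‖t‖) := (norm_lPart_le _ _ _).trans (by gcongr)
  have b3 : ‖lPart B e e‖ ≤ M * ‖e‖ * ‖t‖ :=
    (norm_lPart_le _ _ _).trans (by gcongr; rw [hne]; exact hin)
  -- 5 = 2 + 2 + 1: two mixed terms estimated with `‖s‖ ≤ 2 ‖t‖`, and one purely normal term.
  have b4 : ‖lPart B s e + lPart B e s + lPart B e e‖ ≤ 5 * M * ‖e‖ * ‖t‖ := by
    have := norm_add_le (lPart B s e + lPart B e s) (lPart B e e)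
    have := norm_add_le (lPart B s e) (lPart B e s)
    linarith
  have b5 := (Complex.abs_re_le_norm _).trans b4
  rw [hexp, Complex.add_re, ← hne]
  have := (abs_le.1 b5).1
  linarith

/-! ### Geometry of the boundary: sign of the defining function, distance to `bD`, Levi form inside
`D`. -/

lemma IsDefiningFunction.nonpos {k : ℕ∞} {D U : Set (Cn n)} {φ : Cn n → ℝ}
    (h : IsDefiningFunction k D U φ) {z : Cn n} (hz : z ∈ closure D) (hzU : z ∈ U) : φ z ≤ 0 := by
  have hc : ContinuousAt φ z := h.contDiffOn.continuousOn.continuousAt (h.isOpen.mem_nhds hzU)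
  by_contra hpos
  push Not at hpos
  have h1 : ∀ᶠ x in nhds z, 0 < φ x ∧ x ∈ U :=
    (hc.eventually (lt_mem_nhds hpos)).and (h.isOpen.mem_nhds hzU)
  obtain ⟨x, hx, hxD⟩ := mem_closure_iff_nhds.1 hz _ h1
  have : x ∈ D ∩ U := ⟨hxD, hx.2⟩
  rw [h.inter_eq] at this
  exact absurd this.2 (not_lt.2 hx.1.le)

lemma IsDefiningFunction.eq_zero {k : ℕ∞} {D U : Set (Cn n)} {φ : Cn n → ℝ} (hD : IsOpen D)
    (h : IsDefiningFunction k D U φ) {z : Cn n} (hz : z ∈ frontier D) : φ z = 0 := by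
  refine le_antisymm (h.nonpos hz.1 (h.frontier_subset hz)) ?_
  by_contra hneg
  push Not at hneg
  have : z ∈ D ∩ U := by
    rw [h.inter_eq]
    exact ⟨h.frontier_subset hz, hneg⟩
  rw [hD.frontier_eq] at hz
  exact hz.2 this.1

lemma exists_frontier_mem_segment {D : Set (Cn n)} (hD : IsOpen D) {z p : Cn n} (hz : z ∈ D)
    (hp : p ∉ D) : ∃ y ∈ frontier D, y ∈ segment ℝ z p := by
  by_contra hne
  push Not at hne
  have hpre : IsPreconnected (segment ℝ z p) := (convex_segment z p).isPreconnected
  have hcov : segment ℝ z p ⊆ D ∪ (closure D)ᶜ := by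
    intro y hy
    by_cases hyD : y ∈ D
    · exact Or.inl hyD
    · refine Or.inr fun hyc => hne y ?_ hy
      rw [hD.frontier_eq]
      exact ⟨hyc, hyD⟩
  have hpc : p ∈ (closure D)ᶜ := (hcov (right_mem_segment ℝ z p)).resolve_left hp
  obtain ⟨y, -, hy1, hy2⟩ := hpre D (closure D)ᶜ hD isClosed_closure.isOpen_compl hcov
    ⟨z, left_mem_segment ℝ z p, hz⟩ ⟨p, right_mem_segment ℝ z p, hpc⟩
  exact hy2 (subset_closure hy1)

/-- Near `bD`, the distance to `bD` is at most a multiple of `|φ|`. -/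
lemma exists_frontier_near {k : ℕ∞} {D U : Set (Cn n)} {φ : Cn n → ℝ} (hD : IsOpen D)
    (h : IsDefiningFunction k D U φ) {ρ M c : ℝ} (hb : ThirdOrderBounds φ (frontier D) ρ M)
    (hbU : ∀ y ∈ frontier D, Metric.ball y ρ ⊆ U) (hc : 0 < c)
    (hcφ : ∀ y ∈ frontier D, c ≤ ‖fderiv ℝ φ y‖) :
    ∃ δ > 0, ∀ y ∈ frontier D, ∀ z ∈ closure D, z ∈ Metric.ball y δ →
      z ∈ Metric.ball y ρ ∧
      ∃ y' ∈ frontier D, y' ∈ Metric.ball y ρ ∧ ‖z - y'‖ ≤ 4 / c * |φ z| := by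
  have hM : 0 < M := zero_lt_one.trans_le hb.one_le
  have hρ := hb.pos
  -- `s₀` limits the length of a step along the normal, and `δ` is chosen so that `|φ z| ≤ M δ`
  -- forces the step taken below under `s₀`.
  obtain ⟨s₀, hs₀, hs1, hs2, hs3⟩ : ∃ s₀ > 0, s₀ ≤ 1 ∧ s₀ ≤ c / (8 * M) ∧ s₀ ≤ ρ / 2 :=
    ⟨min 1 (min (c / (8 * M)) (ρ / 2)), by positivity, by simp, by simp, by simp⟩
  obtain ⟨δ, hδ, hδ1, hδ2, hδ3⟩ : ∃ δ > 0, δ ≤ ρ / 2 ∧ δ ≤ c / (2 * M) ∧ δ ≤ c * s₀ / (4 * M) :=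
    ⟨min (ρ / 2) (min (c / (2 * M)) (c * s₀ / (4 * M))), by positivity, by simp, by simp, by simp⟩
  refine ⟨δ, hδ, fun y hy z hz hzy => ?_⟩
  have hzρ : z ∈ Metric.ball y ρ := Metric.ball_subset_ball (by linarith) hzy
  refine ⟨hzρ, ?_⟩
  have hzd : ‖z - y‖ < δ := by simpa [dist_eq_norm] using hzy
  have hyρ : y ∈ Metric.ball y ρ := Metric.mem_ball_self hρ
  by_cases hzD : z ∈ D
  swap
  · refine ⟨z, ?_, hzρ, ?_⟩
    · rw [hD.frontier_eq]; exact ⟨hz, hzD⟩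
    · simp; positivity
  -- the gradient at `z` is bounded below
  have hL : c / 2 ≤ ‖fderiv ℝ φ z‖ := by
    have h1 := hb.fderiv_sub_le y hy y hyρ z hzρ
    have h2 := norm_sub_norm_le (fderiv ℝ φ y) (fderiv ℝ φ z)
    have h3 := hcφ y hy
    have h4 : M * ‖y - z‖ ≤ M * δ := by rw [norm_sub_rev]; gcongr
    have h5 : M * δ ≤ c / 2 := by
      rw [le_div_iff₀ (by positivity)] at hδ2
      linarith
    linarith
  have hL0 : fderiv ℝ φ z ≠ 0 := by
    intro h0
    rw [h0, norm_zero] at hL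
    linarith
  obtain ⟨ν, hν, hLν, -⟩ := exists_unit_normal hL0
  -- Along `ν` the gradient makes `φ` grow at rate at least `c / 2`, and the Taylor errors consume
  -- at most half of this. A step of length `4 |φ z| / c` therefore lifts `φ` to a nonnegative
  -- value, so the segment must meet `bD`.
  set s := 4 / c * |φ z| with hs
  have hφz : |φ z| ≤ M * δ := by
    have h1 := hb.abs_sub_le y hy z hzρ y hyρ
    rw [h.eq_zero hD hy, sub_zero] at h1
    exact h1.trans (by gcongr)
  have hss₀ : s ≤ s₀ := by
    have : M * δ ≤ c * s₀ / 4 := by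
      rw [le_div_iff₀ (by positivity)] at hδ3
      linarith
    calc s ≤ 4 / c * (c * s₀ / 4) := by rw [hs]; gcongr; exact hφz.trans this
      _ = s₀ := by field_simp
  have hsnn : 0 ≤ s := by positivity
  set p := z + s • ν with hp
  have hpz : p - z = s • ν := by simp [hp]
  have hnp : ‖p - z‖ = s := by rw [hpz, norm_smul, hν, mul_one, Real.norm_of_nonneg hsnn]
  have hpρ : p ∈ Metric.ball y ρ := by
    rw [Metric.mem_ball, dist_eq_norm]
    have : p - y = (p - z) + (z - y) := by abel
    rw [this]
    have := norm_add_le (p - z) (z - y)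
    linarith
  have hφp : 0 ≤ φ p := by
    have ht := hb.taylor hy hzρ hpρ
    rw [hnp, hpz] at ht
    have hB : |fderiv ℝ (fderiv ℝ φ) z (s • ν) (s • ν)| ≤ M * s ^ 2 := by
      have h1 := (fderiv ℝ (fderiv ℝ φ) z).le_opNorm₂ (s • ν) (s • ν)
      rw [norm_smul, hν, mul_one, Real.norm_of_nonneg hsnn] at h1
      refine h1.trans ?_
      have h2 := hb.norm_hessian_le y hy z hzρ
      calc ‖fderiv ℝ (fderiv ℝ φ) z‖ * s * s ≤ M * s * s := by gcongr
        _ = M * s ^ 2 := by ring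
    have hlin : c / 2 * s ≤ fderiv ℝ φ z (s • ν) := by
      rw [map_smul, smul_eq_mul, mul_comm]
      exact mul_le_mul_of_nonneg_left (hL.trans hLν) hsnn
    have h1 := (abs_le.1 ht).1
    have h2 := (abs_le.1 hB).1
    have h3 : M * s ^ 3 ≤ M * s ^ 2 := by
      have : s ^ 3 ≤ s ^ 2 := pow_le_pow_of_le_one hsnn (hss₀.trans hs1) (by norm_num)
      gcongr
    have h4 : M * s ^ 2 ≤ c / 8 * s := by
      have h5 : s ≤ c / (8 * M) := hss₀.trans hs2
      rw [le_div_iff₀ (by positivity)] at h5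
      nlinarith
    have h6 : -|φ z| ≤ φ z := neg_abs_le _
    have h7 : c / 4 * s = |φ z| := by rw [hs]; field_simp
    have h8 : 0 ≤ c * s := by positivity
    linarith
  have hpD : p ∉ D := fun hpD => by
    have : p ∈ D ∩ U := ⟨hpD, hbU y hy hpρ⟩
    rw [h.inter_eq] at this
    exact absurd this.2 (not_lt.2 hφp)
  obtain ⟨y', hy', hseg⟩ := exists_frontier_mem_segment hD hzD hpD
  refine ⟨y', hy', (convex_ball y ρ).segment_subset hzρ hpρ hseg, ?_⟩
  rw [norm_sub_rev]
  have := norm_sub_le_of_mem_segment hseg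
  rw [hnp] at this
  exact this

lemma norm_inner_normal_le {L : Cn n →L[ℝ] ℝ} {ν : Cn n} {c : ℝ} (hc : 0 < c) (hLν : c ≤ L ν)
    (hd : ∀ t, dPart L t = (L ν / 2 : ℝ) * inner ℂ ν t) (t : Cn n) :
    ‖inner ℂ ν t‖ ≤ 2 / c * ‖dPart L t‖ := by
  rw [hd t, norm_mul, Complex.norm_real, Real.norm_of_nonneg (by linarith)]
  have : 1 ≤ 2 / c * (L ν / 2) := by
    rw [div_mul_div_comm, le_div_iff₀ (by positivity)]
    linarith
  nlinarith [norm_nonneg (inner ℂ ν t)]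

lemma norm_dPart_le_add {L L' : Cn n →L[ℝ] ℝ} {d : ℝ} (h : ‖L - L'‖ ≤ d) (t : Cn n) :
    ‖dPart L' t‖ ≤ ‖dPart L t‖ + d * ‖t‖ := by
  have e : dPart L' t = dPart L t - dPart (L - L') t := by
    rw [dPart_sub_left]; ring
  rw [e]
  refine (norm_sub_le _ _).trans (add_le_add le_rfl ((norm_dPart_le _ _).trans ?_))
  gcongr

lemma lPart_re_sub_le {B B' : Cn n →L[ℝ] Cn n →L[ℝ] ℝ} {d : ℝ} (h : ‖B - B'‖ ≤ d) (t : Cn n) :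
    (lPart B' t t).re - d * ‖t‖ ^ 2 ≤ (lPart B t t).re := by
  have h3 : ‖lPart B t t - lPart B' t t‖ ≤ d * ‖t‖ ^ 2 := by
    rw [← lPart_sub_left]
    refine (norm_lPart_le _ _ _).trans ?_
    rw [mul_assoc, ← sq]
    gcongr
  have h4 := (abs_le.1 ((Complex.abs_re_le_norm _).trans h3)).1
  rw [Complex.sub_re] at h4
  linarith

/-- The Levi form in `D` near `bD` is bounded below. -/
lemma levi_ge_of_frontier {D : Set (Cn n)} {φ : Cn n → ℝ} {ρ M c : ℝ}
    (hb : ThirdOrderBounds φ (frontier D) ρ M) (hc : 0 < c)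
    (hcφ : ∀ y ∈ frontier D, c ≤ ‖fderiv ℝ φ y‖) (hlevi : ∀ y ∈ frontier D, LeviNonneg φ y)
    {y y' z : Cn n} (hy : y ∈ frontier D) (hy' : y' ∈ frontier D) (hz : z ∈ Metric.ball y ρ)
    (hy'ρ : y' ∈ Metric.ball y ρ) (t : Cn n) :
    -(10 * M / c * ((‖dPart (fderiv ℝ φ z) t‖ + M * ‖z - y'‖ * ‖t‖) * ‖t‖) +
      M * ‖z - y'‖ * ‖t‖ ^ 2) ≤ levi φ z t := by
  have hM : 0 < M := zero_lt_one.trans_le hb.one_le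
  have hL0 : fderiv ℝ φ y' ≠ 0 := by
    intro h0
    have := hcφ y' hy'
    rw [h0, norm_zero] at this
    linarith
  obtain ⟨ν, hν, hLν, hdν, hd⟩ := exists_unit_normal hL0
  have cz : ContDiffAt ℝ 2 φ z := (hb.contDiffAt y hy z hz).of_le (by norm_num)
  have cy : ContDiffAt ℝ 2 φ y' := (hb.contDiffAt y hy y' hy'ρ).of_le (by norm_num)
  have h1 := lPart_re_ge_tangential (hb.norm_hessian_le y hy y' hy'ρ) hν t
  have h2 : 0 ≤ (lPart (fderiv ℝ (fderiv ℝ φ) y') (t - inner ℂ ν t • ν) (t - inner ℂ ν t • ν)).re := by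
    rw [← levi_eq cy]
    refine hlevi y' hy' _ ?_
    rw [sum_dr_mul (cy.differentiableAt (by simp)), dPart_sub, dPart_smul, hdν, hd t]
    ring
  have h4 := lPart_re_sub_le (hb.hessian_sub_le y hy z hz y' hy'ρ) t
  have h5 := norm_inner_normal_le hc ((hcφ y' hy').trans hLν) hd t
  have h6 := norm_dPart_le_add (hb.fderiv_sub_le y hy z hz y' hy'ρ) t
  have h7 : 5 * M * ‖inner ℂ ν t‖ * ‖t‖ ≤
      10 * M / c * ((‖dPart (fderiv ℝ φ z) t‖ + M * ‖z - y'‖ * ‖t‖) * ‖t‖) := by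
    calc 5 * M * ‖inner ℂ ν t‖ * ‖t‖ ≤ 5 * M * (2 / c * (‖dPart (fderiv ℝ φ z) t‖ +
          M * ‖z - y'‖ * ‖t‖)) * ‖t‖ := by
          gcongr
          exact h5.trans (by gcongr)
      _ = _ := by ring
  rw [levi_eq cz]
  linarith

lemma exists_pos_le_norm_fderiv {X U : Set (Cn n)} {φ : Cn n → ℝ} (hX : IsCompact X)
    (hU : IsOpen U) (hXU : X ⊆ U) (hφ : ContDiffOn ℝ 3 φ U) (h0 : ∀ y ∈ X, fderiv ℝ φ y ≠ 0) :
    ∃ c > 0, ∀ y ∈ X, c ≤ ‖fderiv ℝ φ y‖ := by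
  have h1 : ContDiffOn ℝ 2 (fderiv ℝ φ) U := hφ.fderiv_of_isOpen hU (by norm_num)
  obtain ⟨c, hc, h⟩ := hX.exists_forall_le' ((h1.continuousOn.mono hXU).norm) (a := 0)
    (fun y hy => norm_pos_iff.2 (h0 y hy))
  exact ⟨c, hc, h⟩

lemma isCompact_frontier {D : Set (Cn n)} (hD : Bornology.IsBounded D) : IsCompact (frontier D) :=
  hD.isCompact_closure.of_isClosed_subset isClosed_frontier frontier_subset_closure

lemma three_le_coe {k : ℕ∞} (hk : 3 ≤ k) : (3 : WithTop ℕ∞) ≤ (k : WithTop ℕ∞) := by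
  have : ((3 : ℕ∞) : WithTop ℕ∞) ≤ (k : WithTop ℕ∞) := by exact_mod_cast hk
  exact this

theorem exists_levelsPseudoconvex {k : ℕ∞} (hk : 3 ≤ k) {D U : Set (Cn n)}
    {φ : Cn n → ℝ} (hD : IsPseudoconvexDomain k D U φ) :
    ∃ C : ℝ, 0 < C ∧ LevelsPseudoconvex D U (modDef φ C) := by
  have hdef := hD.isDefiningFunction
  have hφ : ContDiffOn ℝ 3 φ U := hdef.contDiffOn.of_le (three_le_coe hk)
  have hX := isCompact_frontier hD.isBounded
  obtain ⟨ρ, M, hb, hbU⟩ := exists_thirdOrderBounds hX hdef.isOpen hdef.frontier_subset hφ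
  obtain ⟨c, hc, hcφ⟩ := exists_pos_le_norm_fderiv hX hdef.isOpen hdef.frontier_subset hφ
    hdef.fderiv_ne_zero
  obtain ⟨δ, hδ, hnear⟩ := exists_frontier_near hD.isOpen hdef hb hbU hc hcφ
  have hM : 0 < M := zero_lt_one.trans_le hb.one_le
  -- `C₀` collects the constants of `levi_ge_of_frontier` after `‖z - y'‖` has been replaced by `4
  -- |φ z| / c`.
  set C₀ := 10 * M / c * (1 + M * (4 / c)) + M * (4 / c) with hC₀
  have hC₀pos : 0 < C₀ := by positivity
  refine ⟨C₀ + C₀ ^ 2, by positivity, U ∩ Metric.thickening δ (frontier D),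
    hdef.isOpen.inter Metric.isOpen_thickening, fun y hy =>
      ⟨hdef.frontier_subset hy, Metric.self_subset_thickening hδ _ hy⟩, Set.inter_subset_left, ?_⟩
  rintro z ⟨hzc, hzU, hzt⟩ t ht
  obtain ⟨y, hy, hzy⟩ := Metric.mem_thickening_iff.1 hzt
  obtain ⟨hzρ, y', hy', hy'ρ, hdist⟩ := hnear y hy z hzc hzy
  have cz : ContDiffAt ℝ 2 φ z := (hb.contDiffAt y hy z hzρ).of_le (by norm_num)
  have dz := cz.differentiableAt (by simp)
  set C := C₀ + C₀ ^ 2 with hC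
  rw [sum_dr_mul (fderiv_modDef dz C).differentiableAt, dPart_modDef dz, mul_eq_zero] at ht
  have hd : dPart (fderiv ℝ φ z) t = C * φ z * inner ℂ z t := by
    rcases ht with h | h
    · exact absurd h (by exact_mod_cast (Real.exp_pos _).ne')
    · exact sub_eq_zero.1 h
  have hφ0 : φ z ≤ 0 := hdef.nonpos hzc hzU
  have hlow := levi_ge_of_frontier hb hc hcφ hD.leviNonneg hy hy' hzρ hy'ρ t
  rw [levi_modDef cz]
  refine mul_nonneg (Real.exp_pos _).le ?_
  set a := inner ℂ z t with ha
  set f := |φ z| with hf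
  have hfφ : φ z = -f := by rw [hf, abs_of_nonpos hφ0, neg_neg]
  have hf0 : 0 ≤ f := abs_nonneg _
  have hCpos : 0 < C := by positivity
  have hnd : ‖dPart (fderiv ℝ φ z) t‖ = C * f * ‖a‖ := by
    rw [hd, norm_mul, norm_mul, Complex.norm_real, Complex.norm_real, Real.norm_of_nonneg hCpos.le,
      Real.norm_eq_abs]
  have hre : (dPart (fderiv ℝ φ z) t).re = C * φ z * a.re := by
    rw [hd, ← Complex.ofReal_mul, Complex.re_ofReal_mul]
  have him : (dPart (fderiv ℝ φ z) t).im = C * φ z * a.im := by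
    rw [hd, ← Complex.ofReal_mul, Complex.im_ofReal_mul]
  have hna : a.re ^ 2 + a.im ^ 2 = ‖a‖ ^ 2 := by
    rw [Complex.sq_norm, Complex.normSq_apply]; ring
  have hup : 10 * M / c * ((C * f * ‖a‖ + M * ‖z - y'‖ * ‖t‖) * ‖t‖) + M * ‖z - y'‖ * ‖t‖ ^ 2 ≤
      C₀ * (C * f * ‖a‖ * ‖t‖ + f * ‖t‖ ^ 2) := by
    have e1 : 10 * M / c * ((C * f * ‖a‖ + M * ‖z - y'‖ * ‖t‖) * ‖t‖) + M * ‖z - y'‖ * ‖t‖ ^ 2 ≤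
      10 * M / c * ((C * f * ‖a‖ + M * (4 / c * f) * ‖t‖) * ‖t‖) + M * (4 / c * f) * ‖t‖ ^ 2 := by
      gcongr
    refine e1.trans ?_
    have e2 : 0 ≤ (10 * M / c * (M * (4 / c)) + M * (4 / c)) * (C * f * ‖a‖ * ‖t‖) := by positivity
    have e3 : 0 ≤ 10 * M / c * (f * ‖t‖ ^ 2) := by positivity
    have e4 : C₀ * (C * f * ‖a‖ * ‖t‖ + f * ‖t‖ ^ 2) =
        10 * M / c * ((C * f * ‖a‖ + M * (4 / c * f) * ‖t‖) * ‖t‖) + M * (4 / c * f) * ‖t‖ ^ 2 +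
        (10 * M / c * (M * (4 / c)) + M * (4 / c)) * (C * f * ‖a‖ * ‖t‖) +
        10 * M / c * (f * ‖t‖ ^ 2) := by
      rw [hC₀]; ring
    rw [e4]
    linarith
  rw [hnd] at hlow
  rw [hre, him, hna, hfφ]
  -- On `ker ∂r` the weight contributes `f ((C‖a‖)² + C ‖t‖²)`, against a defect of at most `C₀ f (C
  -- ‖a‖ ‖t‖ + ‖t‖²)`. In `C = C₀ + C₀²` the summand `C₀` cancels the defect in `‖t‖²`, and `C₀²`
  -- leaves a quadratic form in `(C ‖a‖, ‖t‖)` of nonpositive discriminant.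
  have hfin : 0 ≤ f * ((C * ‖a‖) ^ 2 - C₀ * (C * ‖a‖) * ‖t‖ + C₀ ^ 2 * ‖t‖ ^ 2) := by
    refine mul_nonneg hf0 ?_
    nlinarith [sq_nonneg (C * ‖a‖ - C₀ * ‖t‖ / 2), sq_nonneg (C₀ * ‖t‖)]
  have e5 : C * -f * a.re * a.re + C * -f * a.im * a.im = -(C * f * ‖a‖ ^ 2) := by
    rw [← hna]; ring
  rw [e5]
  have e6 : C * (f * ‖t‖ ^ 2) = C₀ * (f * ‖t‖ ^ 2) + C₀ ^ 2 * (f * ‖t‖ ^ 2) := by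
    rw [hC]; ring
  linarith

end CauchyFantappie

namespace CauchyFantappie

variable {n : ℕ}

/-! ### The support function -/

/-- A `C³` defining function whose Levi form is nonnegative on the complex tangent spaces of `bD`,
with quantitative bounds. -/
structure LeviDefining (D : Set (Cn n)) (r : Cn n → ℝ) (ρ M c : ℝ) : Prop where
  bounds : ThirdOrderBounds r (frontier D) ρ M
  eq_zero : ∀ y ∈ frontier D, r y = 0
  nonpos : ∀ y ∈ frontier D, ∀ z ∈ closure D, z ∈ Metric.ball y ρ → r z ≤ 0
  pos : 0 < c
  le_norm_fderiv : ∀ y ∈ frontier D, c ≤ ‖fderiv ℝ r y‖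
  leviNonneg : ∀ y ∈ frontier D, LeviNonneg r y

/-- The unit normals `ν` at `y` used below. -/
structure IsUnitNormal (r : Cn n → ℝ) (y ν : Cn n) : Prop where
  norm_eq : ‖ν‖ = 1
  norm_le : ‖fderiv ℝ r y‖ ≤ fderiv ℝ r y ν
  dPart_self : dPart (fderiv ℝ r y) ν = (fderiv ℝ r y ν / 2 : ℝ)
  dPart_eq : ∀ t, dPart (fderiv ℝ r y) t = (fderiv ℝ r y ν / 2 : ℝ) * inner ℂ ν t

namespace LeviDefining

variable {D : Set (Cn n)} {r : Cn n → ℝ} {ρ M c : ℝ}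

lemma exists_isUnitNormal (h : LeviDefining D r ρ M c) {y : Cn n} (hy : y ∈ frontier D) :
    ∃ ν, IsUnitNormal r y ν := by
  have : fderiv ℝ r y ≠ 0 := by
    intro h0
    have := h.le_norm_fderiv y hy
    rw [h0, norm_zero] at this
    linarith [h.pos]
  obtain ⟨ν, h1, h2, h3, h4⟩ := exists_unit_normal this
  exact ⟨ν, h1, h2, h3, h4⟩

lemma M_pos (h : LeviDefining D r ρ M c) : 0 < M := zero_lt_one.trans_le h.bounds.one_le

lemma mem_ball_self (h : LeviDefining D r ρ M c) (y : Cn n) : y ∈ Metric.ball y ρ :=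
  Metric.mem_ball_self h.bounds.pos

lemma contDiffAt (h : LeviDefining D r ρ M c) {y : Cn n} (hy : y ∈ frontier D) :
    ContDiffAt ℝ 3 r y := h.bounds.contDiffAt y hy y (h.mem_ball_self y)

lemma contDiffAt_two (h : LeviDefining D r ρ M c) {y : Cn n} (hy : y ∈ frontier D) :
    ContDiffAt ℝ 2 r y := (h.contDiffAt hy).of_le (by norm_num)

lemma levi_tangential_nonneg (h : LeviDefining D r ρ M c) {y ν : Cn n} (hy : y ∈ frontier D)
    (hν : IsUnitNormal r y ν) {t : Cn n} (ht : inner ℂ ν t = 0) :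
    0 ≤ (lPart (fderiv ℝ (fderiv ℝ r) y) t t).re := by
  have cy := h.contDiffAt_two hy
  rw [← levi_eq cy]
  refine h.leviNonneg y hy _ ?_
  rw [sum_dr_mul (cy.differentiableAt (by simp)), hν.dPart_eq, ht, mul_zero]

lemma inner_tangential {ν : Cn n} (hν : ‖ν‖ = 1) (t : Cn n) :
    inner ℂ ν (t - inner ℂ ν t • ν) = 0 := by
  rw [inner_sub_right, inner_smul_right, inner_self_eq_norm_sq_to_K, hν]
  simp

/-- The basic lower bound for the support function, with the Levi form taken at a boundary
point `y` close to `ζ`. -/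
lemma Phi_ge (h : LeviDefining D r ρ M c) {ζ z y ν : Cn n} (hζ : ζ ∈ frontier D)
    (hz : z ∈ closure D) (hy : y ∈ frontier D) (hν : IsUnitNormal r y ν)
    (hζy : ‖ζ - y‖ ≤ 2 * ‖ζ - z‖) (hρ : 2 * ‖ζ - z‖ < ρ) (hsmall : 10 * M / c * ‖ζ - z‖ ≤ 1 / 2)
    {K : ℝ} (hK : 6 * M + 6 * M * (10 * M / c) ≤ K) :
    (lPart (fderiv ℝ (fderiv ℝ r) y) (ζ - z - inner ℂ ν (ζ - z) • ν)
      (ζ - z - inner ℂ ν (ζ - z) • ν)).re + K * ‖ζ - z‖ ^ 3 ≤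
      2 * (Phi r K ζ z).re + 1 / 2 * ‖Phi r K ζ z‖ := by
  set w := ζ - z with hw
  have hM := h.M_pos
  have hc := h.pos
  have hK0 : 0 ≤ K := le_trans (by positivity) hK
  have hζρ := h.mem_ball_self ζ
  have hzρ : z ∈ Metric.ball ζ ρ := by
    rw [Metric.mem_ball, dist_comm, dist_eq_norm]
    linarith [norm_nonneg w]
  have hyρ : y ∈ Metric.ball ζ ρ := by
    rw [Metric.mem_ball, dist_comm, dist_eq_norm]
    linarith
  have cζ := h.contDiffAt_two hζ
  have hΦ : Phi r K ζ z = dPart (fderiv ℝ r ζ) w -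
      (1 / 2) * qPart (fderiv ℝ (fderiv ℝ r) ζ) w w + (K * ‖w‖ ^ 3 : ℝ) := by
    rw [Phi, leviPoly_eq cζ, h.eq_zero ζ hζ]
    push_cast
    ring
  set L := fderiv ℝ r ζ with hL
  set B := fderiv ℝ (fderiv ℝ r) ζ with hB
  set B' := fderiv ℝ (fderiv ℝ r) y with hB'
  have hhalf : ∀ x : ℂ, ((1 / 2 : ℂ) * x).re = x.re / 2 := fun x => by
    have : (1 / 2 : ℂ) = ((1 / 2 : ℝ) : ℂ) := by norm_num
    rw [this, Complex.re_ofReal_mul]; ring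
  have hre : 2 * (Phi r K ζ z).re = L w - (B w w - B (Complex.I • w) (Complex.I • w)) / 4 +
      2 * (K * ‖w‖ ^ 3) := by
    rw [hΦ, Complex.add_re, Complex.sub_re, hhalf, dPart_re, qPart_self_re, Complex.ofReal_re]
    ring
  have htay := h.bounds.taylor hζ hζρ hzρ
  have hzw : z - ζ = -w := by rw [hw]; abel
  rw [hzw, h.eq_zero ζ hζ, map_neg, map_neg, map_neg, neg_apply, norm_neg] at htay
  have h1 := (abs_le.1 htay).2
  -- The sign `r z ≤ 0` turns Taylor's formula into a lower bound for `L w`. Together with the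
  -- second-order term of the Levi polynomial, it leaves exactly the Levi form of `w`, up to a cubic
  -- error.
  have hr := h.nonpos ζ hζ z hz hzρ
  have h1' := (abs_le.1 htay).1
  have h2 : (lPart B w w).re = (B w w + B (Complex.I • w) (Complex.I • w)) / 4 := lPart_self_re B w
  have h3 := lPart_re_sub_le (h.bounds.hessian_sub_le ζ hζ ζ hζρ y hyρ) w
  have h4 := lPart_re_ge_tangential (h.bounds.norm_hessian_le ζ hζ y hyρ) hν.norm_eq w
  have h5 := norm_inner_normal_le hc ((h.le_norm_fderiv y hy).trans hν.norm_le) hν.dPart_eq w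
  have h6 := norm_dPart_le_add (h.bounds.fderiv_sub_le ζ hζ ζ hζρ y hyρ) w
  -- The normal component of `w` is controlled through `Φ` itself, whose leading term is `∂r(w)`
  -- because `r ζ = 0`.
  have h7 : ‖dPart L w‖ ≤ ‖Phi r K ζ z‖ + M * ‖w‖ ^ 2 + K * ‖w‖ ^ 3 := by
    have e : dPart L w = Phi r K ζ z + (1 / 2) * qPart B w w - (K * ‖w‖ ^ 3 : ℝ) := by
      rw [hΦ]; ring
    have e1 := norm_sub_le (Phi r K ζ z + (1 / 2) * qPart B w w) ((K * ‖w‖ ^ 3 : ℝ) : ℂ)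
    have e2 := norm_add_le (Phi r K ζ z) ((1 / 2) * qPart B w w)
    have e3 : ‖(1 / 2 : ℂ) * qPart B w w‖ ≤ M * ‖w‖ ^ 2 := by
      rw [norm_mul]
      have a1 : ‖qPart B w w‖ ≤ M * ‖w‖ * ‖w‖ := (norm_qPart_le _ _ _).trans (by
        gcongr; exact h.bounds.norm_hessian_le ζ hζ ζ hζρ)
      have a2 : ‖(1 / 2 : ℂ)‖ = 1 / 2 := by norm_num
      rw [a2]
      nlinarith [norm_nonneg (qPart B w w)]
    rw [Complex.norm_real, Real.norm_of_nonneg (by positivity)] at e1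
    rw [e]
    linarith
  set F := ‖Phi r K ζ z‖ with hF
  set A := 10 * M / c with hA
  have hA0 : 0 ≤ A := by positivity
  have h8 : M * ‖ζ - y‖ * ‖w‖ ^ 2 ≤ 2 * M * ‖w‖ ^ 3 := by
    calc M * ‖ζ - y‖ * ‖w‖ ^ 2 ≤ M * (2 * ‖w‖) * ‖w‖ ^ 2 := by gcongr
      _ = _ := by ring
  have h9 : ‖dPart (fderiv ℝ r y) w‖ ≤ F + 3 * M * ‖w‖ ^ 2 + K * ‖w‖ ^ 3 := by
    have : M * ‖ζ - y‖ * ‖w‖ ≤ M * (2 * ‖w‖) * ‖w‖ := by gcongr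
    nlinarith
  have h10 : 5 * M * ‖inner ℂ ν w‖ * ‖w‖ ≤ A * ‖w‖ * (F + 3 * M * ‖w‖ ^ 2 + K * ‖w‖ ^ 3) := by
    calc 5 * M * ‖inner ℂ ν w‖ * ‖w‖ ≤
        5 * M * (2 / c * (F + 3 * M * ‖w‖ ^ 2 + K * ‖w‖ ^ 3)) * ‖w‖ := by
          gcongr
          exact h5.trans (by gcongr)
      _ = _ := by rw [hA]; ring
  have h11 : A * ‖w‖ * (F + 3 * M * ‖w‖ ^ 2 + K * ‖w‖ ^ 3) ≤
      1 / 2 * F + 3 * M * A * ‖w‖ ^ 3 + 1 / 2 * (K * ‖w‖ ^ 3) := by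
    have a1 : A * ‖w‖ * F ≤ 1 / 2 * F := mul_le_mul_of_nonneg_right hsmall (norm_nonneg _)
    have a2 : A * ‖w‖ * (K * ‖w‖ ^ 3) ≤ 1 / 2 * (K * ‖w‖ ^ 3) :=
      mul_le_mul_of_nonneg_right hsmall (by positivity)
    have a3 : A * ‖w‖ * (3 * M * ‖w‖ ^ 2) = 3 * M * A * ‖w‖ ^ 3 := by ring
    have a4 : A * ‖w‖ * (F + 3 * M * ‖w‖ ^ 2 + K * ‖w‖ ^ 3) = A * ‖w‖ * F +
      A * ‖w‖ * (3 * M * ‖w‖ ^ 2) + A * ‖w‖ * (K * ‖w‖ ^ 3) := by ring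
    linarith
  -- Of the available `2K‖w‖³`, one `K‖w‖³` stays in the conclusion and `½K‖w‖³` absorbs the `K`
  -- part of the normal error. The last half has to cover `M` from Taylor's formula, `2M` from
  -- moving the Levi form to `y`, and `3MA` from the normal component; hence the threshold `6M +
  -- 6MA`.
  have h12 : (6 * M + 6 * M * A) * ‖w‖ ^ 3 ≤ K * ‖w‖ ^ 3 := by gcongr
  have h13 : (6 * M + 6 * M * A) * ‖w‖ ^ 3 = 6 * (M * ‖w‖ ^ 3) + 6 * (M * A * ‖w‖ ^ 3) := by ring
  have h14 : 3 * M * A * ‖w‖ ^ 3 = 3 * (M * A * ‖w‖ ^ 3) := by ring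
  have h15 : 2 * M * ‖w‖ ^ 3 = 2 * (M * ‖w‖ ^ 3) := by ring
  rw [hre]
  linarith

/-- The global support function does not vanish. -/
lemma S_ne_zero (h : LeviDefining D r ρ M c) {ζ z : Cn n} (hζ : ζ ∈ frontier D)
    (hz : z ∈ closure D) (hne : ζ ≠ z) {K ε : ℝ} (hK : 6 * M + 6 * M * (10 * M / c) ≤ K)
    (hε : 2 * ε ≤ ρ) (hε' : 10 * M / c * ε ≤ 1 / 2) {χ : ℝ → ℝ}
    (hχ : IsCutoff ε χ) : S r K χ ζ z ≠ 0 := by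
  have hw : 0 < ‖ζ - z‖ := norm_pos_iff.2 (sub_ne_zero.2 hne)
  have hM := h.M_pos
  have hc := h.pos
  have hsq : ((‖ζ - z‖ : ℂ)) ^ 2 ≠ 0 := pow_ne_zero _ (by exact_mod_cast hw.ne')
  unfold S
  rcases eq_or_lt_of_le (hχ.nonneg ‖ζ - z‖) with h0 | h0
  · rw [← h0]
    simpa using hsq
  · have hlt : ‖ζ - z‖ < 3 / 4 * ε := by
      by_contra hcon
      push Not at hcon
      exact h0.ne' (hχ.eq_zero _ hcon)
    obtain ⟨ν, hν⟩ := h.exists_isUnitNormal hζ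
    have hlow := h.Phi_ge hζ hz hζ hν (by simp) (by linarith)
      (le_trans (mul_le_mul_of_nonneg_left (by linarith) (by positivity)) hε') hK
    have hlevi := h.levi_tangential_nonneg hζ hν (inner_tangential hν.norm_eq (ζ - z))
    have hKpos : 0 < K * ‖ζ - z‖ ^ 3 := by
      have : 0 < 6 * M + 6 * M * (10 * M / c) := by positivity
      have : 0 < K := by linarith
      positivity
    -- A zero of `S` would make `Φ` a nonpositive real number. Then `2 Re Φ + ½ |Φ| = -(3/2) |Φ| ≤
    -- 0`, against the positive lower bound of `Phi_ge`.
    intro hS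
    set x := χ ‖ζ - z‖ with hx
    have hx1 := hχ.le_one ‖ζ - z‖
    have hΦ : Phi r K ζ z = ((-((1 - x) * ‖ζ - z‖ ^ 2 / x) : ℝ) : ℂ) := by
      have : (x : ℂ) ≠ 0 := by exact_mod_cast h0.ne'
      push_cast
      field_simp
      linear_combination hS
    have hneg : 0 ≤ (1 - x) * ‖ζ - z‖ ^ 2 / x :=
      div_nonneg (mul_nonneg (by linarith) (by positivity)) h0.le
    rw [hΦ, Complex.ofReal_re, Complex.norm_real, norm_neg, Real.norm_of_nonneg hneg] at hlow
    linarith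

end LeviDefining

/-! ### An eigenframe of the Levi form -/

/-- An orthonormal frame of the complex tangent space that diagonalizes a Hermitian form. -/
structure IsLeviFrame {m : ℕ} (B : Cn n →L[ℝ] Cn n →L[ℝ] ℝ) (ν : Cn n) (e : Fin m → Cn n)
    (l : Fin m → ℝ) : Prop where
  norm_eq : ∀ j, ‖e j‖ = 1
  inner_normal : ∀ j, inner ℂ ν (e j) = 0
  lPart_eq : ∀ i j, lPart B (e i) (e j) = if i = j then (l j : ℂ) else 0
  sum_eq : ∀ t, ∑ j, inner ℂ (e j) t • e j + inner ℂ ν t • ν = t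
  lPart_tangential : ∀ t, lPart B (t - inner ℂ ν t • ν) (t - inner ℂ ν t • ν) =
    ∑ j, ((l j * ‖inner ℂ (e j) t‖ ^ 2 : ℝ) : ℂ)

/-- The spectral theorem for the self-adjoint operator that represents the form on the orthogonal
complement of `ν`. No dependence on the base point is claimed, as the frame stays fixed during the
integration. -/
lemma exists_isLeviFrame {m : ℕ} {B : Cn (m + 1) →L[ℝ] Cn (m + 1) →L[ℝ] ℝ}
    (hB : ∀ t s, B t s = B s t) {ν : Cn (m + 1)} (hν : ‖ν‖ = 1) :
    ∃ (e : Fin m → Cn (m + 1)) (l : Fin m → ℝ), IsLeviFrame B ν e l := by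
  set T : Submodule ℂ (Cn (m + 1)) := (ℂ ∙ ν)ᗮ with hT
  have hν0 : ν ≠ 0 := by
    intro h0
    simp [h0] at hν
  have hmem : ∀ t : Cn (m + 1), t ∈ T ↔ inner ℂ ν t = 0 := fun t =>
    Submodule.mem_orthogonal_singleton_iff_inner_right
  have hfin : Module.finrank ℂ T = m := by
    have : Fact (Module.finrank ℂ (Cn (m + 1)) = m + 1) := ⟨by simp⟩
    exact Submodule.finrank_orthogonal_span_singleton hν0
  set b := stdOrthonormalBasis ℂ T with hb
  have hlsum_fst : ∀ {ι : Type} (I : Finset ι) (c : ι → ℂ) (x : ι → Cn (m + 1)) (s : Cn (m + 1)),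
      lPart B (∑ i ∈ I, c i • x i) s = ∑ i ∈ I, c i * lPart B (x i) s := by
    intro ι I c x s
    classical
    induction I using Finset.induction_on with
    | empty => simp [lPart]
    | insert a I ha ih => rw [Finset.sum_insert ha, Finset.sum_insert ha, lPart_add_fst, ih,
        lPart_smul_fst]
  -- `A` is built so that `⟪A t, s⟫` is the form at `(s, t)`: the swap reconciles the inner product,
  -- conjugate linear in its first slot, with `lPart`, conjugate linear in its second.
  let A : T →ₗ[ℂ] T :=
    { toFun := fun t => ∑ i, lPart B t (b i) • b i
      map_add' := fun t s => by
        simp only [Submodule.coe_add, lPart_add_fst, add_smul, Finset.sum_add_distrib]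
      map_smul' := fun c t => by
        simp only [Submodule.coe_smul, lPart_smul_fst, mul_smul, Finset.smul_sum, RingHom.id_apply] }
  have hA : ∀ t s : T, inner ℂ (A t) s = lPart B (s : Cn (m + 1)) t := by
    intro t s
    have hs : (s : Cn (m + 1)) = ∑ i, inner ℂ (b i) s • (b i : Cn (m + 1)) := by
      conv_lhs => rw [← b.sum_repr' s]
      push_cast
      rfl
    change inner ℂ (∑ i, lPart B t (b i) • b i) s = _
    rw [sum_inner]
    conv_rhs => rw [hs, hlsum_fst]
    refine Finset.sum_congr rfl fun i _ => ?_
    rw [inner_smul_left, mul_comm, starRingEnd_apply, star_lPart hB]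
  have hsymm : A.IsSymmetric := by
    intro t s
    rw [hA, ← inner_conj_symm, hA, starRingEnd_apply, star_lPart hB]
  set e := hsymm.eigenvectorBasis hfin with he
  have hlev : ∀ (t : T) (j : Fin m), lPart B (t : Cn (m + 1)) (e j) =
      hsymm.eigenvalues hfin j * inner ℂ (e j) t := by
    intro t j
    rw [← hA, he, hsymm.apply_eigenvectorBasis, inner_smul_left]
    simp
  have hsumT : ∀ t : T, (t : Cn (m + 1)) =
      ∑ j, inner ℂ (e j : Cn (m + 1)) (t : Cn (m + 1)) • (e j : Cn (m + 1)) := by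
    intro t
    conv_lhs => rw [← e.sum_repr' t]
    push_cast
    rfl
  have hin : ∀ j, inner ℂ ν (e j : Cn (m + 1)) = 0 := fun j => (hmem _).1 (e j).2
  have hin' : ∀ j, inner ℂ (e j : Cn (m + 1)) ν = 0 := fun j => by
    rw [← inner_conj_symm, hin, map_zero]
  have htan : ∀ t : Cn (m + 1), t - inner ℂ ν t • ν ∈ T := fun t =>
    (hmem _).2 (LeviDefining.inner_tangential hν t)
  have hint : ∀ t j, inner ℂ (e j : Cn (m + 1)) (t - inner ℂ ν t • ν) =
      inner ℂ (e j : Cn (m + 1)) t := fun t j => by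
    rw [inner_sub_right, inner_smul_right, hin', mul_zero, sub_zero]
  refine ⟨fun j => (e j : Cn (m + 1)), hsymm.eigenvalues hfin, ⟨fun j => ?_, hin, fun i j => ?_,
    fun t => ?_, fun t => ?_⟩⟩
  · have := e.orthonormal.1 j
    exact this
  · rw [hlev]
    have := orthonormal_iff_ite.1 e.orthonormal j i
    rw [this]
    by_cases hij : i = j
    · simp [hij]
    · simp [hij, Ne.symm hij]
  · have := hsumT ⟨_, htan t⟩
    simp only [hint] at this
    rw [← this]
    simp
  · have hs := hsumT ⟨_, htan t⟩
    simp only [hint] at hs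
    nth_rewrite 1 [hs]
    rw [hlsum_fst]
    refine Finset.sum_congr rfl fun j _ => ?_
    have h1 := hlev ⟨_, htan t⟩ j
    simp only at h1
    rw [← star_lPart hB, h1, Submodule.coe_inner, hint]
    push_cast
    rw [star_mul', ← Complex.mul_conj']
    simp
    ring

end CauchyFantappie

namespace CauchyFantappie

/-! ### The pointwise bound for the kernel near the diagonal -/

section Near

variable {n : ℕ}

/-- The cubic terms agree because `|x - z|²` is the sum of the `conj (x_j - z_j) (x_j - z_j)`.
Through this identity `Φ` inherits differentiability from the coefficients of `g`. -/
lemma Phi_eq_form10_sub {r : Cn n → ℝ} (K : ℝ) (x z : Cn n) :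
    Phi r K x z = form10 (fun j x => gCoeff r K j x z) x (x - z) - r x := by
  have hn : (‖x - z‖ : ℂ) ^ 2 = ∑ j, star (x j - z j) * (x j - z j) := by
    have h1 := inner_self_eq_norm_sq_to_K (𝕜 := ℂ) (x - z)
    rw [PiLp.inner_apply] at h1
    simp only [RCLike.inner_apply, PiLp.sub_apply, starRingEnd_apply] at h1
    refine h1.symm.trans (Finset.sum_congr rfl fun j _ => mul_comm _ _)
  simp only [Phi, leviPoly, form10, gCoeff, PiLp.sub_apply, add_mul, sub_mul,
    Finset.sum_add_distrib, Finset.sum_sub_distrib]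
  have e1 : ∑ j, (K : ℂ) * ‖x - z‖ * star (x j - z j) * (x j - z j) = K * ‖x - z‖ ^ 3 := by
    rw [pow_succ, hn, Finset.sum_mul, Finset.mul_sum]
    exact Finset.sum_congr rfl fun j _ => by ring
  have e2 : ∑ j, 1 / 2 * (∑ k, ddr r j k x * (x k - z k)) * (x j - z j) =
      1 / 2 * ∑ j, ∑ k, ddr r j k x * (x j - z j) * (x k - z k) := by
    simp only [Finset.mul_sum, Finset.sum_mul]
    exact Finset.sum_congr rfl fun j _ => Finset.sum_congr rfl fun k _ => by ring
  rw [e1, e2]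
  ring

lemma differentiableAt_Phi {r : Cn n → ℝ} {ζ z : Cn n} (h : ContDiffAt ℝ 3 r ζ) (hne : ζ ≠ z)
    (K : ℝ) : DifferentiableAt ℝ (fun x => Phi r K x z) ζ := by
  have hcoord : ∀ j : Fin n, DifferentiableAt ℝ (fun x : Cn n => (x - z) j) ζ := by
    intro j
    have : (fun x : Cn n => (x - z) j) = fun x => (EuclideanSpace.proj j : Cn n →L[ℂ] ℂ) x - z j := by
      funext x; simp
    rw [this]
    exact ((EuclideanSpace.proj j : Cn n →L[ℂ] ℂ).restrictScalars ℝ).differentiableAt.sub_const _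
  simp only [Phi_eq_form10_sub]
  unfold form10
  refine DifferentiableAt.sub (DifferentiableAt.fun_sum fun j _ =>
    (differentiableAt_gCoeff h hne K j).mul (hcoord j)) ?_
  exact (hasFDerivAt_ofReal (h.differentiableAt (by simp))).differentiableAt

/-- Near the diagonal, `Ω₀(W^S)` is `Φ^{-n} g ∧ (∂̄g)^{n-1}` up to a constant. -/
lemma wedgePow_WS {r : Cn n → ℝ} {ζ z : Cn n} (h : ContDiffAt ℝ 3 r ζ) (hne : ζ ≠ z)
    {K ε : ℝ} {χ : ℝ → ℝ} (hχ : IsCutoff ε χ) (hε : ‖ζ - z‖ < ε / 2) (hΦ : Phi r K ζ z ≠ 0)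
    (m : ℕ) (v : Fin (2 * m + 1) → Cn n) :
    wedgePow (form10 (WS r K χ z) ζ) (dbarForm (WS r K χ z) ζ) m v =
      (Phi r K ζ z)⁻¹ ^ (m + 1) * wedgePow (form10 (fun j x => gCoeff r K j x z) ζ)
        (dbarForm (fun j x => gCoeff r K j x z) ζ) m v := by
  refine wedgePow_div (s := fun x => Phi r K x z) (fun j => ?_)
    (differentiableAt_gCoeff h hne K) (differentiableAt_Phi h hne K) hΦ m v
  have : ∀ᶠ x in nhds ζ, ‖x - z‖ < ε / 2 :=
    (continuous_norm.comp (continuous_id.sub continuous_const)).continuousAt.eventually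
      (gt_mem_nhds hε)
  filter_upwards [this] with x hx
  simp [WS, sCoeff, S, hχ.eq_one _ hx.le]

end Near

/-! ### A weighted real frame of the tangent space. -/

section Frame

variable {m : ℕ}

/-- The real frame `eⱼ, i eⱼ, i ν`. -/
def realFrame {n : ℕ} (ν : Cn n) (e : Fin m → Cn n) : Option (Fin m × Bool) → Cn n
  | none => Complex.I • ν
  | some (j, false) => e j
  | some (j, true) => Complex.I • e j

/-- The coefficients with respect to the real frame. -/
def realCoeff {n : ℕ} (ν : Cn n) (e : Fin m → Cn n) (v : Cn n) : Option (Fin m × Bool) → ℝ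
  | none => (inner ℂ ν v).im
  | some (j, false) => (inner ℂ (e j) v).re
  | some (j, true) => (inner ℂ (e j) v).im

/-- The weights of the real frame. -/
def frameWeight (l : Fin m → ℝ) (d : ℝ) : Option (Fin m × Bool) → ℝ
  | none => (Real.sqrt d)⁻¹
  | some (j, _) => Real.sqrt (l j + d)

/-- Each eigenvalue belongs to two real directions, so the square roots pair up. The single
direction `iν` leaves `1/√d`, which later cancels the `√d` in the bound for `g`. -/
lemma prod_frameWeight {l : Fin m → ℝ} {d : ℝ} (hl : ∀ j, 0 ≤ l j) (hd : 0 < d) :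
    ∏ a, frameWeight l d a = (Real.sqrt d)⁻¹ * ∏ j, (l j + d) := by
  rw [Fintype.prod_option, Fintype.prod_prod_type]
  simp only [frameWeight, Fintype.prod_bool]
  congr 1
  refine Finset.prod_congr rfl fun j _ => Real.mul_self_sqrt ?_
  linarith [hl j]

lemma sum_realCoeff {n : ℕ} {B : Cn n →L[ℝ] Cn n →L[ℝ] ℝ} {ν : Cn n} {e : Fin m → Cn n}
    {l : Fin m → ℝ} (hf : IsLeviFrame B ν e l) (v : Cn n) :
    ∑ a, realCoeff ν e v a • realFrame ν e a = v - (inner ℂ ν v).re • ν := by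
  rw [Fintype.sum_option, Fintype.sum_prod_type]
  simp only [realCoeff, realFrame, Fintype.sum_bool]
  have h := hf.sum_eq v
  rw [complex_smul_eq (inner ℂ ν v)] at h
  have h2 : ∀ j, (inner ℂ (e j) v).im • Complex.I • e j + (inner ℂ (e j) v).re • e j =
      inner ℂ (e j) v • e j := fun j => by rw [complex_smul_eq (inner ℂ (e j) v), add_comm]
  simp only [h2]
  rw [eq_sub_iff_add_eq]
  conv_rhs => rw [← h]
  abel

lemma abs_realCoeff_le {n : ℕ} {B : Cn n →L[ℝ] Cn n →L[ℝ] ℝ} {ν : Cn n} {e : Fin m → Cn n}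
    {l : Fin m → ℝ} (hf : IsLeviFrame B ν e l) (hν : ‖ν‖ = 1) {v : Cn n} (hv : ‖v‖ = 1)
    (a : Option (Fin m × Bool)) : |realCoeff ν e v a| ≤ 1 := by
  have h1 : ‖inner ℂ ν v‖ ≤ 1 := by simpa [hν, hv] using norm_inner_le_norm (𝕜 := ℂ) ν v
  have h2 : ∀ j, ‖inner ℂ (e j) v‖ ≤ 1 := fun j => by
    simpa [hf.norm_eq, hv] using norm_inner_le_norm (𝕜 := ℂ) (e j) v
  rcases a with _ | ⟨j, _ | _⟩
  · exact (Complex.abs_im_le_norm _).trans h1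
  · exact (Complex.abs_re_le_norm _).trans (h2 j)
  · exact (Complex.abs_im_le_norm _).trans (h2 j)

lemma norm_realFrame {n : ℕ} {B : Cn n →L[ℝ] Cn n →L[ℝ] ℝ} {ν : Cn n} {e : Fin m → Cn n}
    {l : Fin m → ℝ} (hf : IsLeviFrame B ν e l) (hν : ‖ν‖ = 1) (a : Option (Fin m × Bool)) :
    ‖realFrame ν e a‖ = 1 := by
  rcases a with _ | ⟨j, _ | _⟩ <;> simp [realFrame, norm_smul, hν, hf.norm_eq]

lemma norm_lPart_realFrame_le {n : ℕ} {B : Cn n →L[ℝ] Cn n →L[ℝ] ℝ} (hB : ∀ t s, B t s = B s t)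
    {ν : Cn n} {e : Fin m → Cn n} {l : Fin m → ℝ} (hf : IsLeviFrame B ν e l) (hl : ∀ j, 0 ≤ l j)
    (i j : Fin m) (p q : Bool) :
    ‖lPart B (realFrame ν e (some (i, p))) (realFrame ν e (some (j, q)))‖ ≤
      if i = j then l j else 0 := by
  have h : ‖lPart B (e i) (e j)‖ ≤ if i = j then l j else 0 := by
    rw [hf.lPart_eq]
    split_ifs
    · rw [Complex.norm_real, Real.norm_of_nonneg (hl j)]
    · simp
  cases p <;> cases q <;>
    simpa [realFrame, lPart_smul_fst, lPart_smul_snd hB] using h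

/-- The weights dominate the eigenvalues. -/
lemma le_frameWeight_mul {l : Fin m → ℝ} {d : ℝ} (hl : ∀ j, 0 ≤ l j) (hd : 0 < d)
    (a b : Option (Fin m × Bool)) (hab : a ≠ b) {x C : ℝ} (hC : 0 ≤ C)
    (hnone : (a = none ∨ b = none) → x ≤ C)
    (hsome : ∀ i j p q, a = some (i, p) → b = some (j, q) → x ≤ C * ((if i = j then l j else 0) + d)) :
    x ≤ C * (frameWeight l d a * frameWeight l d b) := by
  have hsd : 0 < Real.sqrt d := Real.sqrt_pos.2 hd
  have hle : ∀ j, Real.sqrt d ≤ Real.sqrt (l j + d) := fun j =>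
    Real.sqrt_le_sqrt (by linarith [hl j])
  have hone : ∀ j, 1 ≤ (Real.sqrt d)⁻¹ * Real.sqrt (l j + d) := fun j => by
    rw [inv_mul_eq_div, le_div_iff₀ hsd, one_mul]
    exact hle j
  rcases a with _ | ⟨i, p⟩ <;> rcases b with _ | ⟨j, q⟩
  · exact absurd rfl hab
  · exact (hnone (Or.inl rfl)).trans (le_mul_of_one_le_right hC (hone j))
  · refine (hnone (Or.inr rfl)).trans (le_mul_of_one_le_right hC ?_)
    rw [mul_comm]
    exact hone i
  · refine (hsome i j p q rfl rfl).trans (mul_le_mul_of_nonneg_left ?_ hC)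
    simp only [frameWeight]
    split_ifs with hij
    · rw [hij, Real.mul_self_sqrt (by linarith [hl j])]
    · rw [zero_add]
      calc d = Real.sqrt d * Real.sqrt d := (Real.mul_self_sqrt hd.le).symm
        _ ≤ _ := mul_le_mul (hle i) (hle j) hsd.le (Real.sqrt_nonneg _)

end Frame

namespace LeviDefining

variable {m : ℕ} {D : Set (Cn (m + 1))} {r : Cn (m + 1) → ℝ} {ρ M c : ℝ}

/-- `dr = 2 Re ∂r`, where `∂r` vanishes on the `e_j` and is real on `ν`, hence purely imaginary on
`iν`. -/
lemma fderiv_realFrame {y ν : Cn (m + 1)} (hν : IsUnitNormal r y ν)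
    {B : Cn (m + 1) →L[ℝ] Cn (m + 1) →L[ℝ] ℝ} {e : Fin m → Cn (m + 1)} {l : Fin m → ℝ}
    (hf : IsLeviFrame B ν e l) (a : Option (Fin m × Bool)) :
    fderiv ℝ r y (realFrame ν e a) = 0 := by
  have hre : ∀ t, fderiv ℝ r y t = 2 * (dPart (fderiv ℝ r y) t).re := fun t => by
    rw [dPart_re]; ring
  rcases a with _ | ⟨j, _ | _⟩
  · rw [hre, realFrame, dPart_I_smul, hν.dPart_self]
    simp
  · rw [hre, realFrame, hν.dPart_eq, hf.inner_normal]
    simp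
  · rw [hre, realFrame, dPart_I_smul, hν.dPart_eq, hf.inner_normal]
    simp

/-- The numerator `g ∧ (∂̄g)^{n-1}` on tangential orthonormal frames is bounded by the product of
the shifted eigenvalues of the Levi form at a nearby boundary point. -/
lemma exists_norm_wedgePow_gCoeff_le (h : LeviDefining D r ρ M c) {K : ℝ} (hK : 0 ≤ K) :
    ∃ A ≥ 0, ∀ {y ν : Cn (m + 1)} {e : Fin m → Cn (m + 1)} {l : Fin m → ℝ} {ζ z : Cn (m + 1)},
      y ∈ frontier D → IsUnitNormal r y ν →
      IsLeviFrame (fderiv ℝ (fderiv ℝ r) y) ν e l → (∀ j, 0 ≤ l j) → ζ ∈ frontier D →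
      ζ ≠ z → ‖ζ - y‖ ≤ 2 * ‖ζ - z‖ → 2 * ‖ζ - z‖ < ρ → ‖ζ - z‖ ≤ 1 → M * (2 * ‖ζ - z‖) ≤ c / 2 →
      ∀ v : Fin (2 * m + 1) → Cn (m + 1), (∀ i, ‖v i‖ = 1) → (∀ i, fderiv ℝ r ζ (v i) = 0) →
      ‖wedgePow (form10 (fun j x => gCoeff r K j x z) ζ)
        (dbarForm (fun j x => gCoeff r K j x z) ζ) m v‖ ≤ A * ∏ j, (l j + ‖ζ - z‖) := by
  have hM := h.M_pos
  have hc := h.pos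
  -- `κ d` bounds the correction making a frame vector tangent at `ζ`, and `R` the corrected
  -- vectors. `A₁ d` bounds `g` in the directions from the `e_j`, `A₂` in the direction from `iν`.
  -- `A₃ d` bounds the change of the Levi form, and `A₄` is the constant for `∂̄g`.
  set κ := 4 * M / c with hκ
  have hκ0 : 0 ≤ κ := by positivity
  set R := 1 + κ with hR
  set A₁ := 2 * M + κ * M + (M + K) * R with hA₁
  set A₂ := M * R + (M + K) * R with hA₂
  set A₃ := 2 * M * R * R + M * κ * R + M * κ with hA₃
  set A₄ := 2 + 2 * A₃ + 2 * ((M + 2 * K) * R * R) + 2 * (M * R * R) with hA₄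
  refine ⟨(2 * m + 1 : ℕ) ^ (2 * m + 1) * ((2 * m + 1).factorial * ((A₁ + A₂) * A₄ ^ m)),
    by positivity, ?_⟩
  intro y ν e l ζ z hy hν hf hl hζ hne hζy hρ hd1 hMd v hv hvt
  set d := ‖ζ - z‖ with hd
  have hd0 : 0 < d := norm_pos_iff.2 (sub_ne_zero.2 hne)
  have hsd : 0 < Real.sqrt d := Real.sqrt_pos.2 hd0
  have hζρ := h.mem_ball_self ζ
  have hyρ : y ∈ Metric.ball ζ ρ := by
    rw [Metric.mem_ball, dist_comm, dist_eq_norm]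
    linarith
  have cζ := h.contDiffAt hζ
  have cζ2 := h.contDiffAt_two hζ
  set L := fderiv ℝ r ζ with hL
  set L' := fderiv ℝ r y with hL'
  set B := fderiv ℝ (fderiv ℝ r) ζ with hB
  set B' := fderiv ℝ (fderiv ℝ r) y with hB'
  have hLL : ‖L - L'‖ ≤ 2 * M * d := by
    refine (h.bounds.fderiv_sub_le ζ hζ ζ hζρ y hyρ).trans ?_
    nlinarith
  have hBB : ‖B - B'‖ ≤ 2 * M * d := by
    refine (h.bounds.hessian_sub_le ζ hζ ζ hζρ y hyρ).trans ?_
    nlinarith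
  have hLM : ‖L‖ ≤ M := h.bounds.norm_fderiv_le ζ hζ ζ hζρ
  have hBM : ‖B‖ ≤ M := h.bounds.norm_hessian_le ζ hζ ζ hζρ
  have hB'M : ‖B'‖ ≤ M := h.bounds.norm_hessian_le ζ hζ y hyρ
  -- The gradient changes by at most `c / 2` between `y` and `ζ`, so `ν` remains transversal to `bD`
  -- at `ζ`.
  have hLν : c / 2 ≤ L ν := by
    have h1 := (h.le_norm_fderiv y hy).trans hν.norm_le
    have h2 := (L - L').le_opNorm ν
    rw [hν.norm_eq, mul_one, sub_apply] at h2
    have h3 := (abs_le.1 (h2.trans hLL)).1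
    linarith
  have hLν0 : 0 < L ν := by linarith
  set x := realFrame ν e with hx
  have hxn : ∀ a, ‖x a‖ = 1 := norm_realFrame hf hν.norm_eq
  have hLx : ∀ a, |L (x a)| ≤ 2 * M * d := by
    intro a
    have h1 : L (x a) = (L - L') (x a) := by
      rw [sub_apply, hL', hx, fderiv_realFrame hν hf a, sub_zero]
    rw [h1]
    refine ((L - L').le_opNorm (x a)).trans ?_
    rw [hxn, mul_one]
    exact hLL
  -- The frame is tangent to `bD` at `y`, whereas the test vectors are tangent at `ζ`. Subtracting
  -- `k a • ν` restores tangency, and `k` is `O(d)` because the gradients at the two points differ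
  -- by `O(d)`.
  set k : Option (Fin m × Bool) → ℝ := fun a => L (x a) / L ν with hk
  have hkb : ∀ a, |k a| ≤ κ * d := by
    intro a
    rw [hk, abs_div, abs_of_pos hLν0, div_le_iff₀ hLν0]
    refine (hLx a).trans ?_
    calc 2 * M * d = κ * d * (c / 2) := by rw [hκ]; field_simp; ring
      _ ≤ κ * d * L ν := by gcongr
  have hkκ : ∀ a, |k a| ≤ κ := fun a => (hkb a).trans (mul_le_of_le_one_right hκ0 hd1)
  set u : Option (Fin m × Bool) → Cn (m + 1) := fun a => x a - k a • ν with hu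
  have hux : ∀ a, ‖x a - u a‖ ≤ κ * d := by
    intro a
    rw [hu, sub_sub_cancel, norm_smul, hν.norm_eq, mul_one]
    exact hkb a
  have hun : ∀ a, ‖u a‖ ≤ R := by
    intro a
    refine (norm_sub_le _ _).trans ?_
    rw [hxn, norm_smul, hν.norm_eq, mul_one]
    exact add_le_add le_rfl (hkκ a)
  have hLu : ∀ a, L (u a) = 0 := by
    intro a
    rw [hu, map_sub, map_smul, smul_eq_mul, hk, div_mul_cancel₀ _ hLν0.ne', sub_self]
  -- expansion of the tangential vectors
  have hvsum : ∀ i, v i = ∑ a, realCoeff ν e (v i) a • u a := by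
    intro i
    set t := (inner ℂ ν (v i)).re + ∑ a, realCoeff ν e (v i) a * k a with ht
    have h1 : ∑ a, realCoeff ν e (v i) a • u a = v i - t • ν := by
      simp only [hu, smul_sub, Finset.sum_sub_distrib, smul_smul]
      rw [hx, sum_realCoeff hf, ← Finset.sum_smul, ht, add_smul]
      abel
    have h2 : L (∑ a, realCoeff ν e (v i) a • u a) = 0 := by
      rw [map_sum]
      exact Finset.sum_eq_zero fun a _ => by rw [map_smul, hLu, smul_zero]
    rw [h1, map_sub, hvt, map_smul, smul_eq_mul, zero_sub, neg_eq_zero, mul_eq_zero] at h2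
    rw [h1, h2.resolve_right hLν0.ne', zero_smul, sub_zero]
  -- the bound for `g`
  have hα : ∀ a, ‖form10Lin (fun j x => gCoeff r K j x z) ζ (u a)‖ ≤
      ((A₁ + A₂) * Real.sqrt d) * frameWeight l d a := by
    intro a
    have h1 := norm_form10_gCoeff_le cζ2 K hd1 (u a)
    rw [abs_of_nonneg hK] at h1
    have h2 : (‖B‖ + K) * d * ‖u a‖ ≤ (M + K) * R * d := by
      calc (‖B‖ + K) * d * ‖u a‖ ≤ (M + K) * d * R := by gcongr; exact hun a
        _ = _ := by ring
    have hA₁0 : 0 ≤ A₁ := by positivity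
    have hA₂0 : 0 ≤ A₂ := by positivity
    -- In the direction of `iν` the form `g` is merely bounded, which matches `√d · (1/√d)`. In the
    -- other directions it is `O(d)`, which matches `√d √(l_j + d) ≥ d`.
    rcases a with _ | ⟨j, p⟩
    · have h3 : ‖dPart L (u none)‖ ≤ M * R :=
        (norm_dPart_le _ _).trans (mul_le_mul hLM (hun _) (norm_nonneg _) hM.le)
      have h4 : (A₁ + A₂) * Real.sqrt d * frameWeight l d none = A₁ + A₂ := by
        simp only [frameWeight]
        field_simp
      rw [h4]
      have h5 : (M + K) * R * d ≤ (M + K) * R := mul_le_of_le_one_right (by positivity) hd1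
      refine h1.trans ?_
      linarith
    · have hxy : dPart L' (x (some (j, p))) = 0 := by
        cases p <;> simp [hx, realFrame, hL', hν.dPart_eq, hf.inner_normal]
      have h3 : ‖dPart L (x (some (j, p)))‖ ≤ 2 * M * d := by
        have h4 : dPart L (x (some (j, p))) = dPart (L - L') (x (some (j, p))) := by
          rw [dPart_sub_left, hxy, sub_zero]
        rw [h4]
        refine (norm_dPart_le _ _).trans ?_
        rw [hxn, mul_one]
        exact hLL
      have h5 : ‖dPart L (k (some (j, p)) • ν)‖ ≤ κ * M * d := by
        refine (norm_dPart_le _ _).trans ?_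
        rw [norm_smul, hν.norm_eq, mul_one, Real.norm_eq_abs]
        calc ‖L‖ * |k (some (j, p))| ≤ M * (κ * d) := by gcongr; exact hkb _
          _ = _ := by ring
      have h6 : ‖dPart L (u (some (j, p)))‖ ≤ 2 * M * d + κ * M * d := by
        rw [hu, dPart_sub]
        exact (norm_sub_le _ _).trans (add_le_add h3 h5)
      have h7 : d ≤ Real.sqrt d * frameWeight l d (some (j, p)) := by
        simp only [frameWeight]
        calc d = Real.sqrt d * Real.sqrt d := (Real.mul_self_sqrt hd0.le).symm
          _ ≤ _ := mul_le_mul_of_nonneg_left (Real.sqrt_le_sqrt (by linarith [hl j])) hsd.le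
      calc ‖form10Lin (fun j x => gCoeff r K j x z) ζ (u (some (j, p)))‖
          ≤ ‖dPart L (u (some (j, p)))‖ + (‖B‖ + K) * d * ‖u (some (j, p))‖ := h1
        _ ≤ A₁ * d := by rw [hA₁]; linarith
        _ ≤ (A₁ + A₂) * (Real.sqrt d * frameWeight l d (some (j, p))) :=
            mul_le_mul (by linarith) h7 hd0.le (by positivity)
        _ = _ := by ring
  -- the bound for `∂̄g`
  have hlp : ∀ a b, ‖lPart B (u a) (u b)‖ ≤ ‖lPart B' (x a) (x b)‖ + A₃ * d := by
    intro a b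
    have e1 : lPart B (u a) (u b) = lPart B' (x a) (x b) + lPart (B - B') (u a) (u b) -
        lPart B' (x a - u a) (u b) - lPart B' (x a) (x b - u b) := by
      have s1 : x a = u a + (x a - u a) := by abel
      have s2 : x b = u b + (x b - u b) := by abel
      have t1 : lPart B' (x a) (x b) = lPart B' (x a) (u b) + lPart B' (x a) (x b - u b) := by
        rw [← lPart_add_snd, ← s2]
      have t2 : lPart B' (x a) (u b) = lPart B' (u a) (u b) + lPart B' (x a - u a) (u b) := by
        rw [← lPart_add_fst, ← s1]
      rw [lPart_sub_left, t1, t2]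
      ring
    have b1 : ‖lPart (B - B') (u a) (u b)‖ ≤ 2 * M * d * R * R :=
      (norm_lPart_le _ _ _).trans (by gcongr <;> exact hun _)
    have b2 : ‖lPart B' (x a - u a) (u b)‖ ≤ M * (κ * d) * R :=
      (norm_lPart_le _ _ _).trans (by gcongr; exacts [hux a, hun b])
    have b3 : ‖lPart B' (x a) (x b - u b)‖ ≤ M * 1 * (κ * d) :=
      (norm_lPart_le _ _ _).trans (by gcongr; exacts [(hxn a).le, hux b])
    rw [e1]
    have n1 := norm_sub_le (lPart B' (x a) (x b) + lPart (B - B') (u a) (u b) -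
        lPart B' (x a - u a) (u b)) (lPart B' (x a) (x b - u b))
    have n2 := norm_sub_le (lPart B' (x a) (x b) + lPart (B - B') (u a) (u b))
      (lPart B' (x a - u a) (u b))
    have n3 := norm_add_le (lPart B' (x a) (x b)) (lPart (B - B') (u a) (u b))
    have n4 : A₃ * d = 2 * M * d * R * R + M * (κ * d) * R + M * 1 * (κ * d) := by
      rw [hA₃]; ring
    linarith
  have hβ : ∀ a b, a ≠ b → ‖dbarFormLin (fun j x => gCoeff r K j x z) ζ (u a) (u b)‖ ≤
      A₄ * (frameWeight l d a * frameWeight l d b) := by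
    intro a b hab
    have h1 := norm_dbarForm_gCoeff_le cζ hne (h.bounds.norm_fderiv3_le ζ hζ ζ hζρ) K (u a) (u b)
    rw [abs_of_nonneg hK] at h1
    have h2 : (M + 2 * K) * d * ‖u a‖ * ‖u b‖ ≤ (M + 2 * K) * R * R * d := by
      calc (M + 2 * K) * d * ‖u a‖ * ‖u b‖ ≤ (M + 2 * K) * d * R * R := by
            gcongr <;> exact hun _
        _ = _ := by ring
    have hA₃0 : 0 ≤ A₃ := by positivity
    have hR0 : 0 ≤ R := by positivity
    have hMR : 0 ≤ (M + 2 * K) * R * R := by positivity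
    have hMRR : 0 ≤ M * R * R := by positivity
    -- If `iν` is one of the two directions, boundedness suffices since the product of weights is at
    -- least 1. Otherwise the eigenframe gives the eigenvalue (zero for distinct indices) plus
    -- `O(d)`.
    refine h1.trans (le_frameWeight_mul hl hd0 a b hab (by positivity) (fun _ => ?_) ?_)
    · have h3 : ‖lPart B (u a) (u b)‖ ≤ M * R * R :=
        (norm_lPart_le _ _ _).trans (by gcongr <;> exact hun _)
      have h5 : (M + 2 * K) * R * R * d ≤ (M + 2 * K) * R * R := mul_le_of_le_one_right hMR hd1
      rw [hA₄]
      linarith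
    · rintro i j p q rfl rfl
      have h3 := hlp (some (i, p)) (some (j, q))
      have h4 := norm_lPart_realFrame_le (hessian_symm (h.contDiffAt_two hy)) hf hl i j p q
      rw [← hx] at h4
      have h5 : 0 ≤ if i = j then l j else 0 := by split_ifs <;> simp [hl]
      set q' := if i = j then l j else 0
      have h6 : A₄ * (q' + d) = 2 * q' + (2 * A₃ * d + 2 * ((M + 2 * K) * R * R * d)) +
        ((2 * A₃ + 2 * ((M + 2 * K) * R * R)) * q' + 2 * (M * R * R) * q' + 2 * d +
          2 * (M * R * R) * d) := by rw [hA₄]; ring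
      have h7 : 0 ≤ (2 * A₃ + 2 * ((M + 2 * K) * R * R)) * q' + 2 * (M * R * R) * q' + 2 * d +
          2 * (M * R * R) * d := by positivity
      rw [h6]
      linarith
  have hA₁0 : 0 ≤ A₁ := by positivity
  have hA₂0 : 0 ≤ A₂ := by positivity
  have hA₄0 : 0 ≤ A₄ := by positivity
  have hcard : Fintype.card (Option (Fin m × Bool)) = 2 * m + 1 := by
    simp [mul_comm]
  have hτ : ∀ a, 0 ≤ frameWeight l d a := by
    rintro (_ | ⟨j, p⟩) <;> simp [frameWeight]
  have hfin := norm_wedgePow_sum_le hcard (form10Lin (fun j x => gCoeff r K j x z) ζ)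
    (dbarFormLin (fun j x => gCoeff r K j x z) ζ) hτ (by positivity) hA₄0 hα hβ
    (c := fun i a => realCoeff ν e (v i) a)
    (fun i a => abs_realCoeff_le hf hν.norm_eq (hv i) a)
  simp only [← hvsum] at hfin
  refine hfin.trans (le_of_eq ?_)
  rw [prod_frameWeight hl hd0]
  field_simp

end LeviDefining

end CauchyFantappie

namespace CauchyFantappie

/-! ### Coordinates on the boundary -/

/-- The coordinates `(⟪eⱼ, ζ - z⟫, Im Φ(ζ, z))`. -/
def bdryCoord {m n : ℕ} (r : Cn n → ℝ) (K : ℝ) (e : Fin m → Cn n) (z ζ : Cn n) :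
    Option (Fin m × Bool) → ℝ
  | none => (Phi r K ζ z).im
  | some (j, false) => (inner ℂ (e j) (ζ - z)).re
  | some (j, true) => (inner ℂ (e j) (ζ - z)).im

/-- `r ζ` and the cubic term are real, so the last boundary coordinate does not involve `K`. -/
lemma Phi_im {n : ℕ} {r : Cn n → ℝ} {ζ : Cn n} (h : ContDiffAt ℝ 2 r ζ) (K : ℝ) (z : Cn n) :
    (Phi r K ζ z).im = (dPart (fderiv ℝ r ζ) (ζ - z) -
      (1 / 2) * qPart (fderiv ℝ (fderiv ℝ r) ζ) (ζ - z) (ζ - z)).im := by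
  have : ((r ζ : ℂ) - (K : ℂ) * (‖ζ - z‖ : ℂ) ^ 3) = ((r ζ - K * ‖ζ - z‖ ^ 3 : ℝ) : ℂ) := by
    push_cast; ring
  rw [Phi, leviPoly_eq h, sub_add, this, Complex.sub_im, Complex.ofReal_im, sub_zero]

namespace LeviDefining

variable {m : ℕ} {D : Set (Cn (m + 1))} {r : Cn (m + 1) → ℝ} {ρ M c : ℝ}

lemma abs_bdryCoord_le (h : LeviDefining D r ρ M c) {ν : Cn (m + 1)}
    {B : Cn (m + 1) →L[ℝ] Cn (m + 1) →L[ℝ] ℝ}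
    {e : Fin m → Cn (m + 1)} {l : Fin m → ℝ} (hf : IsLeviFrame B ν e l)
    {ζ z : Cn (m + 1)} (hζ : ζ ∈ frontier D) (hd1 : ‖ζ - z‖ ≤ 1) (K : ℝ)
    (a : Option (Fin m × Bool)) : |bdryCoord r K e z ζ a| ≤ 2 * M := by
  have hM := h.bounds.one_le
  have hζρ := h.mem_ball_self ζ
  have h2 : ∀ j, ‖inner ℂ (e j) (ζ - z)‖ ≤ 2 * M := fun j => by
    refine (norm_inner_le_norm (𝕜 := ℂ) (e j) (ζ - z)).trans ?_
    rw [hf.norm_eq]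
    linarith
  rcases a with _ | ⟨j, _ | _⟩
  · simp only [bdryCoord]
    rw [Phi_im (h.contDiffAt_two hζ)]
    refine (Complex.abs_im_le_norm _).trans ?_
    have h3 : ‖dPart (fderiv ℝ r ζ) (ζ - z)‖ ≤ M * 1 := (norm_dPart_le _ _).trans
      (mul_le_mul (h.bounds.norm_fderiv_le ζ hζ ζ hζρ) hd1 (norm_nonneg _) (by linarith))
    have h4 : ‖qPart (fderiv ℝ (fderiv ℝ r) ζ) (ζ - z) (ζ - z)‖ ≤ M * 1 * 1 := by
      refine (norm_qPart_le _ _ _).trans ?_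
      have := h.bounds.norm_hessian_le ζ hζ ζ hζρ
      gcongr
    have h5 : ‖(1 / 2 : ℂ) * qPart (fderiv ℝ (fderiv ℝ r) ζ) (ζ - z) (ζ - z)‖ ≤ M := by
      rw [norm_mul]
      have : ‖(1 / 2 : ℂ)‖ = 1 / 2 := by norm_num
      rw [this]
      linarith
    have := norm_sub_le (dPart (fderiv ℝ r ζ) (ζ - z))
      ((1 / 2) * qPart (fderiv ℝ (fderiv ℝ r) ζ) (ζ - z) (ζ - z))
    linarith
  · exact (Complex.abs_re_le_norm _).trans (h2 j)
  · exact (Complex.abs_im_le_norm _).trans (h2 j)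

/-- The coordinates are bi-Lipschitz on the boundary near `z`. -/
lemma norm_sub_le_bdryCoord (h : LeviDefining D r ρ M c) {y ν : Cn (m + 1)}
    {e : Fin m → Cn (m + 1)} {l : Fin m → ℝ} (hy : y ∈ frontier D) (hν : IsUnitNormal r y ν)
    (hf : IsLeviFrame (fderiv ℝ (fderiv ℝ r) y) ν e l) {δ : ℝ} (hδ1 : δ ≤ 1) (hδρ : 2 * δ < ρ)
    (hδ : 36 * M * δ ≤ c) (K : ℝ) {z ζ ζ' : Cn (m + 1)} (hζ : ζ ∈ frontier D)
    (hζ' : ζ' ∈ frontier D) (hw : ‖ζ - z‖ ≤ δ) (hw' : ‖ζ' - z‖ ≤ δ) (hζy : ‖ζ - y‖ ≤ 2 * δ)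
    (hζ'y : ‖ζ' - y‖ ≤ 2 * δ) :
    ‖ζ - ζ'‖ ≤ (4 * m + 4 / c) * ‖bdryCoord r K e z ζ - bdryCoord r K e z ζ'‖ := by
  have hM := h.M_pos
  have hc := h.pos
  have hδ0 : 0 ≤ δ := (norm_nonneg _).trans hw
  set P := ‖bdryCoord r K e z ζ - bdryCoord r K e z ζ'‖ with hP
  set η := ζ - ζ' with hη
  have hP0 : 0 ≤ P := norm_nonneg _
  have hcomp : ∀ a, |bdryCoord r K e z ζ a - bdryCoord r K e z ζ' a| ≤ P := fun a =>
    norm_le_pi_norm (bdryCoord r K e z ζ - bdryCoord r K e z ζ') a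
  have hηδ : ‖η‖ ≤ 2 * δ := by
    have : η = (ζ - z) - (ζ' - z) := by rw [hη]; abel
    rw [this]
    have := norm_sub_le (ζ - z) (ζ' - z)
    linarith
  have hζρ : ζ ∈ Metric.ball y ρ := by
    rw [Metric.mem_ball, dist_eq_norm]; linarith
  have hζ'ρ : ζ' ∈ Metric.ball y ρ := by
    rw [Metric.mem_ball, dist_eq_norm]; linarith
  have hyρ := h.mem_ball_self y
  have cζ := h.contDiffAt_two hζ
  have cζ' := h.contDiffAt_two hζ'
  -- tangential components
  have htan : ∀ j, ‖inner ℂ (e j) η‖ ≤ 2 * P := by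
    intro j
    have e1 : inner ℂ (e j) η = inner ℂ (e j) (ζ - z) - inner ℂ (e j) (ζ' - z) := by
      rw [← inner_sub_right]
      congr 1
      rw [hη]; abel
    have h1 := hcomp (some (j, false))
    have h2 := hcomp (some (j, true))
    simp only [bdryCoord] at h1 h2
    rw [← Complex.sub_re, ← e1] at h1
    rw [← Complex.sub_im, ← e1] at h2
    have := Complex.norm_le_abs_re_add_abs_im (inner ℂ (e j) η)
    linarith
  set L := fderiv ℝ r ζ with hL
  set L' := fderiv ℝ r ζ' with hL'
  set B := fderiv ℝ (fderiv ℝ r) ζ with hB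
  set B' := fderiv ℝ (fderiv ℝ r) ζ' with hB'
  set Ly := fderiv ℝ r y with hLy
  have hLLy : ‖L - Ly‖ ≤ M * (2 * δ) :=
    (h.bounds.fderiv_sub_le y hy ζ hζρ y hyρ).trans (by gcongr)
  have hLL' : ‖L - L'‖ ≤ M * ‖η‖ := h.bounds.fderiv_sub_le y hy ζ hζρ ζ' hζ'ρ
  have hBB' : ‖B - B'‖ ≤ M * ‖η‖ := h.bounds.hessian_sub_le y hy ζ hζρ ζ' hζ'ρ
  have hBM : ‖B‖ ≤ M := h.bounds.norm_hessian_le y hy ζ hζρ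
  have hB'M : ‖B'‖ ≤ M := h.bounds.norm_hessian_le y hy ζ' hζ'ρ
  -- real part of the normal component
  have hre : |(dPart Ly η).re| ≤ 4 * M * δ * ‖η‖ := by
    -- The real normal direction needs no coordinate: with `r ζ = r ζ' = 0`, Taylor's formula makes
    -- this component a small multiple of `‖η‖`.
    have ht := h.bounds.taylor hy hζρ hζ'ρ
    have e1 : ζ' - ζ = -η := by rw [hη]; abel
    rw [e1, h.eq_zero ζ hζ, h.eq_zero ζ' hζ', map_neg, map_neg, map_neg, neg_apply, norm_neg] at ht
    have hb : |B η η| ≤ M * ‖η‖ * ‖η‖ := (B.le_opNorm₂ η η).trans (by gcongr)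
    have hb2 : M * ‖η‖ * ‖η‖ ≤ M * ‖η‖ * (2 * δ) := by gcongr
    have h3 : M * ‖η‖ ^ 3 ≤ M * ‖η‖ * (4 * δ) := by
      have : ‖η‖ ^ 2 ≤ 4 * δ := by nlinarith [norm_nonneg η]
      calc M * ‖η‖ ^ 3 = M * ‖η‖ * ‖η‖ ^ 2 := by ring
        _ ≤ _ := by gcongr
    have h4 : |(L - Ly) η| ≤ M * (2 * δ) * ‖η‖ :=
      ((L - Ly).le_opNorm η).trans (by gcongr)
    rw [sub_apply] at h4
    rw [dPart_re]
    have t1 := abs_le.1 ht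
    have t2 := abs_le.1 hb
    have t3 := abs_le.1 h4
    have hnn : 0 ≤ M * δ * ‖η‖ := by positivity
    rw [abs_le]
    constructor <;> linarith [t1.1, t1.2, t2.1, t2.2, t3.1, t3.2]
  -- imaginary part of the normal component
  have him : |(dPart Ly η).im| ≤ P + 5 * M * δ * ‖η‖ := by
    have h1 := hcomp none
    simp only [bdryCoord] at h1
    rw [Phi_im cζ, Phi_im cζ', ← Complex.sub_im] at h1
    set w := ζ - z with hwd
    set w' := ζ' - z with hwd'
    have hww : w = w' + η := by rw [hwd, hwd', hη]; abel
    have hww' : η = w - w' := by rw [hww]; abel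
    set X := dPart L w - 1 / 2 * qPart B w w - (dPart L' w' - 1 / 2 * qPart B' w' w') with hX
    -- Each error term is bounded by `M δ ‖η‖` or twice that, so `Im Φ` separates points in the
    -- direction `iν` up to a small multiple of `‖η‖`.
    have hXe : dPart Ly η = X - (dPart (L - Ly) η + dPart (L - L') w' -
        1 / 2 * (qPart (B - B') w w + qPart B' η w + qPart B' w' η)) := by
      have a1 : dPart L w = dPart L w' + dPart L η := by rw [hww, dPart_add]
      have a2 : qPart B' η w = qPart B' w w - qPart B' w' w := by
        rw [← qPart_sub_fst, ← hww']
      have a3 : qPart B' w' η = qPart B' w' w - qPart B' w' w' := by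
        rw [← qPart_sub, ← hww']
      rw [hX, dPart_sub_left, dPart_sub_left, qPart_sub_left, a1, a2, a3]
      ring
    have n1 : ‖dPart (L - Ly) η‖ ≤ M * (2 * δ) * ‖η‖ := (norm_dPart_le _ _).trans (by gcongr)
    have n2 : ‖dPart (L - L') w'‖ ≤ M * ‖η‖ * δ := (norm_dPart_le _ _).trans (by gcongr)
    have n3 : ‖qPart (B - B') w w‖ ≤ M * ‖η‖ * δ * 1 :=
      (norm_qPart_le _ _ _).trans (by gcongr; exact hw.trans hδ1)
    have n4 : ‖qPart B' η w‖ ≤ M * ‖η‖ * δ := (norm_qPart_le _ _ _).trans (by gcongr)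
    have n5 : ‖qPart B' w' η‖ ≤ M * δ * ‖η‖ := (norm_qPart_le _ _ _).trans (by gcongr)
    have n6 : ‖dPart (L - Ly) η + dPart (L - L') w' -
        1 / 2 * (qPart (B - B') w w + qPart B' η w + qPart B' w' η)‖ ≤ 5 * M * δ * ‖η‖ := by
      have half : ‖(1 / 2 : ℂ)‖ = 1 / 2 := by norm_num
      have s1 := norm_sub_le (dPart (L - Ly) η + dPart (L - L') w')
        (1 / 2 * (qPart (B - B') w w + qPart B' η w + qPart B' w' η))
      have s2 := norm_add_le (dPart (L - Ly) η) (dPart (L - L') w')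
      have s3 := norm_add_le (qPart (B - B') w w + qPart B' η w) (qPart B' w' η)
      have s4 := norm_add_le (qPart (B - B') w w) (qPart B' η w)
      rw [norm_mul, half] at s1
      have hnn : 0 ≤ M * δ * ‖η‖ := by positivity
      linarith
    rw [hXe, Complex.sub_im]
    have n7 := (Complex.abs_im_le_norm _).trans n6
    have t1 := abs_le.1 h1
    have t2 := abs_le.1 n7
    rw [abs_le]
    constructor <;> linarith [t1.1, t1.2, t2.1, t2.2]
  have hnor : ‖inner ℂ ν η‖ ≤ 2 / c * P + 1 / 2 * ‖η‖ := by
    have h5 := norm_inner_normal_le hc ((h.le_norm_fderiv y hy).trans hν.norm_le) hν.dPart_eq η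
    have h6 := Complex.norm_le_abs_re_add_abs_im (dPart Ly η)
    have h7 : ‖dPart Ly η‖ ≤ P + 9 * M * δ * ‖η‖ := by linarith
    -- The errors `4Mδ` and `5Mδ` add up to `9Mδ`; with `36Mδ ≤ c` they become `½‖η‖`, which is
    -- absorbed on the left at the end.
    have h8 : 2 / c * (9 * M * δ * ‖η‖) ≤ 1 / 2 * ‖η‖ := by
      rw [← mul_assoc]
      refine mul_le_mul_of_nonneg_right ?_ (norm_nonneg _)
      rw [div_mul_eq_mul_div, div_le_iff₀ hc]
      linarith
    calc ‖inner ℂ ν η‖ ≤ 2 / c * (P + 9 * M * δ * ‖η‖) := h5.trans (by gcongr)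
      _ ≤ _ := by rw [mul_add]; linarith
  have hsum : ‖η‖ ≤ m * (2 * P) + (2 / c * P + 1 / 2 * ‖η‖) := by
    conv_lhs => rw [← hf.sum_eq η]
    refine (norm_add_le _ _).trans (add_le_add ?_ ?_)
    · refine (norm_sum_le _ _).trans ?_
      have : ∑ j : Fin m, ‖inner ℂ (e j) η • e j‖ ≤ ∑ _j : Fin m, 2 * P := by
        refine Finset.sum_le_sum fun j _ => ?_
        rw [norm_smul, hf.norm_eq, mul_one]
        exact htan j
      simpa using this
    · rw [norm_smul, hν.norm_eq, mul_one]
      exact hnor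
  have e9 : (4 * m + 4 / c) * P = 2 * (m * (2 * P)) + 2 * (2 / c * P) := by ring
  rw [e9]
  linarith

end LeviDefining

/-! ### An elementary estimate for the weighted kernel -/

/-- Split each of the `m + 1` powers of `F` as `F^s F^{1-s}`. One `F^s` is spent on each factor
`(l_j + d) w_j^{2s}`, by `l_j w_j² ≤ (5/2) F` and `d^{1+2s} ≤ d^{3s}`, and one on `X^s`. The rest,
`F^{(m+1)(1-s)}`, dominates `d^α` because `d³ ≤ F`. -/
lemma weighted_kernel_le {m : ℕ} {l w : Fin m → ℝ} {d F X s α M : ℝ} (hd : 0 < d) (hd1 : d ≤ 1)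
    (hM : 1 ≤ M) (hl : ∀ j, 0 ≤ l j) (hlM : ∀ j, l j ≤ M) (hw : ∀ j, 0 ≤ w j) (hwd : ∀ j, w j ≤ d)
    (hlw : ∀ j, l j * w j ^ 2 ≤ 5 / 2 * F) (hdF : d ^ 3 ≤ F) (hX : 0 ≤ X) (hXF : X ≤ F)
    (hs : 0 ≤ s) (hs1 : s ≤ 1) (hα : 3 * (m + 1) * (1 - s) ≤ α) :
    d ^ α * ((∏ j, (l j + d)) / F ^ (m + 1)) * (X ^ s * ∏ j, (w j ^ s * w j ^ s)) ≤
      (5 / 2 * M + 1) ^ m := by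
  have hF : 0 < F := (pow_pos hd 3).trans_le hdF
  have hM0 : 0 ≤ M := by linarith
  have hfac : ∀ j, (l j + d) * (w j ^ s * w j ^ s) ≤ (5 / 2 * M + 1) * F ^ s := by
    intro j
    have h1 : w j ^ s * w j ^ s = (w j ^ 2) ^ s := by
      rw [sq, Real.mul_rpow (hw j) (hw j)]
    have h2 : l j * (w j ^ 2) ^ s ≤ 5 / 2 * M * F ^ s := by
      -- Only `l_j^s` is paired with `w_j^{2s}`; the factor `l_j^{1-s}` is bounded by `M`. The case
      -- `l j = 0` is separate because adding real exponents needs a positive base.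
      have e1 : l j = l j ^ (1 - s) * l j ^ s := by
        rcases eq_or_lt_of_le (hl j) with h0 | h0
        · rw [← h0]
          rcases eq_or_lt_of_le hs with h0' | h0'
          · rw [← h0']; simp
          · rw [Real.zero_rpow h0'.ne', mul_zero]
        · rw [← Real.rpow_add h0]; simp
      calc l j * (w j ^ 2) ^ s = l j ^ (1 - s) * (l j * w j ^ 2) ^ s := by
            rw [Real.mul_rpow (hl j) (by positivity), ← mul_assoc, ← e1]
        _ ≤ M ^ (1 - s) * (5 / 2 * F) ^ s := by
            have a1 : l j ^ (1 - s) ≤ M ^ (1 - s) :=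
              Real.rpow_le_rpow (hl j) (hlM j) (by linarith)
            have a2 : (l j * w j ^ 2) ^ s ≤ (5 / 2 * F) ^ s :=
              Real.rpow_le_rpow (mul_nonneg (hl j) (by positivity)) (hlw j) hs
            exact mul_le_mul a1 a2 (Real.rpow_nonneg (mul_nonneg (hl j) (by positivity)) _)
              (Real.rpow_nonneg hM0 _)
        _ ≤ M * (5 / 2 * F ^ s) := by
            have a1 : M ^ (1 - s) ≤ M := by
              conv_rhs => rw [← Real.rpow_one M]
              exact Real.rpow_le_rpow_of_exponent_le hM (by linarith)
            have a2 : (5 / 2 : ℝ) ^ s ≤ 5 / 2 := by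
              conv_rhs => rw [← Real.rpow_one (5 / 2 : ℝ)]
              exact Real.rpow_le_rpow_of_exponent_le (by norm_num) hs1
            rw [Real.mul_rpow (by norm_num) hF.le]
            have := Real.rpow_nonneg hF.le s
            gcongr
        _ = _ := by ring
    have h3 : d * (w j ^ 2) ^ s ≤ F ^ s := by
      calc d * (w j ^ 2) ^ s ≤ d * (d ^ 2) ^ s := by
            have : (w j ^ 2) ^ s ≤ (d ^ 2) ^ s :=
              Real.rpow_le_rpow (by positivity) (pow_le_pow_left₀ (hw j) (hwd j) 2) hs
            gcongr
        _ = d ^ (1 + 2 * s) := by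
            rw [Real.rpow_add hd, Real.rpow_one, Real.rpow_mul hd.le]
            norm_num
        _ ≤ d ^ (3 * s) := Real.rpow_le_rpow_of_exponent_ge hd hd1 (by linarith)
        _ = (d ^ 3) ^ s := by rw [Real.rpow_mul hd.le]; norm_num
        _ ≤ F ^ s := Real.rpow_le_rpow (by positivity) hdF hs
    rw [h1, add_mul, add_mul, one_mul]
    exact add_le_add h2 h3
  have hprod : (∏ j, (l j + d)) * ∏ j, (w j ^ s * w j ^ s) ≤ (5 / 2 * M + 1) ^ m * (F ^ s) ^ m := by
    rw [← Finset.prod_mul_distrib]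
    refine (Finset.prod_le_prod (fun j _ => ?_) fun j _ => hfac j).trans (le_of_eq ?_)
    · have := Real.rpow_nonneg (hw j) s
      have := hl j
      positivity
    · simp [mul_pow]
  have hXs : X ^ s ≤ F ^ s := Real.rpow_le_rpow hX hXF hs
  have hFs : 0 ≤ F ^ s := Real.rpow_nonneg hF.le s
  have hXs0 : 0 ≤ X ^ s := Real.rpow_nonneg hX s
  have hdα : 0 ≤ d ^ α := Real.rpow_nonneg hd.le α
  have hmain : d ^ α * (F ^ s) ^ (m + 1) ≤ F ^ (m + 1) := by
    have e1 : F ^ (m + 1) = (F ^ (1 - s)) ^ (m + 1) * (F ^ s) ^ (m + 1) := by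
      rw [← mul_pow, ← Real.rpow_add hF]; simp
    rw [e1]
    refine mul_le_mul_of_nonneg_right ?_ (pow_nonneg hFs _)
    calc d ^ α ≤ d ^ (3 * (m + 1) * (1 - s)) := Real.rpow_le_rpow_of_exponent_ge hd hd1 hα
      _ = ((d ^ 3) ^ (1 - s)) ^ (m + 1) := by
          rw [← Real.rpow_natCast d 3, ← Real.rpow_mul hd.le, ← Real.rpow_natCast (_ ^ _) (m + 1),
            ← Real.rpow_mul hd.le]
          congr 1
          push_cast
          ring
      _ ≤ (F ^ (1 - s)) ^ (m + 1) :=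
          pow_le_pow_left₀ (Real.rpow_nonneg (by positivity) _)
            (Real.rpow_le_rpow (by positivity) hdF (by linarith)) _
  have hp0 : 0 ≤ (∏ j, (l j + d)) * ∏ j, (w j ^ s * w j ^ s) :=
    mul_nonneg (Finset.prod_nonneg fun j _ => add_nonneg (hl j) hd.le)
      (Finset.prod_nonneg fun j _ => mul_self_nonneg _)
  calc d ^ α * ((∏ j, (l j + d)) / F ^ (m + 1)) * (X ^ s * ∏ j, (w j ^ s * w j ^ s))
      = d ^ α * X ^ s * ((∏ j, (l j + d)) * ∏ j, (w j ^ s * w j ^ s)) / F ^ (m + 1) := by ring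
    _ ≤ d ^ α * F ^ s * ((5 / 2 * M + 1) ^ m * (F ^ s) ^ m) / F ^ (m + 1) := by gcongr
    _ = (5 / 2 * M + 1) ^ m * ((d ^ α * (F ^ s) ^ (m + 1)) / F ^ (m + 1)) := by ring
    _ ≤ (5 / 2 * M + 1) ^ m * 1 := by
        gcongr
        rw [div_le_one (by positivity)]
        exact hmain
    _ = _ := mul_one _

end CauchyFantappie

namespace CauchyFantappie

/-! ### Hausdorff measure and integrals in Lipschitz coordinates -/

section Hausdorff

variable {X ι : Type*} [MetricSpace X] [MeasurableSpace X] [BorelSpace X] [Fintype ι]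

open scoped NNReal ENNReal

/-- The inverse of `P` on the image is `L`-Lipschitz, and Hausdorff measure of full dimension on `ι
→ ℝ` with the sup norm is Lebesgue measure. No smooth parametrization of the boundary is required.
-/
lemma hausdorffMeasure_le_volume_image {s : Set X} {P : X → ι → ℝ} {L : ℝ≥0}
    (h : ∀ x ∈ s, ∀ y ∈ s, dist x y ≤ L * dist (P x) (P y)) :
    (μH[Fintype.card ι] : Measure X) s ≤ (L : ℝ≥0∞) ^ (Fintype.card ι) * volume (P '' s) := by
  rcases s.eq_empty_or_nonempty with rfl | ⟨x₀, hx₀⟩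
  · simp
  have : Nonempty X := ⟨x₀⟩
  have hinj : Set.InjOn P s := by
    intro x hx y hy hxy
    have := h x hx y hy
    rw [hxy, dist_self, mul_zero] at this
    exact dist_le_zero.1 this
  set g := Function.invFunOn P s with hg
  have hgP : ∀ x ∈ s, g (P x) = x := fun x hx => hinj.leftInvOn_invFunOn hx
  have hlip : LipschitzOnWith L g (P '' s) := by
    refine LipschitzOnWith.of_dist_le_mul ?_
    rintro _ ⟨x, hx, rfl⟩ _ ⟨y, hy, rfl⟩
    rw [hgP x hx, hgP y hy]
    exact h x hx y hy
  have himg : g '' (P '' s) = s := by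
    rw [Set.image_image]
    refine (Set.image_congr fun x hx => hgP x hx).trans (Set.image_id _)
  have := hlip.hausdorffMeasure_image_le (d := Fintype.card ι) (by positivity)
  rw [himg, hausdorffMeasure_pi_real] at this
  simpa using this

/-- A change of variables without Jacobian: the measure bound on all preimages says that the
push-forward under `P` is at most a constant times Lebesgue measure. -/
lemma lintegral_comp_le {s : Set X} (hs : MeasurableSet s) {P : X → ι → ℝ}
    (hP : ContinuousOn P s) {L : ℝ≥0} (h : ∀ x ∈ s, ∀ y ∈ s, dist x y ≤ L * dist (P x) (P y))
    {Q : Set (ι → ℝ)} (hPQ : Set.MapsTo P s Q)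
    {f : (ι → ℝ) → ℝ≥0∞} (hf : Measurable f) :
    ∫⁻ x in s, f (P x) ∂(μH[Fintype.card ι] : Measure X) ≤
      (L : ℝ≥0∞) ^ (Fintype.card ι) * ∫⁻ y in Q, f y := by
  have haem : AEMeasurable P ((μH[Fintype.card ι] : Measure X).restrict s) := hP.aemeasurable hs
  have hmap : Measure.map P ((μH[Fintype.card ι] : Measure X).restrict s) ≤
      ((L : ℝ≥0∞) ^ (Fintype.card ι)) • volume.restrict Q := by
    refine Measure.le_iff.2 fun E hE => ?_
    rw [Measure.map_apply_of_aemeasurable haem hE, Measure.restrict_apply' hs,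
      Measure.smul_apply, smul_eq_mul, Measure.restrict_apply hE]
    refine (hausdorffMeasure_le_volume_image (s := P ⁻¹' E ∩ s) (P := P)
      (fun x hx y hy => h x hx.2 y hy.2)).trans ?_
    gcongr
    rintro _ ⟨x, hx, rfl⟩
    exact ⟨hx.1, hPQ hx.2⟩
  rw [← lintegral_map' hf.aemeasurable haem]
  refine (lintegral_mono' hmap le_rfl).trans ?_
  rw [lintegral_smul_measure, smul_eq_mul]

lemma integrableOn_abs_rpow {s : ℝ} (hs : s < 1) (R : ℝ) (hR : 0 ≤ R) :
    IntegrableOn (fun x : ℝ => |x| ^ (-s)) (Set.Icc (-R) R) := by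
  have h1 : IntervalIntegrable (fun x : ℝ => |x| ^ (-s)) volume 0 R := by
    refine (intervalIntegral.intervalIntegrable_rpow' (r := -s) (by linarith)).congr ?_
    intro x hx
    rw [Set.uIoc_of_le hR] at hx
    simp only [abs_of_pos hx.1]
  have h2 : IntervalIntegrable (fun x : ℝ => |x| ^ (-s)) volume (-R) 0 := by
    have := (IntervalIntegrable.iff_comp_neg (f := fun x : ℝ => |x| ^ (-s))).1 h1
    simp only [abs_neg, neg_zero] at this
    exact this.symm
  have h3 := h2.trans h1
  rwa [intervalIntegrable_iff_integrableOn_Icc_of_le (by linarith)] at h3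

/-- The product of the weights `|yₐ|^{-s}`. -/
def invWeight (s : ℝ) (y : ι → ℝ) : ℝ≥0∞ := ∏ a, (ENNReal.ofReal (|y a| ^ s))⁻¹

lemma measurable_invWeight (s : ℝ) : Measurable (invWeight s : (ι → ℝ) → ℝ≥0∞) := by
  unfold invWeight
  refine Finset.measurable_fun_prod _ fun a _ => ?_
  exact ((measurable_pi_apply a).abs.pow_const s).ennreal_ofReal.inv

/-- A product of one-dimensional integrals of `|x|^{-s}`. The coordinate hyperplanes, where the
inverse in `ENNReal` and the real power may disagree, are null sets. -/
lemma lintegral_invWeight_lt_top {s : ℝ} (hs : s < 1) (R : ℝ) (hR : 0 ≤ R) :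
    ∫⁻ y in Set.univ.pi (fun _ : ι => Set.Icc (-R) R), invWeight s y < ⊤ := by
  have hint : Integrable (fun y : ι → ℝ => ∏ a, |y a| ^ (-s))
      (Measure.pi fun _ : ι => (volume : Measure ℝ).restrict (Set.Icc (-R) R)) :=
    Integrable.fintype_prod (f := fun _ x => |x| ^ (-s)) fun a => integrableOn_abs_rpow hs R hR
  have hvol : (volume : Measure (ι → ℝ)).restrict (Set.univ.pi fun _ : ι => Set.Icc (-R) R) =
      Measure.pi fun _ : ι => (volume : Measure ℝ).restrict (Set.Icc (-R) R) := by
    rw [volume_pi, Measure.restrict_pi_pi]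
  rw [hvol]
  have hae : ∀ᵐ y ∂(Measure.pi fun _ : ι => (volume : Measure ℝ).restrict (Set.Icc (-R) R)),
      ∀ a, y a ≠ 0 := by
    rw [ae_all_iff]
    exact fun a => Measure.ae_eval_ne _ a 0
  have heq : ∫⁻ y, invWeight s y ∂(Measure.pi fun _ : ι =>
      (volume : Measure ℝ).restrict (Set.Icc (-R) R)) =
      ∫⁻ y, ENNReal.ofReal (∏ a, |y a| ^ (-s)) ∂(Measure.pi fun _ : ι =>
        (volume : Measure ℝ).restrict (Set.Icc (-R) R)) := by
    refine lintegral_congr_ae ?_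
    filter_upwards [hae] with y hy
    rw [invWeight, ENNReal.ofReal_prod_of_nonneg fun a _ => Real.rpow_nonneg (abs_nonneg _) _]
    refine Finset.prod_congr rfl fun a _ => ?_
    rw [Real.rpow_neg (abs_nonneg _), ENNReal.ofReal_inv_of_pos]
    exact Real.rpow_pos_of_pos (abs_pos.2 (hy a)) _
  rw [heq]
  exact hint.lintegral_lt_top

/-- Passes from a product bound to a quotient bound with no exceptional set: where the weight
vanishes the right-hand side is `⊤`. -/
lemma le_mul_invWeight {s A t : ℝ} {y : ι → ℝ} (hA : 0 < A) (h : t * ∏ a, |y a| ^ s ≤ A) :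
    ENNReal.ofReal t ≤ ENNReal.ofReal A * invWeight s y := by
  have hnn : ∀ a, 0 ≤ |y a| ^ s := fun a => Real.rpow_nonneg (abs_nonneg _) _
  have hinv : invWeight s y = (ENNReal.ofReal (∏ a, |y a| ^ s))⁻¹ := by
    rw [invWeight, ENNReal.ofReal_prod_of_nonneg fun a _ => hnn a,
      ENNReal.prod_inv_distrib]
    intro a _ b _ _
    exact Or.inr ENNReal.ofReal_ne_top
  rw [hinv, ← div_eq_mul_inv]
  rcases eq_or_lt_of_le (Finset.prod_nonneg fun a (_ : a ∈ Finset.univ) => hnn a) with h0 | h0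
  · rw [← h0]
    simp [ENNReal.div_zero, hA]
  · rw [ENNReal.le_div_iff_mul_le (Or.inl (by simpa using h0)) (Or.inl ENNReal.ofReal_ne_top),
      ← ENNReal.ofReal_mul' h0.le]
    exact ENNReal.ofReal_le_ofReal h

end Hausdorff

end CauchyFantappie

namespace CauchyFantappie

variable {n : ℕ}

/-! ### Joint regularity of the kernel off the diagonal -/

lemma contDiffAt_dr {r : Cn n → ℝ} {ζ : Cn n} (h : ContDiffAt ℝ 3 r ζ) (j : Fin n) :
    ContDiffAt ℝ 1 (dr r j) ζ := by
  have h2 : ContDiffAt ℝ 2 r ζ := h.of_le (by norm_num)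
  have h1 : ContDiffAt ℝ 1 (fderiv ℝ r) ζ := h2.fderiv_right (by norm_num)
  exact ((dPartCLM (EuclideanSpace.single j 1)).contDiff.contDiffAt.comp ζ h1).congr_of_eventuallyEq
    (eventually_dz_eq h2 j)

lemma contDiffAt_ddr {r : Cn n → ℝ} {ζ : Cn n} (h : ContDiffAt ℝ 3 r ζ) (j k : Fin n) :
    ContDiffAt ℝ 1 (ddr r j k) ζ := by
  have h2 : ContDiffAt ℝ 2 r ζ := h.of_le (by norm_num)
  have h1 : ContDiffAt ℝ 1 (fderiv ℝ (fderiv ℝ r)) ζ :=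
    (h.fderiv_right (m := 2) (by norm_num)).fderiv_right (by norm_num)
  have hev : ddr r j k =ᶠ[nhds ζ] fun x =>
      (qPartCLM (EuclideanSpace.single j 1)).flip (EuclideanSpace.single k 1)
        (fderiv ℝ (fderiv ℝ r) x) := by
    filter_upwards [h2.eventually (by simp)] with x hx
    exact ddr_eq hx j k
  exact (((qPartCLM (EuclideanSpace.single j 1)).flip
    (EuclideanSpace.single k 1)).contDiff.contDiffAt.comp ζ h1).congr_of_eventuallyEq hev

/-- Regularity jointly in `(ζ, z)` is what makes the estimate away from the diagonal uniform in `z`.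
Class `C³` of `r` leaves one derivative for the second-order coefficients, just enough for `∂̄W`. -/
lemma contDiffAt_WS {r : Cn n → ℝ} {ζ z : Cn n} (h : ContDiffAt ℝ 3 r ζ) (hne : ζ ≠ z) {K : ℝ}
    {χ : ℝ → ℝ} (hχ : ContDiff ℝ ∞ χ) (hS : S r K χ ζ z ≠ 0) (j : Fin n) :
    ContDiffAt ℝ 1 (fun p : Cn n × Cn n => WS r K χ p.2 j p.1) (ζ, z) := by
  have hfst : ContDiffAt ℝ 1 (fun p : Cn n × Cn n => p.1) (ζ, z) := contDiffAt_fst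
  have hsub : ContDiffAt ℝ 1 (fun p : Cn n × Cn n => p.1 - p.2) (ζ, z) :=
    contDiffAt_fst.sub contDiffAt_snd
  have hof : ∀ {f : Cn n × Cn n → ℝ}, ContDiffAt ℝ 1 f (ζ, z) →
      ContDiffAt ℝ 1 (fun p => (f p : ℂ)) (ζ, z) := fun hf =>
    Complex.ofRealCLM.contDiff.contDiffAt.comp (ζ, z) hf
  have hnormR : ContDiffAt ℝ 1 (fun p : Cn n × Cn n => ‖p.1 - p.2‖) (ζ, z) :=
    hsub.norm ℂ (sub_ne_zero.2 hne)
  have hnorm := hof hnormR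
  have hχp : ContDiffAt ℝ 1 (fun p : Cn n × Cn n => (χ ‖p.1 - p.2‖ : ℂ)) (ζ, z) :=
    hof ((hχ.of_le (by exact_mod_cast le_top)).contDiffAt.comp (ζ, z) hnormR)
  have hc : ∀ i, ContDiffAt ℝ 1 (fun p : Cn n × Cn n => p.1 i - p.2 i) (ζ, z) := fun i =>
    ((EuclideanSpace.proj i : Cn n →L[ℂ] ℂ).restrictScalars ℝ).contDiff.contDiffAt.comp (ζ, z) hsub
  have hcs : ∀ i, ContDiffAt ℝ 1 (fun p : Cn n × Cn n => star (p.1 i - p.2 i)) (ζ, z) := fun i =>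
    Complex.conjCLE.toContinuousLinearMap.contDiff.contDiffAt.comp (ζ, z) (hc i)
  have hdr : ∀ i, ContDiffAt ℝ 1 (fun p : Cn n × Cn n => dr r i p.1) (ζ, z) := fun i =>
    (contDiffAt_dr h i).comp (ζ, z) hfst
  have hddr : ∀ i k, ContDiffAt ℝ 1 (fun p : Cn n × Cn n => ddr r i k p.1) (ζ, z) := fun i k =>
    (contDiffAt_ddr h i k).comp (ζ, z) hfst
  have hr : ContDiffAt ℝ 1 (fun p : Cn n × Cn n => (r p.1 : ℂ)) (ζ, z) :=
    hof ((h.of_le (by norm_num)).comp (ζ, z) hfst)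
  have hg : ContDiffAt ℝ 1 (fun p : Cn n × Cn n => gCoeff r K j p.1 p.2) (ζ, z) := by
    unfold gCoeff
    exact ((hdr j).sub (contDiffAt_const.mul (ContDiffAt.sum fun k _ => (hddr j k).mul (hc k)))).add
      ((contDiffAt_const.mul hnorm).mul (hcs j))
  have hΦ : ContDiffAt ℝ 1 (fun p : Cn n × Cn n => Phi r K p.1 p.2) (ζ, z) := by
    unfold Phi leviPoly
    exact (((ContDiffAt.sum fun k _ => (hdr k).mul (hc k)).sub
      (contDiffAt_const.mul (ContDiffAt.sum fun i _ => ContDiffAt.sum fun k _ =>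
        ((hddr i k).mul (hc i)).mul (hc k)))).sub hr).add (contDiffAt_const.mul (hnorm.pow 3))
  have hSS : ContDiffAt ℝ 1 (fun p : Cn n × Cn n => S r K χ p.1 p.2) (ζ, z) := by
    unfold S
    exact (hχp.mul hΦ).add ((contDiffAt_const.sub hχp).mul (hnorm.pow 2))
  have hss : ContDiffAt ℝ 1 (fun p : Cn n × Cn n => sCoeff r K χ j p.1 p.2) (ζ, z) := by
    unfold sCoeff
    exact (hχp.mul hg).add ((contDiffAt_const.sub hχp).mul (hcs j))
  unfold WS
  exact hss.mul (hSS.inv hS)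

lemma continuousAt_Omega0_WS {r : Cn n → ℝ} {ζ z : Cn n} (h : ContDiffAt ℝ 3 r ζ) (hne : ζ ≠ z)
    {K : ℝ} {χ : ℝ → ℝ} (hχ : ContDiff ℝ ∞ χ) (hS : S r K χ ζ z ≠ 0)
    (v : Fin (2 * (n - 1) + 1) → Cn n) :
    ContinuousAt (fun q : (Cn n × Cn n) × (Fin (2 * (n - 1) + 1) → Cn n) =>
      Omega0 (WS r K χ q.1.2) q.1.1 q.2) ((ζ, z), v) := by
  have hW : ∀ j, ContinuousAt (fun q : (Cn n × Cn n) × (Fin (2 * (n - 1) + 1) → Cn n) =>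
      WS r K χ q.1.2 j q.1.1) ((ζ, z), v) := fun j =>
    ContinuousAt.comp (f := Prod.fst) (x := ((ζ, z), v))
      (contDiffAt_WS h hne hχ hS j).continuousAt continuousAt_fst
  have hfd : ∀ j, ContinuousAt (fun p : Cn n × Cn n => fderiv ℝ (WS r K χ p.2 j) p.1) (ζ, z) := by
    intro j
    -- Only `ζ` is differentiated, but the derivative must be continuous in the parameter `z` as
    -- well, so the joint statement is used.
    have hj : ContDiffAt ℝ 1 (Function.uncurry fun (p : Cn n × Cn n) (x : Cn n) =>
        WS r K χ p.2 j x) ((ζ, z), ζ) := by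
      have h1 : ContDiffAt ℝ 1 (fun a : (Cn n × Cn n) × Cn n => (a.2, a.1.2)) ((ζ, z), ζ) :=
        contDiffAt_snd.prodMk (contDiffAt_snd.comp _ contDiffAt_fst)
      exact ContDiffAt.comp ((ζ, z), ζ) (contDiffAt_WS h hne hχ hS j) h1
    exact (ContDiffAt.fderiv (m := 0) hj contDiffAt_fst (by norm_num)).continuousAt
  have hdb : ∀ j k, ContinuousAt (fun q : (Cn n × Cn n) × (Fin (2 * (n - 1) + 1) → Cn n) =>
      dzbar k (WS r K χ q.1.2 j) q.1.1) ((ζ, z), v) := by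
    intro j k
    have h1 : ContinuousAt (fun p : Cn n × Cn n => dzbar k (WS r K χ p.2 j) p.1) (ζ, z) := by
      unfold dzbar
      exact continuousAt_const.mul (((hfd j).clm_apply continuousAt_const).add
        (continuousAt_const.mul ((hfd j).clm_apply continuousAt_const)))
    exact ContinuousAt.comp (f := Prod.fst) (x := ((ζ, z), v)) h1 continuousAt_fst
  have hv : ∀ i k, ContinuousAt (fun q : (Cn n × Cn n) × (Fin (2 * (n - 1) + 1) → Cn n) =>
      q.2 i k) ((ζ, z), v) := by
    intro i k
    have : Continuous (fun q : (Cn n × Cn n) × (Fin (2 * (n - 1) + 1) → Cn n) => q.2 i k) := by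
      have h2 : Continuous fun q : (Cn n × Cn n) × (Fin (2 * (n - 1) + 1) → Cn n) => q.2 i :=
        (continuous_apply i).comp continuous_snd
      exact (EuclideanSpace.proj k : Cn n →L[ℂ] ℂ).continuous.comp h2
    exact this.continuousAt
  have hα : ∀ i, ContinuousAt (fun q : (Cn n × Cn n) × (Fin (2 * (n - 1) + 1) → Cn n) =>
      form10 (WS r K χ q.1.2) q.1.1 (q.2 i)) ((ζ, z), v) := by
    intro i
    unfold form10
    exact tendsto_finsetSum _ fun j _ => (hW j).mul (hv i j)
  have hdf : ∀ j i, ContinuousAt (fun q : (Cn n × Cn n) × (Fin (2 * (n - 1) + 1) → Cn n) =>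
      dbarFun (WS r K χ q.1.2 j) q.1.1 (q.2 i)) ((ζ, z), v) := by
    intro j i
    unfold dbarFun
    exact tendsto_finsetSum _ fun k _ => (hdb j k).mul (continuous_star.continuousAt.comp (hv i k))
  have hβ : ∀ i i', ContinuousAt (fun q : (Cn n × Cn n) × (Fin (2 * (n - 1) + 1) → Cn n) =>
      dbarForm (WS r K χ q.1.2) q.1.1 (q.2 i) (q.2 i')) ((ζ, z), v) := by
    intro i i'
    unfold dbarForm
    exact tendsto_finsetSum _ fun j _ =>
      ((hdf j i).mul (hv i' j)).sub ((hdf j i').mul (hv i j))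
  unfold Omega0 wedgePow
  exact continuousAt_const.mul (continuousAt_const.mul (tendsto_finsetSum _ fun σ _ =>
    (continuousAt_const.mul (hα _)).mul (tendsto_finsetProd _ fun i _ => hβ _ _)))

/-! ### Measurability of the tangential norm -/

lemma isCompact_orthonormal (p : ℕ) : IsCompact {v : Fin p → Cn n | Orthonormal ℝ v} := by
  refine (isCompact_closedBall (0 : Fin p → Cn n) 1).of_isClosed_subset ?_ ?_
  · have : {v : Fin p → Cn n | Orthonormal ℝ v} =
        ⋂ i, ⋂ j, {v | inner ℝ (v i) (v j) = if i = j then (1 : ℝ) else 0} := by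
      ext v
      simp only [Set.mem_ofPred_eq, Set.mem_iInter, orthonormal_iff_ite]
    rw [this]
    exact isClosed_iInter fun i => isClosed_iInter fun j => isClosed_eq
      ((continuous_apply i).inner (continuous_apply j)) continuous_const
  · intro v hv
    rw [mem_closedBall_zero_iff, pi_norm_le_iff_of_nonneg zero_le_one]
    exact fun i => (hv.1 i).le

lemma tangentialNorm_nonneg {p : ℕ} (r : Cn n → ℝ) (ζ : Cn n) (η : (Fin p → Cn n) → ℂ) :
    0 ≤ tangentialNorm r ζ η := by
  refine Real.sSup_nonneg ?_
  rintro x ⟨v, -, -, rfl⟩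
  exact norm_nonneg _

lemma tangentialNorm_le {p : ℕ} {r : Cn n → ℝ} {ζ : Cn n} {η : (Fin p → Cn n) → ℂ} {C : ℝ}
    (hC : 0 ≤ C) (h : ∀ v, Orthonormal ℝ v → (∀ i, fderiv ℝ r ζ (v i) = 0) → ‖η v‖ ≤ C) :
    tangentialNorm r ζ η ≤ C := by
  refine Real.sSup_le ?_ hC
  rintro x ⟨v, h1, h2, rfl⟩
  exact h v h1 h2

/-- The tangential norm of a continuous family of forms is measurable on a countable union of
compact sets. -/
lemma measurable_indicator_tangentialNorm {p : ℕ} {r : Cn n → ℝ}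
    {η : Cn n → (Fin p → Cn n) → ℂ} {Y : ℕ → Set (Cn n)} (hY : ∀ k, IsCompact (Y k))
    (hr : ∀ k, ContinuousOn (fderiv ℝ r) (Y k))
    (hη : ∀ k, ContinuousOn (fun q : Cn n × (Fin p → Cn n) => η q.1 q.2)
      (Y k ×ˢ {v | Orthonormal ℝ v})) :
    Measurable ((⋃ k, Y k).indicator fun ζ => tangentialNorm r ζ (η ζ)) := by
  -- Orthonormal frames form a compact set, so this set is the projection of a compact set and hence
  -- closed.
  have hcpt : ∀ (k : ℕ) (c : ℝ), MeasurableSet {ζ | ζ ∈ Y k ∧ ∃ v, Orthonormal ℝ v ∧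
      (∀ i, fderiv ℝ r ζ (v i) = 0) ∧ c ≤ ‖η ζ v‖} := by
    intro k c
    set Q : Set (Cn n × (Fin p → Cn n)) := Y k ×ˢ {v | Orthonormal ℝ v} with hQ
    have hQc : IsCompact Q := (hY k).prod (isCompact_orthonormal p)
    have h1 : IsClosed (Q ∩ (fun q => fun i => fderiv ℝ r q.1 (q.2 i)) ⁻¹' {0}) := by
      refine ContinuousOn.preimage_isClosed_of_isClosed ?_ hQc.isClosed isClosed_singleton
      refine continuousOn_pi.2 fun i => ?_
      exact ((hr k).comp continuousOn_fst fun q hq => hq.1).clm_apply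
        ((continuous_apply i).comp continuous_snd).continuousOn
    have h2 : IsClosed (Q ∩ (fun q => ‖η q.1 q.2‖) ⁻¹' Set.Ici c) :=
      ContinuousOn.preimage_isClosed_of_isClosed (hη k).norm hQc.isClosed isClosed_Ici
    have h3 : IsCompact ((Q ∩ (fun q => fun i => fderiv ℝ r q.1 (q.2 i)) ⁻¹' {0}) ∩
        (Q ∩ (fun q => ‖η q.1 q.2‖) ⁻¹' Set.Ici c)) :=
      hQc.of_isClosed_subset (h1.inter h2) fun q hq => hq.1.1
    convert (h3.image continuous_fst).isClosed.measurableSet using 1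
    ext ζ
    constructor
    · rintro ⟨hζ, v, hv, hv', hc⟩
      exact ⟨(ζ, v), ⟨⟨⟨hζ, hv⟩, funext hv'⟩, ⟨⟨hζ, hv⟩, hc⟩⟩, rfl⟩
    · rintro ⟨⟨ζ', v⟩, ⟨⟨⟨hζ, hv⟩, hv'⟩, ⟨-, hc⟩⟩, rfl⟩
      exact ⟨hζ, v, hv, fun i => congrFun hv' i, hc⟩
  have hbdd : ∀ k, ∀ ζ ∈ Y k, BddAbove {x : ℝ | ∃ v : Fin p → Cn n, Orthonormal ℝ v ∧
      (∀ i, fderiv ℝ r ζ (v i) = 0) ∧ x = ‖η ζ v‖} := by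
    intro k ζ hζ
    obtain ⟨C, hC⟩ := ((hY k).prod (isCompact_orthonormal p)).exists_bound_of_continuousOn (hη k)
    refine ⟨C, ?_⟩
    rintro x ⟨v, hv, -, rfl⟩
    exact hC (ζ, v) ⟨hζ, hv⟩
  refine measurable_of_Ioi fun c => ?_
  rcases lt_or_ge c 0 with hc | hc
  · convert MeasurableSet.univ
    refine Set.eq_univ_of_forall fun ζ => ?_
    exact hc.trans_le (Set.indicator_nonneg (fun ζ _ => tangentialNorm_nonneg r ζ _) ζ)
  · have : (⋃ k, Y k).indicator (fun ζ => tangentialNorm r ζ (η ζ)) ⁻¹' Set.Ioi c =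
        ⋃ k, ⋃ q : ℕ, {ζ | ζ ∈ Y k ∧ ∃ v, Orthonormal ℝ v ∧
          (∀ i, fderiv ℝ r ζ (v i) = 0) ∧ c + 1 / ((q : ℝ) + 1) ≤ ‖η ζ v‖} := by
      ext ζ
      simp only [Set.mem_preimage, Set.mem_Ioi, Set.mem_iUnion, Set.mem_ofPred_eq]
      constructor
      · intro hlt
        by_cases hζ : ζ ∈ ⋃ k, Y k
        · rw [Set.indicator_of_mem hζ] at hlt
          obtain ⟨k, hk⟩ := Set.mem_iUnion.1 hζ
          -- With no tangential orthonormal family, the supremum would have its default value 0,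
          -- which is not greater than `c ≥ 0`.
          have hne : {x : ℝ | ∃ v : Fin p → Cn n, Orthonormal ℝ v ∧
              (∀ i, fderiv ℝ r ζ (v i) = 0) ∧ x = ‖η ζ v‖}.Nonempty := by
            by_contra hempty
            rw [Set.not_nonempty_iff_eq_empty] at hempty
            rw [tangentialNorm, hempty, Real.sSup_empty] at hlt
            linarith
          obtain ⟨x, ⟨v, hv, hv', rfl⟩, hx⟩ := exists_lt_of_lt_csSup hne hlt
          obtain ⟨q, hq⟩ := exists_nat_one_div_lt (sub_pos.2 hx)
          exact ⟨k, q, hk, v, hv, hv', by linarith⟩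
        · rw [Set.indicator_of_notMem hζ] at hlt
          linarith
      · rintro ⟨k, q, hk, v, hv, hv', hle⟩
        rw [Set.indicator_of_mem (Set.mem_iUnion.2 ⟨k, hk⟩)]
        have hpos : (0 : ℝ) < 1 / ((q : ℝ) + 1) := by positivity
        refine lt_of_lt_of_le ?_ (le_csSup (hbdd k ζ hk) ⟨v, hv, hv', rfl⟩)
        linarith
    rw [this]
    exact MeasurableSet.iUnion fun k => MeasurableSet.iUnion fun q => hcpt k _

end CauchyFantappie

namespace CauchyFantappie

/-! ### The modified defining function -/

/-- On `bD` one has `φ = 0`, so `dr` is a positive multiple of `dφ` there and does not vanish. Of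
the pseudoconvexity of the level sets, only that of `bD` is carried on. -/
lemma exists_leviDefining_modDef {n : ℕ} {k : ℕ∞} (hk : 3 ≤ k) {D U : Set (Cn n)} {φ : Cn n → ℝ}
    (hD : IsPseudoconvexDomain k D U φ) {C : ℝ} (hC : LevelsPseudoconvex D U (modDef φ C)) :
    ∃ ρ M c, LeviDefining D (modDef φ C) ρ M c := by
  have hdef := hD.isDefiningFunction
  have hφ : ContDiffOn ℝ 3 φ U := hdef.contDiffOn.of_le (three_le_coe hk)
  have hX := isCompact_frontier hD.isBounded
  have hr : ContDiffOn ℝ 3 (modDef φ C) U := by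
    unfold modDef
    exact hφ.mul ((contDiff_const.mul (contDiff_norm_sq ℝ)).exp).contDiffOn
  have hne : ∀ y ∈ frontier D, fderiv ℝ (modDef φ C) y ≠ 0 := by
    intro y hy
    have hd : DifferentiableAt ℝ φ y :=
      (hφ.contDiffAt (hdef.isOpen.mem_nhds (hdef.frontier_subset hy))).differentiableAt (by simp)
    rw [(fderiv_modDef hd C).fderiv, hdef.eq_zero hD.isOpen hy]
    simpa [Real.exp_ne_zero] using hdef.fderiv_ne_zero y hy
  obtain ⟨ρ, M, hb, hbU⟩ := exists_thirdOrderBounds hX hdef.isOpen hdef.frontier_subset hr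
  obtain ⟨c, hc, hcb⟩ := exists_pos_le_norm_fderiv hX hdef.isOpen hdef.frontier_subset hr hne
  obtain ⟨V, -, hV, -, hlevi⟩ := hC
  refine ⟨ρ, M, c, hb, fun y hy => ?_, fun y hy z hz hzy => ?_, hc, hcb,
    fun y hy => hlevi y ⟨frontier_subset_closure hy, hV hy⟩⟩
  · rw [modDef, hdef.eq_zero hD.isOpen hy, zero_mul]
  · exact mul_nonpos_of_nonpos_of_nonneg (hdef.nonpos hz (hbU y hy hzy)) (Real.exp_pos _).le

/-- The scales on which the local estimates hold. -/
structure IsSmallScale (ρ M c ε : ℝ) : Prop where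
  pos : 0 < ε
  le_one : ε ≤ 1
  two_mul_le : 2 * ε ≤ ρ
  mul_le : 36 * M * ε ≤ c

namespace LeviDefining

variable {m : ℕ} {D : Set (Cn (m + 1))} {r : Cn (m + 1) → ℝ} {ρ M c : ℝ}

/-- The eigenvalues are values of the Levi form on unit complex tangent vectors: nonnegative by
pseudoconvexity, at most `M` by the Hessian bound. -/
lemma exists_frame (h : LeviDefining D r ρ M c) {y : Cn (m + 1)} (hy : y ∈ frontier D) :
    ∃ (ν : Cn (m + 1)) (e : Fin m → Cn (m + 1)) (l : Fin m → ℝ), IsUnitNormal r y ν ∧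
      IsLeviFrame (fderiv ℝ (fderiv ℝ r) y) ν e l ∧ (∀ j, 0 ≤ l j) ∧ ∀ j, l j ≤ M := by
  obtain ⟨ν, hν⟩ := h.exists_isUnitNormal hy
  obtain ⟨e, l, hf⟩ := exists_isLeviFrame (hessian_symm (h.contDiffAt_two hy)) hν.norm_eq
  have hl : ∀ j, (lPart (fderiv ℝ (fderiv ℝ r) y) (e j) (e j)).re = l j := fun j => by
    rw [hf.lPart_eq, if_pos rfl, Complex.ofReal_re]
  refine ⟨ν, e, l, hν, hf, fun j => ?_, fun j => ?_⟩
  · rw [← hl]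
    exact h.levi_tangential_nonneg hy hν (hf.inner_normal j)
  · rw [← hl]
    refine (Complex.re_le_norm _).trans ((norm_lPart_le _ _ _).trans ?_)
    rw [hf.norm_eq, mul_one, mul_one]
    exact h.bounds.norm_hessian_le y hy y (h.mem_ball_self y)

lemma continuousOn_fderiv (h : LeviDefining D r ρ M c) :
    ContinuousOn (fderiv ℝ r) (frontier D) := fun ζ hζ =>
  ((h.contDiffAt_two hζ).fderiv_right (m := 1) (by norm_num)).continuousAt.continuousWithinAt

lemma continuousOn_bdryCoord (h : LeviDefining D r ρ M c) (K : ℝ) (e : Fin m → Cn (m + 1))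
    (z : Cn (m + 1)) : ContinuousOn (bdryCoord r K e z) (frontier D) := by
  have hin : ∀ j, Continuous fun ζ : Cn (m + 1) => inner ℂ (e j) (ζ - z) := fun j => by fun_prop
  refine continuousOn_pi.2 fun a => ?_
  rcases a with _ | ⟨j, _ | _⟩
  · refine ContinuousOn.congr (f := fun ζ => (dPart (fderiv ℝ r ζ) (ζ - z) -
      (1 / 2) * qPart (fderiv ℝ (fderiv ℝ r) ζ) (ζ - z) (ζ - z)).im) ?_
      fun ζ hζ => Phi_im (h.contDiffAt_two hζ) K z
    have h1 := h.continuousOn_fderiv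
    have h2 : ContinuousOn (fderiv ℝ (fderiv ℝ r)) (frontier D) := fun ζ hζ =>
      (((h.contDiffAt hζ).fderiv_right (m := 2) (by norm_num)).fderiv_right
        (m := 1) (by norm_num)).continuousAt.continuousWithinAt
    unfold dPart qPart
    fun_prop
  · exact (Complex.continuous_re.comp (hin j)).continuousOn
  · exact (Complex.continuous_im.comp (hin j)).continuousOn

/-- The Lipschitz constant of the inverse of the boundary coordinates. -/
lemma dist_le_bdryCoord (h : LeviDefining D r ρ M c) {ε : ℝ} (hε : IsSmallScale ρ M c ε)
    {y ν : Cn (m + 1)} {e : Fin m → Cn (m + 1)} {l : Fin m → ℝ} (hy : y ∈ frontier D)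
    (hν : IsUnitNormal r y ν) (hf : IsLeviFrame (fderiv ℝ (fderiv ℝ r) y) ν e l) (K : ℝ)
    {z : Cn (m + 1)} (hzy : ‖z - y‖ ≤ ε / 2) :
    ∀ ζ ∈ frontier D ∩ Metric.ball z (ε / 2), ∀ ζ' ∈ frontier D ∩ Metric.ball z (ε / 2),
      dist ζ ζ' ≤ (Real.toNNReal (4 * m + 4 / c)) *
        dist (bdryCoord r K e z ζ) (bdryCoord r K e z ζ') := by
  rintro ζ ⟨hζ, hζz⟩ ζ' ⟨hζ', hζ'z⟩
  have hc := h.pos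
  have hM := h.M_pos
  rw [Metric.mem_ball, dist_eq_norm] at hζz hζ'z
  rw [Real.coe_toNNReal _ (by positivity), dist_eq_norm, dist_eq_norm]
  have hy1 : ∀ x : Cn (m + 1), ‖x - z‖ < ε / 2 → ‖x - y‖ ≤ 2 * (ε / 2) := fun x hx => by
    have := norm_sub_le_norm_sub_add_norm_sub x z y
    linarith
  have := hε.pos
  have := hε.two_mul_le
  have := hε.le_one
  have := hε.mul_le
  exact h.norm_sub_le_bdryCoord hy hν hf (δ := ε / 2) (by linarith) (by linarith)
    (by nlinarith) K hζ hζ' hζz.le hζ'z.le (hy1 ζ hζz) (hy1 ζ' hζ'z)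

lemma mapsTo_bdryCoord (h : LeviDefining D r ρ M c) {ε : ℝ} (hε : IsSmallScale ρ M c ε)
    {ν : Cn (m + 1)} {B : Cn (m + 1) →L[ℝ] Cn (m + 1) →L[ℝ] ℝ} {e : Fin m → Cn (m + 1)}
    {l : Fin m → ℝ} (hf : IsLeviFrame B ν e l) (K : ℝ) (z : Cn (m + 1)) :
    Set.MapsTo (bdryCoord r K e z) (frontier D ∩ Metric.ball z (ε / 2))
      (Set.univ.pi fun _ => Set.Icc (-(2 * M)) (2 * M)) := by
  rintro ζ ⟨hζ, hζz⟩ a -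
  rw [Metric.mem_ball, dist_eq_norm] at hζz
  exact abs_le.1 (h.abs_bdryCoord_le hf hζ (by linarith [hε.le_one, hε.pos]) K a)

lemma card_index (m : ℕ) : Fintype.card (Option (Fin m × Bool)) = 2 * (m + 1) - 1 := by
  simp; omega

/-- By compactness local finiteness suffices, and a small piece of `bD` is a Lipschitz image of a
subset of a cube. The boundary coordinates with `K = 0` and `z = y` serve for this. -/
lemma hausdorffMeasure_frontier_lt_top (h : LeviDefining D r ρ M c) {ε : ℝ}
    (hε : IsSmallScale ρ M c ε) (hX : IsCompact (frontier D)) :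
    (μH[(2 * (m + 1) - 1 : ℕ)] : Measure (Cn (m + 1))) (frontier D) < ⊤ := by
  refine hX.measure_lt_top_of_nhdsWithin fun y hy => ?_
  obtain ⟨ν, e, l, hν, hf, -, -⟩ := h.exists_frame hy
  refine ⟨frontier D ∩ Metric.ball y (ε / 2), ?_, ?_⟩
  · exact Filter.inter_mem self_mem_nhdsWithin
      (mem_nhdsWithin_of_mem_nhds (Metric.ball_mem_nhds _ (half_pos hε.pos)))
  · have h1 := hausdorffMeasure_le_volume_image
      (h.dist_le_bdryCoord hε hy hν hf 0 (z := y) (by simpa using (half_pos hε.pos).le))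
    rw [card_index] at h1
    refine h1.trans_lt (ENNReal.mul_lt_top (by finiteness) ?_)
    refine (measure_mono (h.mapsTo_bdryCoord hε hf 0 y).image_subset).trans_lt ?_
    exact (isCompact_univ_pi fun _ => isCompact_Icc).measure_lt_top

lemma isFiniteMeasure_surfaceMeasure (h : LeviDefining D r ρ M c) {ε : ℝ}
    (hε : IsSmallScale ρ M c ε) (hX : IsCompact (frontier D)) :
    IsFiniteMeasure (surfaceMeasure D) := by
  refine ⟨?_⟩
  rw [surfaceMeasure, Measure.restrict_apply_univ, Measure.euclideanHausdorffMeasure_def,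
    Measure.smul_apply, ENNReal.smul_def, smul_eq_mul]
  exact ENNReal.mul_lt_top ENNReal.coe_lt_top (h.hausdorffMeasure_frontier_lt_top hε hX)

end LeviDefining

end CauchyFantappie

namespace CauchyFantappie

/-! ### The kernel near the diagonal -/

lemma prod_abs_bdryCoord_rpow_le {m n : ℕ} (r : Cn n → ℝ) (K : ℝ) (e : Fin m → Cn n) (z ζ : Cn n)
    {s : ℝ} (hs : 0 ≤ s) :
    ∏ a, |bdryCoord r K e z ζ a| ^ s ≤ |(Phi r K ζ z).im| ^ s *
      ∏ j, (‖inner ℂ (e j) (ζ - z)‖ ^ s * ‖inner ℂ (e j) (ζ - z)‖ ^ s) := by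
  rw [Fintype.prod_option, Fintype.prod_prod_type]
  simp only [Fintype.prod_bool, bdryCoord]
  gcongr with j _
  · exact Complex.abs_im_le_norm _
  · exact Complex.abs_re_le_norm _

lemma kernelDensity_nonneg {n : ℕ} (r : Cn n → ℝ) (K : ℝ) (χ : ℝ → ℝ) (α : ℝ) (z ζ : Cn n) :
    0 ≤ kernelDensity r K χ α z ζ :=
  mul_nonneg (Real.rpow_nonneg (norm_nonneg _) _) (tangentialNorm_nonneg _ _ _)

namespace LeviDefining

variable {m : ℕ} {D : Set (Cn (m + 1))} {r : Cn (m + 1) → ℝ} {ρ M c : ℝ}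

/-- All terms on the left of `Phi_ge` are nonnegative, so each can be isolated; 5/2 = 2 + 1/2 by `Re
Φ ≤ |Φ|`. As `M ≥ 1` forces `K ≥ 6`, the cubic bound holds with constant 1. -/
lemma Phi_lower_bounds (h : LeviDefining D r ρ M c) {ε K : ℝ} (hε : IsSmallScale ρ M c ε)
    (hK : 6 * M + 6 * M * (10 * M / c) ≤ K) {y ν : Cn (m + 1)} {e : Fin m → Cn (m + 1)}
    {l : Fin m → ℝ} {ζ z : Cn (m + 1)} (hy : y ∈ frontier D) (hν : IsUnitNormal r y ν)
    (hf : IsLeviFrame (fderiv ℝ (fderiv ℝ r) y) ν e l) (hl : ∀ j, 0 ≤ l j)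
    (hζ : ζ ∈ frontier D) (hz : z ∈ closure D) (hζy : ‖ζ - y‖ ≤ 2 * ‖ζ - z‖)
    (hd : ‖ζ - z‖ < ε / 2) :
    (∀ j, l j * ‖inner ℂ (e j) (ζ - z)‖ ^ 2 ≤ 5 / 2 * ‖Phi r K ζ z‖) ∧
      ‖ζ - z‖ ^ 3 ≤ ‖Phi r K ζ z‖ := by
  have hM := h.bounds.one_le
  have hc := h.pos
  have hε0 := hε.pos
  have hsmall : 10 * M / c * ‖ζ - z‖ ≤ 1 / 2 := by
    rw [div_mul_eq_mul_div, div_le_iff₀ hc]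
    nlinarith [hε.mul_le]
  have hlow := h.Phi_ge hζ hz hy hν hζy (by linarith [hε.two_mul_le]) hsmall hK
  rw [hf.lPart_tangential, ← Complex.ofReal_sum, Complex.ofReal_re] at hlow
  have hre := Complex.re_le_norm (Phi r K ζ z)
  have hterm : ∀ j, 0 ≤ l j * ‖inner ℂ (e j) (ζ - z)‖ ^ 2 := fun j =>
    mul_nonneg (hl j) (by positivity)
  have hK6 : 6 ≤ K := by
    have : 0 ≤ 6 * M * (10 * M / c) := by positivity
    linarith
  have hd3 : 0 ≤ ‖ζ - z‖ ^ 3 := by positivity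
  have hKd : 6 * ‖ζ - z‖ ^ 3 ≤ K * ‖ζ - z‖ ^ 3 := mul_le_mul_of_nonneg_right hK6 hd3
  refine ⟨fun j => ?_, ?_⟩
  · have := Finset.single_le_sum (fun j _ => hterm j) (Finset.mem_univ j)
    linarith
  · have := Finset.sum_nonneg fun j (_ : j ∈ Finset.univ) => hterm j
    linarith

/-- Near the diagonal, the kernel is bounded by an integrable weight in the boundary
coordinates. -/
lemma exists_kernelDensity_mul_le (h : LeviDefining D r ρ M c) {ε K α s : ℝ}
    (hε : IsSmallScale ρ M c ε) (hK : 6 * M + 6 * M * (10 * M / c) ≤ K) (hα : 0 < α)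
    (hs : 0 ≤ s) (hs1 : s ≤ 1) (hsα : 3 * (m + 1) * (1 - s) ≤ α) {χ : ℝ → ℝ}
    (hχ : IsCutoff ε χ) :
    ∃ A > 0, ∀ {y ν : Cn (m + 1)} {e : Fin m → Cn (m + 1)} {l : Fin m → ℝ} {ζ z : Cn (m + 1)},
      y ∈ frontier D → IsUnitNormal r y ν →
      IsLeviFrame (fderiv ℝ (fderiv ℝ r) y) ν e l → (∀ j, 0 ≤ l j) → (∀ j, l j ≤ M) →
      ζ ∈ frontier D → z ∈ closure D → ‖ζ - y‖ ≤ 2 * ‖ζ - z‖ → ‖ζ - z‖ < ε / 2 →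
      kernelDensity r K χ α z ζ * ∏ a, |bdryCoord r K e z ζ a| ^ s ≤ A := by
  have hM := h.bounds.one_le
  have hc := h.pos
  have hε0 := hε.pos
  have hε1 := hε.le_one
  have hK0 : 0 ≤ K := le_trans (by positivity) hK
  obtain ⟨A, hA, hwedge⟩ := h.exists_norm_wedgePow_gCoeff_le hK0
  set p : ℝ := ‖((2 * Real.pi * Complex.I) ^ (m + 1))⁻¹‖ with hp
  have hp0 : 0 ≤ p := norm_nonneg _
  refine ⟨p * A * (5 / 2 * M + 1) ^ m + 1, by positivity, ?_⟩
  intro y ν e l ζ z hy hν hf hl hlM hζ hz hζy hd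
  -- On the diagonal `α > 0` makes the integrand zero, whatever value the form takes there.
  rcases eq_or_ne ζ z with rfl | hne
  · rw [kernelDensity, sub_self, norm_zero, Real.zero_rpow hα.ne', zero_mul, zero_mul]
    positivity
  have hd0 : 0 < ‖ζ - z‖ := norm_pos_iff.2 (sub_ne_zero.2 hne)
  obtain ⟨hlw, hdF⟩ := h.Phi_lower_bounds hε hK hy hν hf hl hζ hz hζy hd
  have hF : 0 < ‖Phi r K ζ z‖ := (pow_pos hd0 3).trans_le hdF
  have hprod : 0 ≤ ∏ j, (l j + ‖ζ - z‖) :=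
    Finset.prod_nonneg fun j _ => add_nonneg (hl j) hd0.le
  have hT : tangentialNorm r ζ (Omega0 (WS r K χ z) ζ) ≤
      p * A * ((∏ j, (l j + ‖ζ - z‖)) / ‖Phi r K ζ z‖ ^ (m + 1)) := by
    refine tangentialNorm_le (by positivity) fun v hv hv' => ?_
    have h1 := hwedge hy hν hf hl hζ hne hζy (by linarith [hε.two_mul_le]) (by linarith)
      (by nlinarith [hε.mul_le]) v hv.1 hv'
    have h2 := wedgePow_WS (h.contDiffAt hζ) hne hχ hd (norm_pos_iff.1 hF) m v
    calc ‖Omega0 (WS r K χ z) ζ v‖ = p * (‖Phi r K ζ z‖⁻¹ ^ (m + 1) *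
          ‖wedgePow (form10 (fun j x => gCoeff r K j x z) ζ)
            (dbarForm (fun j x => gCoeff r K j x z) ζ) m v‖) := by
          rw [← norm_inv, ← norm_pow, ← norm_mul, ← h2, hp, ← norm_mul]
          rfl
      _ ≤ p * (‖Phi r K ζ z‖⁻¹ ^ (m + 1) * (A * ∏ j, (l j + ‖ζ - z‖))) := by gcongr
      _ = _ := by rw [inv_pow]; ring
  have hwk := weighted_kernel_le (w := fun j => ‖inner ℂ (e j) (ζ - z)‖) hd0 (by linarith) hM hl hlM
    (fun j => norm_nonneg _) (fun j => (norm_inner_le_norm (e j) (ζ - z)).trans_eq (by rw [hf.norm_eq, one_mul]))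
    hlw hdF (abs_nonneg _) (Complex.abs_im_le_norm (Phi r K ζ z)) hs hs1 hsα
  have hw := prod_abs_bdryCoord_rpow_le r K e z ζ hs
  have hw0 : 0 ≤ ∏ a, |bdryCoord r K e z ζ a| ^ s :=
    Finset.prod_nonneg fun a _ => Real.rpow_nonneg (abs_nonneg _) _
  have hdα : 0 ≤ ‖ζ - z‖ ^ α := Real.rpow_nonneg (norm_nonneg _) _
  calc kernelDensity r K χ α z ζ * ∏ a, |bdryCoord r K e z ζ a| ^ s
      ≤ ‖ζ - z‖ ^ α * (p * A * ((∏ j, (l j + ‖ζ - z‖)) / ‖Phi r K ζ z‖ ^ (m + 1))) *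
        (|(Phi r K ζ z).im| ^ s *
          ∏ j, (‖inner ℂ (e j) (ζ - z)‖ ^ s * ‖inner ℂ (e j) (ζ - z)‖ ^ s)) := by
        unfold kernelDensity
        gcongr
    _ = p * A * (‖ζ - z‖ ^ α * ((∏ j, (l j + ‖ζ - z‖)) / ‖Phi r K ζ z‖ ^ (m + 1)) *
        (|(Phi r K ζ z).im| ^ s *
          ∏ j, (‖inner ℂ (e j) (ζ - z)‖ ^ s * ‖inner ℂ (e j) (ζ - z)‖ ^ s))) := by ring
    _ ≤ p * A * (5 / 2 * M + 1) ^ m := by gcongr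
    _ ≤ _ := by linarith

open scoped ENNReal in
/-- The integral of the kernel over the part of the boundary close to `z`. -/
lemma exists_lintegral_near_le (h : LeviDefining D r ρ M c) {ε K α : ℝ}
    (hε : IsSmallScale ρ M c ε) (hX : IsCompact (frontier D))
    (hK : 6 * M + 6 * M * (10 * M / c) ≤ K) (hα : 0 < α) {χ : ℝ → ℝ} (hχ : IsCutoff ε χ) :
    ∃ B : ℝ≥0∞, B < ⊤ ∧ ∀ z ∈ closure D, Metric.infDist z (frontier D) < ε / 2 →
      ∫⁻ ζ in frontier D ∩ Metric.ball z (ε / 2), ENNReal.ofReal (kernelDensity r K χ α z ζ)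
        ∂(μH[(2 * (m + 1) - 1 : ℕ)]) ≤ B := by
  -- With `s = 1 - δ`, the first entry gives `3n(1 - s) ≤ α`, so that `d^α` pays for the missing
  -- powers of `Φ`. Also `δ > 0` gives integrability of the weight, and the cap `1 / 2` keeps `s`
  -- nonnegative.
  set δ := min (α / (3 * (m + 1))) (1 / 2) with hδ
  have hδ0 : 0 < δ := by positivity
  have hδ1 : δ ≤ 1 / 2 := min_le_right _ _
  have hδα : 3 * (m + 1) * (1 - (1 - δ)) ≤ α := by
    have : δ ≤ α / (3 * (m + 1)) := min_le_left _ _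
    rw [le_div_iff₀ (by positivity)] at this
    linarith
  obtain ⟨A, hA, hker⟩ := h.exists_kernelDensity_mul_le hε hK hα (s := 1 - δ) (by linarith)
    (by linarith) hδα hχ
  have hfin := lintegral_invWeight_lt_top (ι := Option (Fin m × Bool)) (s := 1 - δ) (by linarith)
    (2 * M) (by linarith [h.bounds.one_le])
  refine ⟨ENNReal.ofReal A * ((Real.toNNReal (4 * m + 4 / c) : ℝ≥0∞) ^ (2 * (m + 1) - 1) *
    ∫⁻ y in Set.univ.pi (fun _ : Option (Fin m × Bool) => Set.Icc (-(2 * M)) (2 * M)),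
      invWeight (1 - δ) y), ?_, ?_⟩
  · exact ENNReal.mul_lt_top ENNReal.ofReal_lt_top (ENNReal.mul_lt_top (by finiteness) hfin)
  intro z hz hzd
  rcases (frontier D).eq_empty_or_nonempty with h0 | h0
  · simp [h0]
  -- For a nearest boundary point, `|z - y| ≤ |ζ - z|` for every `ζ` in `bD`, hence `|ζ - y| ≤ 2 |ζ
  -- - z|`. One frame thus serves the whole near piece.
  obtain ⟨y, hy, hzy⟩ := hX.exists_infDist_eq_dist h0 z
  obtain ⟨ν, e, l, hν, hf, hl, hlM⟩ := h.exists_frame hy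
  have hmeas : MeasurableSet (frontier D ∩ Metric.ball z (ε / 2)) :=
    isClosed_frontier.measurableSet.inter Metric.isOpen_ball.measurableSet
  have hzy' : ‖z - y‖ ≤ ε / 2 := by rw [← dist_eq_norm, ← hzy]; exact hzd.le
  have hint := lintegral_comp_le hmeas
    ((h.continuousOn_bdryCoord K e z).mono Set.inter_subset_left)
    (h.dist_le_bdryCoord hε hy hν hf K hzy') (h.mapsTo_bdryCoord hε hf K z)
    (measurable_invWeight (1 - δ))
  rw [card_index] at hint
  calc _ ≤ ∫⁻ ζ in frontier D ∩ Metric.ball z (ε / 2), ENNReal.ofReal A *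
        invWeight (1 - δ) (bdryCoord r K e z ζ) ∂(μH[(2 * (m + 1) - 1 : ℕ)]) := by
        refine setLIntegral_mono' hmeas fun ζ hζ => le_mul_invWeight hA ?_
        have hζz := hζ.2
        rw [Metric.mem_ball, dist_eq_norm] at hζz
        refine hker hy hν hf hl hlM hζ.1 hz ?_ hζz
        have h1 : ‖z - y‖ ≤ ‖ζ - z‖ := by
          rw [← dist_eq_norm, ← dist_eq_norm, ← hzy, dist_comm ζ z]
          exact Metric.infDist_le_dist_of_mem hζ.1
        have := norm_sub_le_norm_sub_add_norm_sub ζ z y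
        linarith
    _ = ENNReal.ofReal A * ∫⁻ ζ in frontier D ∩ Metric.ball z (ε / 2),
        invWeight (1 - δ) (bdryCoord r K e z ζ) ∂(μH[(2 * (m + 1) - 1 : ℕ)]) :=
        lintegral_const_mul' _ _ ENNReal.ofReal_ne_top
    _ ≤ _ := by gcongr

/-- The kernel is uniformly bounded away from the diagonal. -/
lemma exists_kernelDensity_far_le (h : LeviDefining D r ρ M c) {ε K α : ℝ}
    (hε : IsSmallScale ρ M c ε) (hD : Bornology.IsBounded D)
    (hα : 0 < α) {χ : ℝ → ℝ} (hχ : IsCutoff ε χ)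
    (hS : ∀ ζ ∈ frontier D, ∀ z ∈ closure D, ζ ≠ z → S r K χ ζ z ≠ 0) :
    ∃ A : ℝ, ∀ z ∈ closure D, ∀ ζ ∈ frontier D, ε / 2 ≤ ‖ζ - z‖ →
      kernelDensity r K χ α z ζ ≤ A := by
  have hε0 := hε.pos
  -- On this compact set of pairs `S` has no zero, so joint continuity bounds the kernel uniformly
  -- in `z`.
  have hcpt : IsCompact ((frontier D ×ˢ closure D) ∩
      {q : Cn (m + 1) × Cn (m + 1) | ε / 2 ≤ ‖q.1 - q.2‖}) :=
    ((isCompact_frontier hD).prod hD.isCompact_closure).inter_right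
      (isClosed_le continuous_const (by fun_prop))
  have hne : ∀ {ζ z : Cn (m + 1)}, ε / 2 ≤ ‖ζ - z‖ → ζ ≠ z := by
    rintro ζ z hζz rfl
    rw [sub_self, norm_zero] at hζz
    linarith
  obtain ⟨A, hA⟩ := (hcpt.prod (isCompact_orthonormal (2 * (m + 1 - 1) + 1))).exists_bound_of_continuousOn
    (f := fun q : (Cn (m + 1) × Cn (m + 1)) × (Fin (2 * (m + 1 - 1) + 1) → Cn (m + 1)) =>
      Omega0 (WS r K χ q.1.2) q.1.1 q.2) (by
      rintro ⟨⟨ζ, z⟩, v⟩ ⟨⟨⟨hζ, hz⟩, hζz⟩, -⟩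
      exact (continuousAt_Omega0_WS (h.contDiffAt hζ) (hne hζz) hχ.contDiff
        (hS ζ hζ z hz (hne hζz)) v).continuousWithinAt)
  obtain ⟨R, hR⟩ := hcpt.exists_bound_of_continuousOn
    (f := fun q : Cn (m + 1) × Cn (m + 1) => ‖q.1 - q.2‖ ^ α)
    (Continuous.rpow_const (by fun_prop) fun _ => Or.inr hα.le).continuousOn
  refine ⟨|R| * |A|, fun z hz ζ hζ hζz => ?_⟩
  have hq : (ζ, z) ∈ (frontier D ×ˢ closure D) ∩
      {q : Cn (m + 1) × Cn (m + 1) | ε / 2 ≤ ‖q.1 - q.2‖} := ⟨⟨hζ, hz⟩, hζz⟩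
  refine mul_le_mul ((le_abs_self _).trans ((hR _ hq).trans (le_abs_self R)))
    (tangentialNorm_le (abs_nonneg A) fun v hv _ =>
      (hA ((ζ, z), v) ⟨hq, hv⟩).trans (le_abs_self A)) (tangentialNorm_nonneg _ _ _)
    (abs_nonneg R)

/-- Continuity of the form is available only off `ζ = z`, so the boundary minus `z` is exhausted by
compact sets; at `z` itself the factor `|ζ - z|^α` vanishes. -/
lemma aestronglyMeasurable_kernelDensity (h : LeviDefining D r ρ M c) {ε K α : ℝ}
    (hX : IsCompact (frontier D)) (hα : 0 < α) {χ : ℝ → ℝ} (hχ : IsCutoff ε χ)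
    {z : Cn (m + 1)} (hS : ∀ ζ ∈ frontier D, ζ ≠ z → S r K χ ζ z ≠ 0) :
    AEStronglyMeasurable (kernelDensity r K χ α z) (surfaceMeasure D) := by
  set Y : ℕ → Set (Cn (m + 1)) := fun k => frontier D ∩ {ζ | 1 / ((k : ℝ) + 1) ≤ ‖ζ - z‖} with hY
  have hne : ∀ {k : ℕ} {ζ : Cn (m + 1)}, ζ ∈ Y k → ζ ≠ z := by
    rintro k ζ ⟨-, hζ⟩ rfl
    have h0 : (0 : ℝ) < 1 / ((k : ℝ) + 1) := by positivity
    have h1 : 1 / ((k : ℝ) + 1) ≤ ‖ζ - ζ‖ := hζ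
    rw [sub_self, norm_zero] at h1
    linarith
  have hmeas := measurable_indicator_tangentialNorm (r := r) (Y := Y)
    (η := fun ζ => Omega0 (WS r K χ z) ζ)
    (fun k => hX.inter_right (isClosed_le continuous_const (by fun_prop)))
    (fun k => h.continuousOn_fderiv.mono Set.inter_subset_left) (fun k => by
      rintro ⟨ζ, v⟩ ⟨hζ, -⟩
      have h1 := continuousAt_Omega0_WS (h.contDiffAt hζ.1) (hne hζ) hχ.contDiff
        (hS ζ hζ.1 (hne hζ)) v
      have h2 : ContinuousAt (fun q : Cn (m + 1) × (Fin (2 * (m + 1 - 1) + 1) → Cn (m + 1)) =>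
          ((q.1, z), q.2)) (ζ, v) := by fun_prop
      exact (ContinuousAt.comp (f := fun q : Cn (m + 1) ×
        (Fin (2 * (m + 1 - 1) + 1) → Cn (m + 1)) => ((q.1, z), q.2)) (x := (ζ, v))
        h1 h2).continuousWithinAt)
  have hpow : Measurable fun ζ : Cn (m + 1) => ‖ζ - z‖ ^ α :=
    (Continuous.rpow_const (by fun_prop) fun _ => Or.inr hα.le).measurable
  refine (hpow.mul hmeas).aestronglyMeasurable.congr ?_
  refine (ae_restrict_iff' isClosed_frontier.measurableSet).2 (Filter.Eventually.of_forall ?_)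
  intro ζ hζ
  simp only [Pi.mul_apply, kernelDensity]
  rcases eq_or_ne ζ z with rfl | hζz
  · rw [sub_self, norm_zero, Real.zero_rpow hα.ne', zero_mul, zero_mul]
  · obtain ⟨k, hk⟩ := exists_nat_one_div_lt (norm_pos_iff.2 (sub_ne_zero.2 hζz))
    have hmem : ζ ∈ ⋃ k, Y k := Set.mem_iUnion.2 ⟨k, hζ, hk.le⟩
    rw [Set.indicator_of_mem hmem]

open scoped ENNReal in
/-- The integrals of the kernel over the boundary are uniformly bounded. -/
lemma exists_integral_kernelDensity_le (h : LeviDefining D r ρ M c) {ε K α : ℝ}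
    (hε : IsSmallScale ρ M c ε) (hD : Bornology.IsBounded D)
    (hK : 6 * M + 6 * M * (10 * M / c) ≤ K) (hα : 0 < α) {χ : ℝ → ℝ} (hχ : IsCutoff ε χ)
    (hS : ∀ ζ ∈ frontier D, ∀ z ∈ closure D, ζ ≠ z → S r K χ ζ z ≠ 0) :
    ∃ Cα : ℝ, ∀ z ∈ closure D, Metric.infDist z (frontier D) < ε / 2 →
      Integrable (kernelDensity r K χ α z) (surfaceMeasure D) ∧
      ∫ ζ, kernelDensity r K χ α z ζ ∂(surfaceMeasure D) ≤ Cα := by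
  have hX := isCompact_frontier hD
  obtain ⟨B, hB, hnear⟩ := h.exists_lintegral_near_le hε hX hK hα hχ
  obtain ⟨A, hfar⟩ := h.exists_kernelDensity_far_le (K := K) hε hD hα hχ hS
  have := h.isFiniteMeasure_surfaceMeasure hε hX
  -- The normalization factor between surface measure and the Hausdorff measure in which the near
  -- estimate is stated.
  set κ : NNReal := Measure.addHaarScalarFactor
    (volume : Measure (EuclideanSpace ℝ (Fin (2 * (m + 1) - 1)))) μH[(2 * (m + 1) - 1 : ℕ)] with hκ
  set T : ℝ≥0∞ := κ * B + ENNReal.ofReal A * surfaceMeasure D Set.univ with hT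
  have hTfin : T < ⊤ := ENNReal.add_lt_top.2 ⟨ENNReal.mul_lt_top ENNReal.coe_lt_top hB,
    ENNReal.mul_lt_top ENNReal.ofReal_lt_top (measure_lt_top _ _)⟩
  refine ⟨T.toReal, fun z hz hzd => ?_⟩
  have hm := h.aestronglyMeasurable_kernelDensity (α := α) hX hα hχ fun ζ hζ => hS ζ hζ z hz
  have hnn : 0 ≤ᵐ[surfaceMeasure D] kernelDensity r K χ α z :=
    Filter.Eventually.of_forall fun ζ => kernelDensity_nonneg r K χ α z ζ
  have hball : MeasurableSet (Metric.ball z (ε / 2)) := Metric.isOpen_ball.measurableSet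
  have hle : ∫⁻ ζ, ENNReal.ofReal (kernelDensity r K χ α z ζ) ∂(surfaceMeasure D) ≤ T := by
    rw [← lintegral_add_compl _ hball]
    refine add_le_add ?_ ?_
    · rw [surfaceMeasure, Measure.restrict_restrict hball, Set.inter_comm,
        Measure.euclideanHausdorffMeasure_def, Measure.restrict_smul, ENNReal.smul_def,
        lintegral_smul_measure, smul_eq_mul]
      gcongr
      exact hnear z hz hzd
    · calc _ ≤ ∫⁻ _ in (Metric.ball z (ε / 2))ᶜ, ENNReal.ofReal A ∂(surfaceMeasure D) := by
            refine lintegral_mono_ae ?_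
            rw [surfaceMeasure, Measure.restrict_restrict hball.compl]
            refine (ae_restrict_iff' (hball.compl.inter isClosed_frontier.measurableSet)).2
              (Filter.Eventually.of_forall fun ζ hζ => ENNReal.ofReal_le_ofReal ?_)
            refine hfar z hz ζ hζ.2 ?_
            have := hζ.1
            rwa [Set.mem_compl_iff, Metric.mem_ball, not_lt, dist_eq_norm] at this
        _ ≤ _ := by
            rw [setLIntegral_const]
            gcongr
            exact Set.subset_univ _
  refine ⟨⟨hm, ?_⟩, ?_⟩
  · rw [hasFiniteIntegral_iff_ofReal hnn]
    exact hle.trans_lt hTfin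
  · rw [integral_eq_lintegral_of_nonneg_ae hnn hm]
    exact ENNReal.toReal_mono hTfin.ne hle

lemma exists_isSmallScale (h : LeviDefining D r ρ M c) :
    ∃ ε₀ > 0, ∀ ε, 0 < ε → ε ≤ ε₀ → IsSmallScale ρ M c ε := by
  have hM := h.M_pos
  have hc := h.pos
  have hρ := h.bounds.pos
  refine ⟨min 1 (min (ρ / 2) (c / (36 * M))), by positivity, fun ε hε hle => ?_⟩
  have h1 := hle.trans (min_le_left _ _)
  have h2 := (hle.trans (min_le_right _ _)).trans (min_le_left _ _)
  have h3 := (hle.trans (min_le_right _ _)).trans (min_le_right _ _)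
  rw [le_div_iff₀ (by positivity)] at h3
  exact ⟨hε, h1, by linarith, by linarith⟩

end LeviDefining

end CauchyFantappie

end

/-! ### The theorem. -/

open CauchyFantappie in
theorem proposition11 {n : ℕ} (hn : 1 ≤ n) {k : ℕ∞} (hk : 3 ≤ k) {D U : Set (Cn n)}
    {φ : Cn n → ℝ} (hD : IsPseudoconvexDomain k D U φ) :
    (∃ C : ℝ, 0 < C ∧ LevelsPseudoconvex D U (modDef φ C)) ∧
    ∀ C : ℝ, 0 < C → LevelsPseudoconvex D U (modDef φ C) →
      ∃ K₀ > (0 : ℝ), ∃ ε₀ > (0 : ℝ), ∀ K ≥ K₀, ∀ ε : ℝ, 0 < ε → ε ≤ ε₀ →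
        ∀ χ : ℝ → ℝ, IsCutoff ε χ →
          (∀ ζ ∈ frontier D, ∀ z ∈ closure D, ζ ≠ z → S (modDef φ C) K χ ζ z ≠ 0) ∧
          ∀ α : ℝ, 0 < α → ∃ Cα : ℝ, ∀ z ∈ closure D, Metric.infDist z (frontier D) < ε / 2 →
            MeasureTheory.Integrable (kernelDensity (modDef φ C) K χ α z) (surfaceMeasure D) ∧
            ∫ ζ, kernelDensity (modDef φ C) K χ α z ζ ∂(surfaceMeasure D) ≤ Cα := by
  refine ⟨exists_levelsPseudoconvex hk hD, fun C _ hC => ?_⟩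
  obtain ⟨m, rfl⟩ : ∃ m, n = m + 1 := ⟨n - 1, by omega⟩
  obtain ⟨ρ, M, c, h⟩ := exists_leviDefining_modDef hk hD hC
  have hM := h.M_pos
  have hc := h.pos
  obtain ⟨ε₀, hε₀, hsmall⟩ := h.exists_isSmallScale
  -- The threshold is the one required by `Phi_ge`. Both it and `ε₀` depend only on `ρ`, `M` and
  -- `c`, hence not on the cut-off or on `α`.
  refine ⟨6 * M + 6 * M * (10 * M / c), by positivity, ε₀, hε₀, fun K hK ε hε hle χ hχ => ?_⟩
  have hs := hsmall ε hε hle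
  have hS : ∀ ζ ∈ frontier D, ∀ z ∈ closure D, ζ ≠ z → S (modDef φ C) K χ ζ z ≠ 0 := by
    intro ζ hζ z hz hne
    refine h.S_ne_zero hζ hz hne hK hs.two_mul_le ?_ hχ
    rw [div_mul_eq_mul_div, div_le_iff₀ hc]
    nlinarith [hs.mul_le, mul_pos hM hε]
  exact ⟨hS, fun α hα => h.exists_integral_kernelDensity_le hs hD.isBounded hK hα hχ hS⟩
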